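/- **Language.** Work over a language of arithmetic consisting of $0$, $S$, $=$ and further function and relation symbols with fixed standard interpretations on $\mathbb N$, together with a unary predicate $I$ (we write $t\in I$). A formula is *simple* if it contains no closed terms. The language is closed under adding, for each quantifier-free simple formula $\phi(x,y_1,\dots,y_n)$, an $n$-ary Skolem function $c_{\exists x\phi}$; $\phi$ may itself contain Skolem functions. All formulas are quantifier-free; $\exists x\,\phi(x,\vec t)$ abbreviates $\phi(c_{\exists x\phi}(\vec t),\vec t)$ and $\forall x\,\phi(x,\vec t)$ abbreviates $\phi(c_{\exists x\neg\phi}(\vec t),\vec t)$. Fix a simple formula $B(x,y,X)$ without Skolem functions in which $X$ occurs, and occurs only positively; $A(y,X)$ is $\forall x\,B(x,y,X)$. Fix a finite list $\mathrm{Cr}$ of closed critical formulas, each of one of the forms *Pred* $\neg s=0\to\exists x\,s=Sx$; *Epsilon* $\phi(t,\vec s)\to\exists x\,\phi(x,\vec s)$; *Induction* $\phi(0,\vec s)\wedge\neg\phi(t,\vec s)\to\exists x(\phi(x,\vec s)\wedge\neg\phi(Sx,\vec s))$; *Inductive definition* $A(t,I)\to t\in I$; *Closure* $\forall x(A(x,\phi)\to\phi(x,\vec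 s))\to\forall x(x\in I\to\phi(x,\vec s))$ (with $\phi$ simple). **Substitutions.** A canonical expression is a formula $n\in I$ or a term $c_{\exists x\phi}(\vec a)$ with numerals $n,\vec a$. Put $c_n=c_{\exists x\neg B(x,y,I)}(n)$ and $\Omega=\omega_1$. Let the simple rank $rk_s$ be the nesting depth of Skolem functions (so $rk_s(c_{\exists x\phi})=rk_s(\phi)+1$). Ranks: $rk(n\in I)=rk(c_n)=\Omega$; otherwise $rk(c_{\exists x\phi}(\vec a))$ is $\Omega+rk_s(c_{\exists x\phi})+1$ if $I$ occurs in $\phi$ (at any depth), and $rk_s(c_{\exists x\phi})$ if not. An $\epsilon$-substitution is a partial function $S$ on canonical expressions; the value of a term is $?$ or a positive numeral, the value of a formula is $?$ or $\top$. The reduction $|\cdot|_S$ replaces canonical expressions in $\mathrm{dom}(S)$ by their values ($?$ being read as $0$, respectively $\bot$) and evaluates function symbols of arithmetic on numerals, repeatedly. $S\vDash\phi$ means that $|\phi|_S$ is a true sentence of arithmetic; $S$ decides $\phi$ if $S\vDash\phi$ or $S\vDash\neg\phi$; $\overline S$ extends $S$ by the value $?$ elsewhere. Let $F(e,?)=\top$,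 $F(c_{\exists x\phi}(\vec a),u)=\phi(u,\vec a)\wedge\bigwedge_{v<u}\neg\phi(v,\vec a)$, $F(n\in I,\top)=A(n,I)$. $S$ is correct if $\overline S\vDash F(e,u)$ for all $(e,u)\in S$. $S$ is computationally inconsistent if $S\vDash\neg F(e,u)$ for some $(e,u)\in S$, or if $(c_n,u),(n\in I,\top)\in S$ for some $n$ and some $u\ne{?}$. $S^-_{=\Omega}$ consists of the pairs $(c_m,u)$, $u\neq{?}$, and $(m\in I,?)$ in $S$; $S^+_{=\Omega}$ of the pairs $(c_m,?)$ and $(m\in I,\top)$ in $S$. $S_{<r}$, $S_{\le r}$ denote restriction to expressions of that rank. **Sequents.** A sequent $\Theta=(S,P,V,\mathcal F)$ consists of an $\epsilon$-substitution $S$; an enumeration $P$ without repetitions of the formulas with $(n\in I,\top)\in S$; a function $V$ on the members of $P$ whose values are finite $\epsilon$-substitutions $W$ with $W=W^-_{=\Omega}$; and a function $\mathcal F$ into $\{t,f\}$ whose domain is the set of $e\in\mathrm{dom}(S)$ with $S(e)={?}$ or $rk(e)=\Omega$. $\emptyset$ is the empty sequent. $P=\langle n_1\in I,\dots,n_k\in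 I\rangle$ is admissible if $\overline{\{(n_j\in I,\top):j<i\}}\vDash B(0,n_i,I)$ for each $i$. **$H$-step.** To an unsatisfied critical formula (one with $S\vDash\neg Cr$) is assigned a pair $(e,v)$; write $\vec a=|\vec s|_S$. *Pred*: $e=c_{\exists x\,y=Sx}(|s|_S)$, $v=|s|_S-1$. *Epsilon*: $e=c_{\exists x\phi}(\vec a)$, $v=|t|_S$. *Induction*: $e=c_{\exists x(\phi(x)\wedge\neg\phi(Sx))}(\vec a)$ and $v$ is the least $m<|t|_S$ with $\phi(m,\vec s)\wedge\neg\phi(Sm,\vec s)$ true. *Inductive definition*: $e$ is $|t|_S\in I$, $v=\top$. *Closure*: let $n\in I$ be the first member of $P$ with $S\vDash\neg\phi(n,\vec s)$; if $S\vDash\neg A(n,\phi)$ then $e=c_n$, $v=S(c_{\exists z\neg B(z,x,\phi)}(n,\vec a))$; if $S\vDash A(n,\phi)$ then $e=c_{\exists x\neg(A(x,\phi)\to\phi(x))}(\vec a)$, $v=n$. The $H$-step applies to $\Theta$ if $S$ is correct, $S\vDash\neg Cr$ for some $Cr\in\mathrm{Cr}$, and all calculations take place in $S$, i.e.: $S$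 decides all critical formulas; the pairs of all unsatisfied ones are computed in $S$, and $(e(\Theta),v(\Theta))$ is the pair whose $e$ has least rank, of the first such critical formula; $S$ decides $F(e',u)$ for all $(e',u)\in S$ with $e'$ a term, and $F(e(\Theta),v(\Theta))$; $(e(\Theta),?)\in S$; if $e(\Theta)=c_n$ then $n\in I\in\mathrm{dom}(S)$; if $e(\Theta)$ is $n\in I$ then $c_n\in\mathrm{dom}(S)$; if $e(\Theta)$ is a term of rank $\Omega$ and $(c_n,?)\in S$ then $n\in I\in\mathrm{dom}(S)$. Then, with $e=e(\Theta)$, $v=v(\Theta)$, $H(\Theta)=(S',P',V',\mathcal F')$ is: - if $rk(e)\ne\Omega$: $S'$ is $S_{\le rk(e)}$ with the value of $e$ changed to $v$; $P'=V'=\emptyset$ if $rk(e)<\Omega$, and $P'=P$, $V'=V$ if $rk(e)>\Omega$; - if $e$ is $n\in I$: $S'=S_{<\Omega}\cup S^+_{=\Omega}\cup\{(e,\top)\}$, $P'=P^\frown\langle e\rangle$, $V'=V\cup\{(e,S^-_{=\Omega})\}$; - if $e=c_n$: $P'$ is the longest initial segment of $P$ not containing $n\in I$, $V'=V\restriction P'$,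 and $S'$ consists of $(c_n,v)$, $S_{<\Omega}$, the pairs $(m\in I,\top)$ and those $(c_m,?)\in S$ with $m\in I$ in $P'$, and $V(n\in I)$ if $n\in I$ is in $P$, respectively $S^-_{=\Omega}$ if it is not. $\mathcal F'$ agrees with $\mathcal F$ on $\mathrm{dom}(S)$ and is $t$ on new expressions. An expression $e'\in\mathrm{dom}(S)$ is active at $\Theta$ if $rk(e')=rk(e(\Theta))$ and $e'\notin\mathrm{dom}(S')$ or $S'(e')\ne S(e')$. **Rules.** $(e,u,i),\Theta$ is $\Theta$ with $(e,u)$ added to $S$ and $(e,i)$ to $\mathcal F$ (no $i$ is given when $u\neq{?}$ and $rk(e)\ne\Omega$); it presupposes $e\notin\mathrm{dom}(S)$. Below, $u$ ranges over positive numerals. Axioms: *AxF*: $S$ is computationally inconsistent; *AxS*: $S\vDash Cr$ for all $Cr\in\mathrm{Cr}$; *AxH*: the $H$-step applies to $\Theta$ and some active $e'$ has $\mathcal F(e')=f$. Inferences with conclusion $\Theta$ and main expression $e$: - $Cut$ ($e$ a term): premises $(e,?,f),\Theta$ and, for all $u$, $(e,u),\Theta$ (if $rk(e)\ne\Omega$),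 respectively $(e,u,f),\Theta$ (if $rk(e)=\Omega$); - $CutFr$ ($e$ a term): the same with first premise $(e,?,t),\Theta$; - $Cut$ ($e$ a formula $n\in I$): premises $(e,?,f),\Theta$ and, for all $P_e$ proper for $e,\Theta$ and all $V_e$, the sequent $(e,\top,f,P_e,V_e),\Theta$, which is obtained by adding $(m\in I,\top)$ to $S$ and $(m\in I,f)$ to $\mathcal F$ for all $m\in I$ in $P_e$, appending $P_e$ to $P$, and adding $V_e$ to $V$. Here $P_e$ is *proper* if it is a sequence of distinct formulas $m\in I$ with last element $e$, none of them in $P$ or in $\mathrm{dom}(S)$, such that $P^\frown P_e$ is admissible and $(c_m,u)\notin S$ for $m\in I$ in $P_e$ and $u\ne{?}$; $V_e$ is a function on the members of $P_e$ with values as required for $V$; - $Fr$: premise $(e,?,t),\Theta$; - $H$: premise $H(\Theta)$, provided the $H$-step applies to $\Theta$ with $e=e(\Theta)$, $(e,?)\in S$, $\mathcal F(e)=t$, and $\mathcal F(e')=t$ for all active $e'$. A *deduction* from a set $\mathcal S$ of sequents is a well-founded tree built from elements of $\mathcal S$, axioms and inferences; a *derivation* is a deduction from $\emptyset$. For an ordinal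 $r$, a deduction is an *$r$-deduction* if its $Cut$s have main expressions of rank $<r$, it has no $CutFr$, and its $Fr$ and $H$ inferences have rank $\ge r$. It is an *$r^+$-deduction* if all $Cut$s have rank $<r$, all $CutFr$s rank $=r$, all $Fr$s rank $>r$, and all $H$s rank $\ge r$. An *$r$-path* for $\Theta$ is a sequence $\Theta_0=\emptyset,\dots,\Theta_n=\Theta$ that is a path in some $r$-deduction. *Pruning* a deduction replaces each $CutFr$ inference by the $Fr$ inference with the same main expression, keeping only the subdeduction of $(e,?,t),\Theta$. **Theorem (predicative cut reduction).** Let $r\ne\Omega$ be an ordinal. If $\Theta$ has an $(r+1)$-derivation and $\Theta$ has an $(r+1)$-path, then there is an $r^+$-derivation $d'$ of $\Theta$, and pruning $d'$ yields an $r$-derivation of $\Theta$. -/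

import Mathlib

noncomputable section

namespace EpsID1


/-! ## The Skolemized quantifier-free language -/

mutual
/-- Terms with free variables among `Fin k`. The symbols of arithmetic are `0`, `S` and the function
symbols of `L`; `skolem φ ts` is `c_{∃x φ(x,y₁,…,yₙ)}(t₁,…,tₙ)`, where variable `0` of `φ` is `x` and
variable `i + 1` is `yᵢ`. -/
inductive Tm (L : FirstOrder.Language.{0, 0}) : ℕ → Type
  | var {k : ℕ} (i : Fin k) : Tm L k
  | zero {k : ℕ} : Tm L k
  | succ {k : ℕ} (t : Tm L k) : Tm L k
  | func {k n : ℕ} (f : L.Functions n) (ts : Fin n → Tm L k) : Tm L k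
  | skolem {k n : ℕ} (φ : Fm L (n + 1)) (ts : Fin n → Tm L k) : Tm L k

/-- Quantifier-free formulas with free variables among `Fin k`; `mem t` is `t ∈ I`. -/
inductive Fm (L : FirstOrder.Language.{0, 0}) : ℕ → Type
  | tru {k : ℕ} : Fm L k
  | fls {k : ℕ} : Fm L k
  | eq {k : ℕ} (s t : Tm L k) : Fm L k
  | rel {k n : ℕ} (R : L.Relations n) (ts : Fin n → Tm L k) : Fm L k
  | mem {k : ℕ} (t : Tm L k) : Fm L k
  | neg {k : ℕ} (φ : Fm L k) : Fm L k
  | and {k : ℕ} (φ ψ : Fm L k) : Fm L k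
  | or {k : ℕ} (φ ψ : Fm L k) : Fm L k
end

variable {L : FirstOrder.Language.{0, 0}}

/-- `φ → ψ`, as an abbreviation. -/
def Fm.imp {k : ℕ} (φ ψ : Fm L k) : Fm L k := .or (.neg φ) ψ

/-- The numeral `S ⋯ S 0`. -/
def Tm.num {k : ℕ} : ℕ → Tm L k
  | 0 => .zero
  | n + 1 => .succ (Tm.num n)

/-- The number denoted by a term that is a numeral; `none` if the term is not a numeral. -/
def Tm.numVal {k : ℕ} : Tm L k → Option ℕ
  | .zero => some 0
  | .succ t => t.numVal.map (· + 1)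
  | .var _ => none
  | .func _ _ => none
  | .skolem _ _ => none

/-- Simultaneous substitution of terms for the free variables. -/
def Tm.subst {k m : ℕ} (σ : Fin k → Tm L m) : Tm L k → Tm L m
  | .var i => σ i
  | .zero => .zero
  | .succ t => .succ (t.subst σ)
  | .func f ts => .func f (fun i => (ts i).subst σ)
  | .skolem φ ts => .skolem φ (fun i => (ts i).subst σ)

/-- Simultaneous substitution of terms for the free variables. -/
def Fm.subst {k m : ℕ} (σ : Fin k → Tm L m) : Fm L k → Fm L m
  | .tru => .tru
  | .fls => .fls
  | .eq s t => .eq (s.subst σ) (t.subst σ)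
  | .rel R ts => .rel R (fun i => (ts i).subst σ)
  | .mem t => .mem (t.subst σ)
  | .neg φ => .neg (φ.subst σ)
  | .and φ ψ => .and (φ.subst σ) (ψ.subst σ)
  | .or φ ψ => .or (φ.subst σ) (ψ.subst σ)

/-- Replace every atom `t ∈ X` (written `mem t`) by the formula `ψ t`. -/
def Fm.replaceMem {k : ℕ} (ψ : Tm L k → Fm L k) : Fm L k → Fm L k
  | .tru => .tru
  | .fls => .fls
  | .eq s t => .eq s t
  | .rel R ts => .rel R ts
  | .mem t => ψ t
  | .neg φ => .neg (φ.replaceMem ψ)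
  | .and φ χ => .and (φ.replaceMem ψ) (χ.replaceMem ψ)
  | .or φ χ => .or (φ.replaceMem ψ) (χ.replaceMem ψ)

/-- The term contains no Skolem function. -/
def Tm.SkolemFree {k : ℕ} : Tm L k → Prop
  | .var _ => True
  | .zero => True
  | .succ t => t.SkolemFree
  | .func _ ts => ∀ i, (ts i).SkolemFree
  | .skolem _ _ => False

/-- The formula contains no Skolem function, i.e. it is a quantifier-free formula of the language of
`ID₁` (in which `I` may occur). -/
def Fm.SkolemFree {k : ℕ} : Fm L k → Prop
  | .tru => True
  | .fls => True
  | .eq s t => s.SkolemFree ∧ t.SkolemFree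
  | .rel _ ts => ∀ i, (ts i).SkolemFree
  | .mem t => t.SkolemFree
  | .neg φ => φ.SkolemFree
  | .and φ ψ => φ.SkolemFree ∧ ψ.SkolemFree
  | .or φ ψ => φ.SkolemFree ∧ ψ.SkolemFree

/-- The formula is in the language of Peano arithmetic: no Skolem function and no `I`. -/
def Fm.IsArith {k : ℕ} : Fm L k → Prop
  | .tru => True
  | .fls => True
  | .eq s t => s.SkolemFree ∧ t.SkolemFree
  | .rel _ ts => ∀ i, (ts i).SkolemFree
  | .mem _ => False
  | .neg φ => φ.IsArith
  | .and φ ψ => φ.IsArith ∧ ψ.IsArith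
  | .or φ ψ => φ.IsArith ∧ ψ.IsArith

/-- The term and all its subterms are not closed. -/
def Tm.NoClosed {k : ℕ} : Tm L k → Prop
  | .var _ => True
  | .zero => False
  | .succ t => t.NoClosed
  | .func (n := n) _ ts => 0 < n ∧ ∀ i, (ts i).NoClosed
  | .skolem (n := n) _ ts => 0 < n ∧ ∀ i, (ts i).NoClosed

/-- The formula contains no closed terms. -/
def Fm.Simple {k : ℕ} : Fm L k → Prop
  | .tru => True
  | .fls => True
  | .eq s t => s.NoClosed ∧ t.NoClosed
  | .rel _ ts => ∀ i, (ts i).NoClosed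
  | .mem t => t.NoClosed
  | .neg φ => φ.Simple
  | .and φ ψ => φ.Simple ∧ ψ.Simple
  | .or φ ψ => φ.Simple ∧ ψ.Simple

mutual
/-- The term belongs to the Skolemized language: every Skolem function `c_{∃x φ}` in it, at any depth,
has a simple `φ`. -/
def Tm.InLang {k : ℕ} : Tm L k → Prop
  | .var _ => True
  | .zero => True
  | .succ t => t.InLang
  | .func _ ts => ∀ i, (ts i).InLang
  | .skolem φ ts => φ.Simple ∧ φ.InLang ∧ ∀ i, (ts i).InLang

/-- The formula belongs to the Skolemized language. -/
def Fm.InLang {k : ℕ} : Fm L k → Prop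
  | .tru => True
  | .fls => True
  | .eq s t => s.InLang ∧ t.InLang
  | .rel _ ts => ∀ i, (ts i).InLang
  | .mem t => t.InLang
  | .neg φ => φ.InLang
  | .and φ ψ => φ.InLang ∧ ψ.InLang
  | .or φ ψ => φ.InLang ∧ ψ.InLang
end

mutual
/-- `I` occurs in the term (inside a Skolem function). -/
def Tm.HasI {k : ℕ} : Tm L k → Prop
  | .var _ => False
  | .zero => False
  | .succ t => t.HasI
  | .func _ ts => ∃ i, (ts i).HasI
  | .skolem φ ts => φ.HasI ∨ ∃ i, (ts i).HasI

/-- `I` occurs in the formula, possibly inside a Skolem function. -/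
def Fm.HasI {k : ℕ} : Fm L k → Prop
  | .tru => False
  | .fls => False
  | .eq s t => s.HasI ∨ t.HasI
  | .rel _ ts => ∃ i, (ts i).HasI
  | .mem _ => True
  | .neg φ => φ.HasI
  | .and φ ψ => φ.HasI ∨ ψ.HasI
  | .or φ ψ => φ.HasI ∨ ψ.HasI
end

mutual
/-- The simple rank: the least stage of the language hierarchy in which the term appears. -/
def Tm.simpleRank {k : ℕ} : Tm L k → ℕ
  | .var _ => 0
  | .zero => 0
  | .succ t => t.simpleRank
  | .func _ ts => Finset.univ.sup fun i => (ts i).simpleRank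
  | .skolem φ ts => max (φ.simpleRank + 1) (Finset.univ.sup fun i => (ts i).simpleRank)

/-- The simple rank: the least stage of the language hierarchy in which the formula appears. -/
def Fm.simpleRank {k : ℕ} : Fm L k → ℕ
  | .tru => 0
  | .fls => 0
  | .eq s t => max s.simpleRank t.simpleRank
  | .rel _ ts => Finset.univ.sup fun i => (ts i).simpleRank
  | .mem t => t.simpleRank
  | .neg φ => φ.simpleRank
  | .and φ ψ => max φ.simpleRank ψ.simpleRank
  | .or φ ψ => max φ.simpleRank ψ.simpleRank
end

/-- All occurrences of `X` (written `mem`) in the formula are positive (`b = true`),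
respectively negative (`b = false`). -/
def Fm.OnlySign {k : ℕ} (b : Bool) : Fm L k → Prop
  | .tru => True
  | .fls => True
  | .eq _ _ => True
  | .rel _ _ => True
  | .mem _ => b = true
  | .neg φ => φ.OnlySign (!b)
  | .and φ ψ => φ.OnlySign b ∧ ψ.OnlySign b
  | .or φ ψ => φ.OnlySign b ∧ ψ.OnlySign b

/-- `φ(s, t₁, …, tₙ)`. -/
def Fm.inst {n k : ℕ} (φ : Fm L (n + 1)) (s : Tm L k) (ts : Fin n → Tm L k) : Fm L k :=
  φ.subst (Fin.cons s ts)

/-- `∃x φ(x, t⃗)`, an abbreviation for `φ(c_{∃x φ}(t⃗), t⃗)`. -/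
def Fm.ex {n k : ℕ} (φ : Fm L (n + 1)) (ts : Fin n → Tm L k) : Fm L k :=
  φ.inst (.skolem φ ts) ts

/-- `∀x φ(x, t⃗)`, an abbreviation for `φ(c_{∃x ¬φ}(t⃗), t⃗)`. -/
def Fm.all {n k : ℕ} (φ : Fm L (n + 1)) (ts : Fin n → Tm L k) : Fm L k :=
  φ.inst (.skolem φ.neg ts) ts

/-- `B(z, x, φ(·, y⃗))` in the variables `z, x, y⃗`, for `B(z, x, X)` and `φ(x, y⃗)`. -/
def instB (B : Fm L 2) {n : ℕ} (φ : Fm L (n + 1)) : Fm L (n + 2) :=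
  (B.subst ![.var 0, .var 1]).replaceMem fun t => φ.inst t fun i => .var i.succ.succ

/-- `A(t, I) = ∀x B(x, t, I)`. -/
def formA {k : ℕ} (B : Fm L 2) (t : Tm L k) : Fm L k := Fm.all (n := 1) B fun _ => t

/-- `A(t, φ(·, s⃗)) = ∀z B(z, t, φ(·, s⃗))`. -/
def formAOf {n k : ℕ} (B : Fm L 2) (φ : Fm L (n + 1)) (t : Tm L k) (ts : Fin n → Tm L k) : Fm L k :=
  Fm.all (n := n + 1) (instB B φ) (Fin.cons t ts)

/-! ## Critical formulas -/

/-- Closed critical formulas, with the data of the axiom they are instances of. -/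
inductive Crit (L : FirstOrder.Language.{0, 0}) : Type
  | pred (s : Tm L 0)
  | epsilon {n : ℕ} (φ : Fm L (n + 1)) (t : Tm L 0) (ts : Fin n → Tm L 0)
  | induction {n : ℕ} (φ : Fm L (n + 1)) (t : Tm L 0) (ts : Fin n → Tm L 0)
  | inductiveDef (t : Tm L 0)
  | closure {n : ℕ} (φ : Fm L (n + 1)) (ts : Fin n → Tm L 0)

/-- `y = S x`. -/
def predFm : Fm L (1 + 1) := .eq (.var 1) (.succ (.var 0))

/-- `φ(x, y⃗) ∧ ¬ φ(S x, y⃗)`. -/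
def indFm {n : ℕ} (φ : Fm L (n + 1)) : Fm L (n + 1) :=
  .and φ (.neg (φ.inst (.succ (.var 0)) fun i => .var i.succ))

/-- `A(x, φ(·, y⃗)) → φ(x, y⃗)`. -/
def progFm (B : Fm L 2) {n : ℕ} (φ : Fm L (n + 1)) : Fm L (n + 1) :=
  (formAOf B φ (.var 0) fun i => .var i.succ).imp φ

/-- `x ∈ I → φ(x, y⃗)`. -/
def inclFm {n : ℕ} (φ : Fm L (n + 1)) : Fm L (n + 1) := (Fm.mem (.var 0)).imp φ

/-- The critical formula itself. -/
def Crit.fm (B : Fm L 2) : Crit L → Fm L 0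
  | .pred s => (Fm.neg (.eq s .zero)).imp (predFm.ex fun _ => s)
  | .epsilon φ t ts => (φ.inst t ts).imp (φ.ex ts)
  | .induction φ t ts =>
      (Fm.and (φ.inst .zero ts) (.neg (φ.inst t ts))).imp ((indFm φ).ex ts)
  | .inductiveDef t => (formA B t).imp (.mem t)
  | .closure φ ts => ((progFm B φ).all ts).imp ((inclFm φ).all ts)

/-- The critical formula belongs to the Skolemized language. -/
def Crit.InLang : Crit L → Prop
  | .pred s => s.InLang
  | .epsilon φ t ts => φ.Simple ∧ φ.InLang ∧ t.InLang ∧ ∀ i, (ts i).InLang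
  | .induction φ t ts => φ.Simple ∧ φ.InLang ∧ t.InLang ∧ ∀ i, (ts i).InLang
  | .inductiveDef t => t.InLang
  | .closure φ ts => φ.Simple ∧ φ.InLang ∧ ∀ i, (ts i).InLang

/-! ## Canonical expressions and `ε`-substitutions -/

/-- `term φ a` is `c_{∃x φ}(a₁, …, aₙ)` with numerals `aᵢ`; `mem n` is the formula `n ∈ I`. -/
inductive CExpr (L : FirstOrder.Language.{0, 0}) : Type
  | term {n : ℕ} (φ : Fm L (n + 1)) (a : Fin n → ℕ)
  | mem (n : ℕ)

/-- The canonical expression belongs to the Skolemized language. -/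
def CExpr.InLang : CExpr L → Prop
  | .term φ _ => φ.Simple ∧ φ.InLang
  | .mem _ => True

def CExpr.IsTerm : CExpr L → Prop
  | .term _ _ => True
  | .mem _ => False

/-- `c_n`, i.e. `c_{∃x ¬B(x,y,I)}(n)`. -/
def cTerm (B : Fm L 2) (n : ℕ) : CExpr L := .term (n := 1) B.neg fun _ => n

/-- The ordinal `Ω`. -/
def Om : Ordinal.{0} := Ordinal.omega 1

open Classical in
/-- The rank of a canonical expression. -/
def rk (B : Fm L 2) : CExpr L → Ordinal.{0}
  | .term (n := n) φ _ =>
      if (⟨n, φ⟩ : Σ m, Fm L (m + 1)) = ⟨1, B.neg⟩ then Om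
      else if φ.HasI then Om + ((φ.simpleRank + 1 : ℕ) : Ordinal) + 1
      else ((φ.simpleRank + 1 : ℕ) : Ordinal)
  | .mem _ => Om

/-- Values: the default symbol `?`, numerals, and `⊤`. -/
inductive Val : Type
  | unk
  | num (k : ℕ)
  | top

/-- Terms take `?` or a positive numeral as value, formulas take `?` or `⊤`. -/
def Val.Fits : Val → CExpr L → Prop
  | .unk, _ => True
  | .num k, .term _ _ => 0 < k
  | .top, .mem _ => True
  | _, _ => False

/-- Partial functions from canonical expressions to values. -/
abbrev Subst (L : FirstOrder.Language.{0, 0}) : Type := CExpr L → Option Val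

/-- The partial function is an `ε`-substitution. -/
def IsSubst (S : Subst L) : Prop := ∀ e u, S e = some u → e.InLang ∧ u.Fits e

/-- The standard extension: everything outside the domain gets the value `?`. -/
def Subst.ext (S : Subst L) : Subst L := fun e => some ((S e).getD .unk)

section Eval

variable [L.Structure ℕ]

open Classical in
/-- The reduction `|t|_S`. -/
def Tm.reduce (S : Subst L) {k : ℕ} : Tm L k → Tm L k
  | .var i => .var i
  | .zero => .zero
  | .succ t => .succ (t.reduce S)
  | .func f ts =>
      if ∀ i, ((ts i).reduce S).numVal.isSome then
        .num (FirstOrder.Language.Structure.funMap f fun i => (((ts i).reduce S).numVal.getD 0 : ℕ))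
      else .func f fun i => (ts i).reduce S
  | .skolem φ ts =>
      if ∀ i, ((ts i).reduce S).numVal.isSome then
        match S (.term φ fun i => ((ts i).reduce S).numVal.getD 0) with
        | some .unk => .zero
        | some (.num m) => .num m
        | _ => .skolem φ fun i => (ts i).reduce S
      else .skolem φ fun i => (ts i).reduce S

/-- `|t|_S` is the numeral of `n`. -/
def Tm.HasVal (S : Subst L) (t : Tm L 0) (n : ℕ) : Prop := (t.reduce S).numVal = some n

/-- The reduction `|φ|_S`. -/
def Fm.reduce (S : Subst L) {k : ℕ} : Fm L k → Fm L k
  | .tru => .tru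
  | .fls => .fls
  | .eq s t => .eq (s.reduce S) (t.reduce S)
  | .rel R ts => .rel R fun i => (ts i).reduce S
  | .mem t =>
      match (t.reduce S).numVal with
      | some n =>
          match S (.mem n) with
          | some .top => .tru
          | some .unk => .fls
          | _ => .mem (t.reduce S)
      | none => .mem (t.reduce S)
  | .neg φ => .neg (φ.reduce S)
  | .and φ ψ => .and (φ.reduce S) (ψ.reduce S)
  | .or φ ψ => .or (φ.reduce S) (ψ.reduce S)

/-- Value of a term of arithmetic in the standard model (only used for Skolem-free terms). -/
def Tm.value {k : ℕ} (ρ : Fin k → ℕ) : Tm L k → ℕ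
  | .var i => ρ i
  | .zero => 0
  | .succ t => t.value ρ + 1
  | .func f ts => FirstOrder.Language.Structure.funMap f fun i => (ts i).value ρ
  | .skolem _ _ => 0

/-- Truth of a formula of arithmetic in the standard model (only used for arithmetical formulas). -/
def Fm.Holds {k : ℕ} (ρ : Fin k → ℕ) : Fm L k → Prop
  | .tru => True
  | .fls => False
  | .eq s t => s.value ρ = t.value ρ
  | .rel R ts => FirstOrder.Language.Structure.RelMap R fun i => ((ts i).value ρ : ℕ)
  | .mem _ => False
  | .neg φ => ¬ φ.Holds ρ
  | .and φ ψ => φ.Holds ρ ∧ ψ.Holds ρ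
  | .or φ ψ => φ.Holds ρ ∨ ψ.Holds ρ

/-- `S ⊨ φ`: the reduction `|φ|_S` is a true sentence of arithmetic. -/
def Models (S : Subst L) (φ : Fm L 0) : Prop :=
  (φ.reduce S).IsArith ∧ (φ.reduce S).Holds Fin.elim0

/-- `S` decides `φ`. -/
def Decides (S : Subst L) (φ : Fm L 0) : Prop := Models S φ ∨ Models S φ.neg

/-- `φ(u, a⃗)` with numerals. -/
def instNum {n : ℕ} (φ : Fm L (n + 1)) (u : ℕ) (a : Fin n → ℕ) : Fm L 0 :=
  φ.inst (.num u) fun i => .num (a i)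

/-- The formula `F(e, u)`. -/
def justif (B : Fm L 2) : CExpr L → Val → Fm L 0
  | .term φ a, .num u =>
      .and (instNum φ u a)
        ((List.range u).foldr (fun v χ => .and (.neg (instNum φ v a)) χ) .tru)
  | .mem n, .top => formA B (.num n)
  | _, _ => .tru

/-- `S` is correct. -/
def Correct (B : Fm L 2) (S : Subst L) : Prop :=
  ∀ e u, S e = some u → Models S.ext (justif B e u)

/-- `S` is computationally inconsistent. -/
def CompInconsistent (B : Fm L 2) (S : Subst L) : Prop :=
  (∃ e u, S e = some u ∧ Models S (justif B e u).neg) ∨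
    ∃ n u, S (cTerm B n) = some (.num u) ∧ S (.mem n) = some .top

open Classical in
/-- The substitution `{(m ∈ I, ⊤) | m ∈ P}`. -/
def substOfList (P : List ℕ) : Subst L
  | .mem m => if m ∈ P then some .top else none
  | .term _ _ => none

/-- A sequence of formulas `n ∈ I` (given by the numbers `n`) is admissible. -/
def Admissible (B : Fm L 2) (P : List ℕ) : Prop :=
  ∀ P₁ n P₂, P = P₁ ++ n :: P₂ →
    Models (substOfList P₁).ext (B.subst ![.zero, .num n])

end Eval

open Classical in
/-- The negative rank `Ω` part `S⁻_{=Ω}`: the pairs `(c_m, u)` with `u ≠ ?` and `(m ∈ I, ?)`. -/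
def negPart (B : Fm L 2) (S : Subst L) : Subst L := fun e =>
  match e, S e with
  | .term φ a, some (.num u) => if rk B (.term φ a) = Om then some (.num u) else none
  | .mem _, some .unk => some .unk
  | _, _ => none

open Classical in
/-- The positive rank `Ω` part `S⁺_{=Ω}`: the pairs `(c_m, ?)` and `(m ∈ I, ⊤)`. -/
def posPart (B : Fm L 2) (S : Subst L) : Subst L := fun e =>
  match e, S e with
  | .term φ a, some .unk => if rk B (.term φ a) = Om then some .unk else none
  | .mem _, some .top => some .top
  | _, _ => none

/-! ## Sequents -/

/-- The data `(S, P, V, F)` of a sequent. The list `P` and the domain of `V` contain `n` for the formula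
`n ∈ I`; in `F`, `true` is `t` and `false` is `f`. -/
structure Sequent (L : FirstOrder.Language.{0, 0}) : Type where
  S : Subst L
  P : List ℕ
  V : ℕ → Option (Subst L)
  F : CExpr L → Option Bool

/-- A possible value of the function `V`: a finite `ε`-substitution consisting of negative
rank `Ω` pairs. -/
def IsHistVal (B : Fm L 2) (W : Subst L) : Prop :=
  IsSubst W ∧ {e | W e ≠ none}.Finite ∧ negPart B W = W

/-- The data form a sequent. -/
structure Sequent.IsSequent (B : Fm L 2) (Θ : Sequent L) : Prop where
  isSubst : IsSubst Θ.S
  nodup : Θ.P.Nodup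
  mem_P : ∀ n, n ∈ Θ.P ↔ Θ.S (.mem n) = some .top
  dom_V : ∀ n, (Θ.V n).isSome ↔ n ∈ Θ.P
  val_V : ∀ n W, Θ.V n = some W → IsHistVal B W
  dom_F : ∀ e, (Θ.F e).isSome ↔ Θ.S e = some .unk ∨ ((Θ.S e).isSome ∧ rk B e = Om)

/-- The empty sequent. -/
def Sequent.empty : Sequent L := ⟨fun _ => none, [], fun _ => none, fun _ => none⟩

open Classical in
/-- `(e, ?, i), Θ`. -/
def Sequent.addUnk (e : CExpr L) (i : Bool) (Θ : Sequent L) : Sequent L :=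
  { Θ with S := Function.update Θ.S e (some .unk), F := Function.update Θ.F e (some i) }

open Classical in
/-- `(e, u), Θ`. -/
def Sequent.addNum (e : CExpr L) (u : ℕ) (Θ : Sequent L) : Sequent L :=
  { Θ with S := Function.update Θ.S e (some (.num u)) }

open Classical in
/-- `(e, u, i), Θ`. -/
def Sequent.addNumF (e : CExpr L) (u : ℕ) (i : Bool) (Θ : Sequent L) : Sequent L :=
  { Θ with S := Function.update Θ.S e (some (.num u)), F := Function.update Θ.F e (some i) }

open Classical in
/-- `(e, ⊤, i, Pₑ, Vₑ), Θ`; here `e` is the last element of `Pₑ`. -/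
def Sequent.addForms (Pe : List ℕ) (Ve : ℕ → Option (Subst L)) (i : Bool) (Θ : Sequent L) :
    Sequent L where
  S := fun x => match x with
    | .mem m => if m ∈ Pe then some .top else Θ.S (.mem m)
    | .term φ a => Θ.S (.term φ a)
  P := Θ.P ++ Pe
  V := fun m => if m ∈ Pe then Ve m else Θ.V m
  F := fun x => match x with
    | .mem m => if m ∈ Pe then some i else Θ.F (.mem m)
    | .term φ a => Θ.F (.term φ a)

/-! ## The `H`-step -/

open Classical in
/-- The substitution part of `H(Θ)`, when `e` is the `H`-expression and `v` the `H`-value. -/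
def hSubst (B : Fm L 2) (Θ : Sequent L) (e : CExpr L) (v : Val) : Subst L := fun x =>
  if x = e then some v
  else if rk B e ≠ Om then (if rk B x ≤ rk B e then Θ.S x else none)
  else if rk B x < Om then Θ.S x
  else match e with
    | .mem _ => posPart B Θ.S x
    | .term (n := k) _ a =>
        if h : k = 1 then
          let n := a ⟨0, by omega⟩
          let P' := Θ.P.takeWhile (· ≠ n)
          if ∃ m ∈ P', x = .mem m then some .top
          else if ∃ m ∈ P', x = cTerm B m ∧ Θ.S x = some .unk then some .unk
          else if n ∈ Θ.P then (Θ.V n).bind (fun W => W x)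
          else negPart B Θ.S x
        else none

open Classical in
/-- The sequence part of `H(Θ)`. -/
def hSeq (B : Fm L 2) (Θ : Sequent L) (e : CExpr L) : List ℕ :=
  if rk B e < Om then []
  else if Om < rk B e then Θ.P
  else match e with
    | .mem n => Θ.P ++ [n]
    | .term (n := k) _ a => if h : k = 1 then Θ.P.takeWhile (· ≠ a ⟨0, by omega⟩) else []

open Classical in
/-- The history part of `H(Θ)`. -/
def hHist (B : Fm L 2) (Θ : Sequent L) (e : CExpr L) : ℕ → Option (Subst L) := fun m =>
  if e = .mem m then some (negPart B Θ.S)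
  else if m ∈ hSeq B Θ e then Θ.V m
  else none

open Classical in
/-- `H(Θ)`, when `e` is the `H`-expression and `v` the `H`-value. -/
def hStep (B : Fm L 2) (Θ : Sequent L) (e : CExpr L) (v : Val) : Sequent L where
  S := hSubst B Θ e v
  P := hSeq B Θ e
  V := hHist B Θ e
  F := fun x =>
    if hSubst B Θ e v x = some .unk ∨ ((hSubst B Θ e v x).isSome ∧ rk B x = Om) then
      (if (Θ.S x).isSome then Θ.F x else some true)
    else none

/-- `x` is active at `Θ`, when `e` is the `H`-expression and `v` the `H`-value. -/
def Active (B : Fm L 2) (Θ : Sequent L) (e : CExpr L) (v : Val) (x : CExpr L) : Prop :=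
  (Θ.S x).isSome ∧ rk B x = rk B e ∧ hSubst B Θ e v x ≠ Θ.S x

section Deductions

variable [L.Structure ℕ]

/-- `(e, v)` is the pair proposed by an unsatisfied critical formula, every value used for it being
computed in `S`. -/
inductive CritPair (B : Fm L 2) (S : Subst L) (P : List ℕ) : Crit L → CExpr L → Val → Prop
  | pred {s : Tm L 0} {k : ℕ} (hs : s.HasVal S k) :
      CritPair B S P (.pred s) (.term predFm fun _ => k) (.num (k - 1))
  | epsilon {n : ℕ} {φ : Fm L (n + 1)} {t : Tm L 0} {ts : Fin n → Tm L 0} {k : ℕ} {a : Fin n → ℕ}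
      (ht : t.HasVal S k) (hts : ∀ i, (ts i).HasVal S (a i)) :
      CritPair B S P (.epsilon φ t ts) (.term φ a) (.num k)
  | induction {n : ℕ} {φ : Fm L (n + 1)} {t : Tm L 0} {ts : Fin n → Tm L 0} {k m : ℕ}
      {a : Fin n → ℕ} (ht : t.HasVal S k) (hts : ∀ i, (ts i).HasVal S (a i)) (hm : m < k)
      (hφ : Models S ((indFm φ).inst (.num m) ts))
      (hmin : ∀ j < m, Models S ((indFm φ).inst (.num j) ts).neg) :
      CritPair B S P (.induction φ t ts) (.term (indFm φ) a) (.num m)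
  | inductiveDef {t : Tm L 0} {n : ℕ} (ht : t.HasVal S n) :
      CritPair B S P (.inductiveDef t) (.mem n) .top
  /-- `n ∈ I` is the first formula of `P` for which `φ` fails, and `A(n, φ)` fails. -/
  | closureNeg {k : ℕ} {φ : Fm L (k + 1)} {ts : Fin k → Tm L 0} {a : Fin k → ℕ} {n v : ℕ}
      {P₁ P₂ : List ℕ} (hts : ∀ i, (ts i).HasVal S (a i)) (hP : P = P₁ ++ n :: P₂)
      (hn : Models S (φ.inst (.num n) ts).neg) (hP₁ : ∀ m ∈ P₁, Models S (φ.inst (.num m) ts))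
      (hA : Models S (formAOf B φ (.num n) ts).neg)
      (hv : S (.term (n := k + 1) (instB B φ).neg (Fin.cons n a)) = some (.num v)) :
      CritPair B S P (.closure φ ts) (cTerm B n) (.num v)
  /-- `n ∈ I` is the first formula of `P` for which `φ` fails, and `A(n, φ)` holds. -/
  | closurePos {k : ℕ} {φ : Fm L (k + 1)} {ts : Fin k → Tm L 0} {a : Fin k → ℕ} {n : ℕ}
      {P₁ P₂ : List ℕ} (hts : ∀ i, (ts i).HasVal S (a i)) (hP : P = P₁ ++ n :: P₂)
      (hn : Models S (φ.inst (.num n) ts).neg) (hP₁ : ∀ m ∈ P₁, Models S (φ.inst (.num m) ts))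
      (hA : Models S (formAOf B φ (.num n) ts)) :
      CritPair B S P (.closure φ ts) (.term (progFm B φ).neg a) (.num n)

/-- `(e, v)` is the pair of the critical formula selected for `(S, P)`: among the unsatisfied critical
formulas it has an expression of least rank, and it comes first among those. -/
def Selected (B : Fm L 2) (Cr : List (Crit L)) (S : Subst L) (P : List ℕ) (e : CExpr L) (v : Val) :
    Prop :=
  ∃ i : Fin Cr.length, Models S ((Cr.get i).fm B).neg ∧ CritPair B S P (Cr.get i) e v ∧
    ∀ (j : Fin Cr.length) (e' : CExpr L) (v' : Val), Models S ((Cr.get j).fm B).neg →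
      CritPair B S P (Cr.get j) e' v' → rk B e < rk B e' ∨ (rk B e = rk B e' ∧ i ≤ j)

/-- The `H`-step applies to `Θ`, with `H`-expression `e` and `H`-value `v`: `S` is correct and
nonsolving, and all the calculations in the computation of `H(Θ)` take place in `S`. -/
structure HApplies (B : Fm L 2) (Cr : List (Crit L)) (Θ : Sequent L) (e : CExpr L) (v : Val) :
    Prop where
  correct : Correct B Θ.S
  /-- `S` evaluates all critical formulas. -/
  decides_crit : ∀ c ∈ Cr, Decides Θ.S (c.fm B)
  /-- The pairs of all unsatisfied critical formulas are computed in `S`. -/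
  computes : ∀ c ∈ Cr, Models Θ.S (c.fm B).neg → ∃ e' v', CritPair B Θ.S Θ.P c e' v'
  /-- In particular some critical formula is unsatisfied. -/
  selected : Selected B Cr Θ.S Θ.P e v
  /-- The conditions `F(e', u)` on the values of terms in `S`, and on the new pair, are evaluated
  in `S`. -/
  decides_justif : ∀ e' u, e'.IsTerm → Θ.S e' = some u → Decides Θ.S (justif B e' u)
  decides_new : Decides Θ.S (justif B e v)
  /-- The value to be changed is present in `S`. -/
  unk : Θ.S e = some .unk
  mem_dom : ∀ n, e = cTerm B n → (Θ.S (.mem n)).isSome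
  cTerm_dom : ∀ n, e = .mem n → (Θ.S (cTerm B n)).isSome
  mem_dom_of_unk : e.IsTerm → rk B e = Om →
    ∀ n, Θ.S (cTerm B n) = some .unk → (Θ.S (.mem n)).isSome

/-- `AxF`. -/
def AxF (B : Fm L 2) (Θ : Sequent L) : Prop := CompInconsistent B Θ.S

/-- `AxS`: `S` is solving, every critical formula being evaluated in `S`. -/
def AxS (B : Fm L 2) (Cr : List (Crit L)) (Θ : Sequent L) : Prop := ∀ c ∈ Cr, Models Θ.S (c.fm B)

/-- `AxH_{e,v}`. -/
def AxH (B : Fm L 2) (Cr : List (Crit L)) (e : CExpr L) (v : Val) (Θ : Sequent L) : Prop :=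
  HApplies B Cr Θ e v ∧ ∃ x, Active B Θ e v x ∧ Θ.F x = some false

/-- `Θ` is an axiom. -/
def IsAxiom (B : Fm L 2) (Cr : List (Crit L)) (Θ : Sequent L) : Prop :=
  AxF B Θ ∨ AxS B Cr Θ ∨ ∃ e v, AxH B Cr e v Θ

/-- `Pₑ` is proper for `n ∈ I` and `Θ`. -/
structure Proper (B : Fm L 2) (n : ℕ) (Θ : Sequent L) (Pe : List ℕ) : Prop where
  nodup : Pe.Nodup
  unk : ∀ m ∈ Pe, ∀ u, Θ.S (cTerm B m) = some u → u = .unk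
  admissible : Admissible B (Θ.P ++ Pe)
  last : Pe.getLast? = some n
  disjoint : ∀ m ∈ Pe, m ∉ Θ.P
  /-- No formula of `Pₑ` has a value in `Θ` yet. -/
  fresh : ∀ m ∈ Pe, Θ.S (.mem m) = none

/-- `Vₑ` is a history with domain `Pₑ`. -/
def IsHist (B : Fm L 2) (Pe : List ℕ) (Ve : ℕ → Option (Subst L)) : Prop :=
  (∀ m, (Ve m).isSome ↔ m ∈ Pe) ∧ ∀ m W, Ve m = some W → IsHistVal B W

/-- The inference rules, with their main expressions. -/
inductive Rule (L : FirstOrder.Language.{0, 0}) : Type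
  | cut (e : CExpr L)
  | cutFr (e : CExpr L)
  | cutTerm (e : CExpr L)
  | cutFrTerm (e : CExpr L)
  | cutForm (n : ℕ)
  | fr (e : CExpr L)
  | h (e : CExpr L) (v : Val)

/-- The names `Cut`, `CutFr`, `Fr`, `H`. -/
inductive RuleName : Type
  | Cut
  | CutFr
  | Fr
  | H

/-- The rules `Cut`, `Cut^{Ω,term}`, `Cut^{Ω,form}` count as `Cut`, and `CutFr`, `CutFr^{Ω,term}`
as `CutFr`. -/
def Rule.name : Rule L → RuleName
  | .cut _ => .Cut
  | .cutFr _ => .CutFr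
  | .cutTerm _ => .Cut
  | .cutFrTerm _ => .CutFr
  | .cutForm _ => .Cut
  | .fr _ => .Fr
  | .h _ _ => .H

/-- The main expression. -/
def Rule.main : Rule L → CExpr L
  | .cut e => e
  | .cutFr e => e
  | .cutTerm e => e
  | .cutFrTerm e => e
  | .cutForm n => .mem n
  | .fr e => e
  | .h e _ => e

/-- `Θ` is a possible conclusion of the rule. -/
def Rule.Applies (B : Fm L 2) (Cr : List (Crit L)) : Rule L → Sequent L → Prop
  | .cut e, Θ => e.IsTerm ∧ e.InLang ∧ rk B e ≠ Om ∧ Θ.S e = none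
  | .cutFr e, Θ => e.IsTerm ∧ e.InLang ∧ rk B e ≠ Om ∧ Θ.S e = none
  | .cutTerm e, Θ => e.IsTerm ∧ e.InLang ∧ rk B e = Om ∧ Θ.S e = none
  | .cutFrTerm e, Θ => e.IsTerm ∧ e.InLang ∧ rk B e = Om ∧ Θ.S e = none
  | .cutForm n, Θ => Θ.S (.mem n) = none
  | .fr e, Θ => e.InLang ∧ Θ.S e = none
  | .h e v, Θ => HApplies B Cr Θ e v ∧ Θ.F e = some true ∧
      ∀ x, Active B Θ e v x → Θ.F x = some true

/-- The premises of the rule with conclusion `Θ`. -/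
def Rule.premises (B : Fm L 2) : Rule L → Sequent L → Set (Sequent L)
  | .cut e, Θ => {Θ' | Θ' = Θ.addUnk e false ∨ ∃ u, 0 < u ∧ Θ' = Θ.addNum e u}
  | .cutFr e, Θ => {Θ' | Θ' = Θ.addUnk e true ∨ ∃ u, 0 < u ∧ Θ' = Θ.addNum e u}
  | .cutTerm e, Θ => {Θ' | Θ' = Θ.addUnk e false ∨ ∃ u, 0 < u ∧ Θ' = Θ.addNumF e u false}
  | .cutFrTerm e, Θ => {Θ' | Θ' = Θ.addUnk e true ∨ ∃ u, 0 < u ∧ Θ' = Θ.addNumF e u false}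
  | .cutForm n, Θ => {Θ' | Θ' = Θ.addUnk (.mem n) false ∨
      ∃ Pe Ve, Proper B n Θ Pe ∧ IsHist B Pe Ve ∧ Θ' = Θ.addForms Pe Ve false}
  | .fr e, Θ => {Θ.addUnk e true}
  | .h e v, Θ => {hStep B Θ e v}

/-- Deductions of a sequent from a set `𝒮` of sequents: well-founded trees built from elements of
`𝒮`, axioms and inferences. -/
inductive Deduction (B : Fm L 2) (Cr : List (Crit L)) (𝒮 : Set (Sequent L)) : Sequent L → Type
  | leaf (Θ : Sequent L) (hΘ : Θ.IsSequent B) (h : Θ ∈ 𝒮) : Deduction B Cr 𝒮 Θ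
  | ax (Θ : Sequent L) (hΘ : Θ.IsSequent B) (h : IsAxiom B Cr Θ) : Deduction B Cr 𝒮 Θ
  | infer (Θ : Sequent L) (hΘ : Θ.IsSequent B) (R : Rule L) (h : R.Applies B Cr Θ)
      (ds : ∀ Θ', Θ' ∈ R.premises B Θ → Deduction B Cr 𝒮 Θ') : Deduction B Cr 𝒮 Θ

/-- A derivation is a deduction from the empty set. -/
abbrev Derivation (B : Fm L 2) (Cr : List (Crit L)) (Θ : Sequent L) : Type := Deduction B Cr ∅ Θ

variable {B : Fm L 2} {Cr : List (Crit L)} {𝒮 : Set (Sequent L)}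

/-- The set of rules applied in the deduction. -/
def Deduction.rules {Θ : Sequent L} : Deduction B Cr 𝒮 Θ → Set (Rule L)
  | .leaf _ _ _ => ∅
  | .ax _ _ _ => ∅
  | .infer Θ _ R _ ds => {R} ∪ ⋃ (Θ') (h : Θ' ∈ R.premises B Θ), (ds Θ' h).rules

/-- `d` is an `r`-deduction: `Cut(d) < r`, `CutFr(d) < 0`, `Fr(d) ≥ r` and `H(d) ≥ r`. -/
def Deduction.IsR {Θ : Sequent L} (d : Deduction B Cr 𝒮 Θ) (r : Ordinal.{0}) : Prop :=
  ∀ R ∈ d.rules, match R.name with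
    | .Cut => rk B R.main < r
    | .CutFr => rk B R.main < 0
    | .Fr => r ≤ rk B R.main
    | .H => r ≤ rk B R.main

/-- `d` is an `r⁺`-deduction: `Cut(d) < r`, `CutFr(d) = r`, `Fr(d) > r` and `H(d) ≥ r`. -/
def Deduction.IsRPlus {Θ : Sequent L} (d : Deduction B Cr 𝒮 Θ) (r : Ordinal.{0}) : Prop :=
  ∀ R ∈ d.rules, match R.name with
    | .Cut => rk B R.main < r
    | .CutFr => rk B R.main = r
    | .Fr => r < rk B R.main
    | .H => r ≤ rk B R.main

/-- The list of sequents is a path in the deduction, from its root upwards. -/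
def Deduction.IsPath {Θ : Sequent L} : Deduction B Cr 𝒮 Θ → List (Sequent L) → Prop
  | .leaf Θ _ _, l => l = [Θ]
  | .ax Θ _ _, l => l = [Θ]
  | .infer Θ _ R _ ds, l => l = [Θ] ∨
      ∃ (Θ' : Sequent L) (h : Θ' ∈ R.premises B Θ) (l' : List (Sequent L)),
        l = Θ :: l' ∧ (ds Θ' h).IsPath l'

/-- An `r`-path: a sequence of sequents starting with the empty one that is a path in some
`r`-deduction. -/
def IsRPath (B : Fm L 2) (Cr : List (Crit L)) (r : Ordinal.{0}) (l : List (Sequent L)) : Prop :=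
  ∃ (𝒮 : Set (Sequent L)) (d : Deduction B Cr 𝒮 Sequent.empty), d.IsR r ∧ d.IsPath l

/-- `Θ` has an `r`-path: some `r`-path ends in `Θ`. -/
def HasRPath (B : Fm L 2) (Cr : List (Crit L)) (r : Ordinal.{0}) (Θ : Sequent L) : Prop :=
  ∃ l, IsRPath B Cr r l ∧ l.getLast? = some Θ

/-- Replace a `CutFr` rule by `Fr`. -/
def Rule.prune : Rule L → Rule L
  | .cutFr e => .fr e
  | .cutFrTerm e => .fr e
  | R => R

theorem Rule.Applies.prune {R : Rule L} {Θ : Sequent L} (h : R.Applies B Cr Θ) :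
    R.prune.Applies B Cr Θ := by
  cases R with
  | cutFr e => exact ⟨h.2.1, h.2.2.2⟩
  | cutFrTerm e => exact ⟨h.2.1, h.2.2.2⟩
  | _ => exact h

theorem Rule.premises_prune {R : Rule L} {Θ Θ' : Sequent L} (h : Θ' ∈ R.prune.premises B Θ) :
    Θ' ∈ R.premises B Θ := by
  cases R with
  | cutFr e => exact Or.inl h
  | cutFrTerm e => exact Or.inl h
  | _ => exact h

/-- Prune every `CutFr` inference to an `Fr` inference, keeping only the branch of `(e, ?, t)`. -/
def Deduction.prune {Θ : Sequent L} : Deduction B Cr 𝒮 Θ → Deduction B Cr 𝒮 Θ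
  | .leaf Θ hΘ h => .leaf Θ hΘ h
  | .ax Θ hΘ h => .ax Θ hΘ h
  | .infer Θ hΘ R h ds =>
      .infer Θ hΘ R.prune h.prune fun Θ' h' => (ds Θ' (Rule.premises_prune h')).prune

end Deductions

end EpsID1

end

open EpsID1

/-!
Given a `Cut` of rank `r` with main expression `e` in an `(r + 1)`-derivation, relabelling its
premise `(e, ?, f), Θ` to `(e, ?, t), Θ` turns the `Cut` into a `CutFr`. An `AxH` above it
whose `H`-step changes the value of `e` then becomes an `H`-inference, whose premise `K = H(Ξ)` has
to be derived. All values of `K` have rank `≤ r`, those of terms are justified (or else `K` is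
computationally inconsistent), and `K` gives a numeral `v` to `e`.

The premise `(e, v), Θ` of the `Cut` has an `r⁺`-derivation, and it can be weakened by justified
values of rank `≤ r`: a `Cut` or `CutFr` whose main expression has received a value is skipped in
favour of the premise with that value, and values that contradict each other give an `AxF`.
This derives `Θ` with its part of rank `≤ r` replaced by that of `K`. The `Cut`s on an
`(r + 1)`-path have rank `≤ r`, and its `Fr`s and `H`s have rank `> r`. So one descends along the
path from `Θ` to `∅`: the replacement makes conclusion and premise of a `Cut` agree, while an `Fr`
or `H` applies to the replaced sequents as well. What is left at `∅` is a derivation of `K`.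

For `r > Ω` weakening may destroy an `AxH` of rank `Ω`, whose `H`-step requires that the
formulas `n ∈ I` with `(c_n, ?)` in the sequent have values. There are only finitely many without
one, and these are cut first.
-/

noncomputable section

namespace EpsID1

variable {L : FirstOrder.Language.{0, 0}}

/-! ### Evaluation -/

theorem Tm.subst_subst {k m l : ℕ} (σ : Fin k → Tm L m) (τ : Fin m → Tm L l) :
    ∀ t : Tm L k, (t.subst σ).subst τ = t.subst fun i => (σ i).subst τ
  | .var _ => rfl
  | .zero => rfl
  | .succ t => by simp only [Tm.subst, Tm.subst_subst σ τ t]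
  | .func f ts => by simp only [Tm.subst, fun i => Tm.subst_subst σ τ (ts i)]
  | .skolem φ ts => by simp only [Tm.subst, fun i => Tm.subst_subst σ τ (ts i)]

theorem Fm.subst_subst {k m l : ℕ} (σ : Fin k → Tm L m) (τ : Fin m → Tm L l) :
    ∀ φ : Fm L k, (φ.subst σ).subst τ = φ.subst fun i => (σ i).subst τ
  | .tru => rfl
  | .fls => rfl
  | .eq s t => by simp only [Fm.subst, Tm.subst_subst]
  | .rel R ts => by simp only [Fm.subst, Tm.subst_subst]
  | .mem t => by simp only [Fm.subst, Tm.subst_subst]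
  | .neg φ => by simp only [Fm.subst, Fm.subst_subst σ τ φ]
  | .and φ ψ => by simp only [Fm.subst, Fm.subst_subst σ τ φ, Fm.subst_subst σ τ ψ]
  | .or φ ψ => by simp only [Fm.subst, Fm.subst_subst σ τ φ, Fm.subst_subst σ τ ψ]

theorem Tm.simpleRank_of_skolemFree {k : ℕ} : ∀ t : Tm L k, t.SkolemFree → t.simpleRank = 0
  | .var _, _ => rfl
  | .zero, _ => rfl
  | .succ t, h => Tm.simpleRank_of_skolemFree t h
  | .func _ ts, h =>
      Nat.le_zero.1 (Finset.sup_le fun i _ => (Tm.simpleRank_of_skolemFree (ts i) (h i)).le)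
  | .skolem _ _, h => h.elim

theorem Fm.simpleRank_of_skolemFree {k : ℕ} : ∀ φ : Fm L k, φ.SkolemFree → φ.simpleRank = 0
  | .tru, _ => rfl
  | .fls, _ => rfl
  | .eq s t, h => Nat.max_eq_zero_iff.2
      ⟨Tm.simpleRank_of_skolemFree s h.1, Tm.simpleRank_of_skolemFree t h.2⟩
  | .rel _ ts, h =>
      Nat.le_zero.1 (Finset.sup_le fun i _ => (Tm.simpleRank_of_skolemFree (ts i) (h i)).le)
  | .mem t, h => Tm.simpleRank_of_skolemFree t h
  | .neg φ, h => Fm.simpleRank_of_skolemFree φ h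
  | .and φ ψ, h => Nat.max_eq_zero_iff.2
      ⟨Fm.simpleRank_of_skolemFree φ h.1, Fm.simpleRank_of_skolemFree ψ h.2⟩
  | .or φ ψ, h => Nat.max_eq_zero_iff.2
      ⟨Fm.simpleRank_of_skolemFree φ h.1, Fm.simpleRank_of_skolemFree ψ h.2⟩

theorem formAOf_subst {B : Fm L 2} {n k m : ℕ} (φ : Fm L (n + 1)) (t : Tm L k)
    (ts : Fin n → Tm L k) (σ : Fin k → Tm L m) :
    (formAOf B φ t ts).subst σ = formAOf B φ (t.subst σ) fun i => (ts i).subst σ := by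
  have h : ∀ i : Fin (n + 1), (Fin.cons (α := fun _ => Tm L k) t ts i).subst σ =
      Fin.cons (α := fun _ => Tm L m) (t.subst σ) (fun i => (ts i).subst σ) i :=
    Fin.cases rfl fun _ => rfl
  unfold formAOf Fm.all Fm.inst
  rw [Fm.subst_subst]
  congr 1
  funext i
  refine Fin.cases ?_ h i
  simp only [Fin.cons_zero, Tm.subst, h]

theorem progFm_inst {B : Fm L 2} {n : ℕ} (φ : Fm L (n + 1)) (s : Tm L 0) (ts : Fin n → Tm L 0) :
    (progFm B φ).inst s ts = (formAOf B φ s ts).imp (φ.inst s ts) := by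
  have h := formAOf_subst (B := B) φ (.var 0) (fun i => .var i.succ)
    (Fin.cons s ts : Fin (n + 1) → Tm L 0)
  simp only [Tm.subst, Fin.cons_zero, Fin.cons_succ] at h
  simp only [progFm, Fm.inst, Fm.imp, Fm.subst, h]

theorem Tm.numVal_num {k : ℕ} : ∀ n : ℕ, (Tm.num n : Tm L k).numVal = some n
  | 0 => rfl
  | n + 1 => by simp only [Tm.num, Tm.numVal, Tm.numVal_num n, Option.map_some]

theorem Tm.eq_num_of_numVal {k : ℕ} : ∀ {t : Tm L k} {n : ℕ}, t.numVal = some n → t = .num n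
  | .zero, _, rfl => rfl
  | .succ _, _, h => by
      obtain ⟨m, hm, rfl⟩ := Option.map_eq_some_iff.1 h
      rw [Tm.eq_num_of_numVal hm, Tm.num]

theorem Tm.skolemFree_num {k : ℕ} : ∀ n : ℕ, (Tm.num n : Tm L k).SkolemFree
  | 0 => trivial
  | n + 1 => Tm.skolemFree_num n

/-- Inclusion of partial functions. -/
def Subst.Le (S S' : Subst L) : Prop := ∀ e u, S e = some u → S' e = some u

theorem Subst.Le.isSome {S S' : Subst L} (h : S.Le S') {e : CExpr L} (he : (S e).isSome) :
    (S' e).isSome := by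
  obtain ⟨u, hu⟩ := Option.isSome_iff_exists.1 he
  exact Option.isSome_iff_exists.2 ⟨u, h e u hu⟩

theorem Subst.le_ext (S : Subst L) : S.Le S.ext := fun e u h => by simp [Subst.ext, h]

/-- Agreement of two substitutions on the Skolem functions of simple rank at most `N`; `withI` tells
whether they also have to agree on `I` and on the Skolem functions in which `I` occurs. -/
structure Subst.AgreeUpTo (N : ℕ) (withI : Prop) (S S' : Subst L) : Prop where
  term : ∀ {n : ℕ} (ψ : Fm L (n + 1)) (a : Fin n → ℕ), ψ.simpleRank < N → (ψ.HasI → withI) →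
    S (.term ψ a) = S' (.term ψ a)
  mem : withI → ∀ n, S (.mem n) = S' (.mem n)

theorem Subst.AgreeUpTo.refl (N : ℕ) (withI : Prop) (S : Subst L) : S.AgreeUpTo N withI S :=
  ⟨fun _ _ _ _ => rfl, fun _ _ => rfl⟩

/-- The substitution gives a value to every formula `n ∈ I`. -/
def Subst.TotalOnI (S : Subst L) : Prop := ∀ n, S (.mem n) = some .top ∨ S (.mem n) = some .unk

theorem IsSubst.totalOnI_ext {S : Subst L} (hS : IsSubst S) : S.ext.TotalOnI := by
  intro n
  unfold Subst.ext
  cases hu : S (.mem n) with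
  | none => exact .inr rfl
  | some u =>
    cases u with
    | unk => exact .inr rfl
    | top => exact .inl rfl
    | num k => exact (hS _ _ hu).2.elim

theorem substOfList_ext_mem_eq_top {P : List ℕ} {n : ℕ} :
    (substOfList P : Subst L).ext (.mem n) = some .top ↔ n ∈ P := by
  by_cases h : n ∈ P <;> simp [Subst.ext, substOfList, h]

theorem isSubst_substOfList (P : List ℕ) : IsSubst (substOfList P : Subst L)
  | .term _ _, _, h => nomatch h
  | .mem m, u, h => by
      by_cases hm : m ∈ P
      · cases (if_pos hm).symm.trans h; exact ⟨trivial, trivial⟩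
      · cases (if_neg hm).symm.trans h

section Evaluation

variable [L.Structure ℕ]

theorem Tm.reduce_num (S : Subst L) {k : ℕ} : ∀ n : ℕ, (Tm.num n : Tm L k).reduce S = .num n
  | 0 => rfl
  | n + 1 => by simp only [Tm.num, Tm.reduce, Tm.reduce_num S n]

theorem Tm.value_num {k : ℕ} (ρ : Fin k → ℕ) : ∀ n : ℕ, (Tm.num n : Tm L k).value ρ = n
  | 0 => rfl
  | n + 1 => by simp only [Tm.num, Tm.value, Tm.value_num ρ n]

theorem Tm.reduce_mono {S S' : Subst L} (hS : S.Le S') {k : ℕ} :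
    ∀ t : Tm L k, (t.reduce S).numVal.isSome → t.reduce S' = t.reduce S
  | .var _, _ => rfl
  | .zero, _ => rfl
  | .succ t, h => by
      simp only [Tm.reduce, Tm.numVal, Option.isSome_map] at h ⊢
      rw [Tm.reduce_mono hS t h]
  | .func f ts, h => by
      by_cases hts : ∀ i, ((ts i).reduce S).numVal.isSome
      · simp only [Tm.reduce, fun i => Tm.reduce_mono hS (ts i) (hts i)]
      · simp [Tm.reduce, hts, Tm.numVal] at h
  | .skolem φ ts, h => by
      by_cases hts : ∀ i, ((ts i).reduce S).numVal.isSome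
      · simp only [Tm.reduce, fun i => Tm.reduce_mono hS (ts i) (hts i), if_pos hts] at h ⊢
        cases hv : S (.term φ fun i => ((ts i).reduce S).numVal.getD 0) with
        | none => simp [hv, Tm.numVal] at h
        | some u => rw [hS _ _ hv]
      · simp [Tm.reduce, hts, Tm.numVal] at h

theorem Tm.isSome_numVal_of_skolemFree_reduce {S : Subst L} {k : ℕ} [IsEmpty (Fin k)] :
    ∀ t : Tm L k, (t.reduce S).SkolemFree → (t.reduce S).numVal.isSome
  | .var i, _ => isEmptyElim i
  | .zero, _ => rfl
  | .succ t, h => by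
      simpa only [Tm.reduce, Tm.numVal, Option.isSome_map] using
        Tm.isSome_numVal_of_skolemFree_reduce t h
  | .func f ts, h => by
      by_cases hts : ∀ i, ((ts i).reduce S).numVal.isSome
      · simp [Tm.reduce, hts, Tm.numVal_num]
      · simp only [Tm.reduce, hts, if_false, Tm.SkolemFree] at h
        exact absurd (fun i => Tm.isSome_numVal_of_skolemFree_reduce (ts i) (h i)) hts
  | .skolem φ ts, h => by
      by_cases hts : ∀ i, ((ts i).reduce S).numVal.isSome
      · simp only [Tm.reduce, if_pos hts] at h ⊢
        revert h
        split <;> simp [Tm.SkolemFree, Tm.numVal, Tm.numVal_num]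
      · simp [Tm.reduce, hts, Tm.SkolemFree] at h

theorem Fm.reduce_mono {S S' : Subst L} (hS : S.Le S') :
    ∀ φ : Fm L 0, (φ.reduce S).IsArith → φ.reduce S' = φ.reduce S
  | .tru, _ => rfl
  | .fls, _ => rfl
  | .eq s t, h => by
      simp only [Fm.reduce, Tm.reduce_mono hS s (Tm.isSome_numVal_of_skolemFree_reduce s h.1),
        Tm.reduce_mono hS t (Tm.isSome_numVal_of_skolemFree_reduce t h.2)]
  | .rel R ts, h => by
      simp only [Fm.reduce,
        fun i => Tm.reduce_mono hS _ (Tm.isSome_numVal_of_skolemFree_reduce (ts i) (h i))]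
  | .mem t, h => by
      cases hn : (t.reduce S).numVal with
      | none => simp [Fm.reduce, hn, Fm.IsArith] at h
      | some n =>
        simp only [Fm.reduce, hn, Tm.reduce_mono hS t (by simp [hn])] at h ⊢
        cases hv : S (.mem n) with
        | none => simp [hv, Fm.IsArith] at h
        | some u => rw [hS _ _ hv]
  | .neg φ, h => by simp only [Fm.reduce, Fm.reduce_mono hS φ h]
  | .and φ ψ, h => by simp only [Fm.reduce, Fm.reduce_mono hS φ h.1, Fm.reduce_mono hS ψ h.2]
  | .or φ ψ, h => by simp only [Fm.reduce, Fm.reduce_mono hS φ h.1, Fm.reduce_mono hS ψ h.2]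

theorem Models.mono {S S' : Subst L} (hS : S.Le S') {φ : Fm L 0} (h : Models S φ) :
    Models S' φ := by
  unfold Models
  rwa [Fm.reduce_mono hS φ h.1]

theorem Models.congr {S S' : Subst L} {φ ψ : Fm L 0} (h : Models S φ)
    (heq : φ.reduce S = ψ.reduce S') : Models S' ψ := by
  unfold Models at h ⊢
  rwa [← heq]

theorem Models.not_models_neg {S : Subst L} {φ : Fm L 0} (h : Models S φ) : ¬ Models S φ.neg :=
  fun h' => h'.2 h.2

theorem models_neg_imp {S : Subst L} {φ ψ : Fm L 0} (h : Models S (φ.imp ψ).neg) :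
    Models S φ ∧ Models S ψ.neg :=
  have h' := not_or.1 h.2
  ⟨⟨h.1.1, not_not.1 h'.1⟩, h.1.2, h'.2⟩

theorem decides_iff {S : Subst L} {φ : Fm L 0} : Decides S φ ↔ (φ.reduce S).IsArith := by
  unfold Decides Models
  change _ ∨ (_ ∧ ¬ _) ↔ _
  tauto

theorem Decides.mono {S S' : Subst L} (hS : S.Le S') {φ : Fm L 0} (h : Decides S φ) :
    Decides S' φ := h.imp (Models.mono hS) (Models.mono hS)

theorem Decides.models_of_le {S S' : Subst L} (hS : S.Le S') {φ : Fm L 0} (h : Decides S φ)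
    (h' : Models S' φ) : Models S φ :=
  h.resolve_right fun hn => h'.not_models_neg (hn.mono hS)

theorem Tm.hasVal_num (S : Subst L) (n : ℕ) : (Tm.num n : Tm L 0).HasVal S n := by
  unfold Tm.HasVal
  rw [Tm.reduce_num, Tm.numVal_num]

theorem Tm.HasVal.mono {S S' : Subst L} (hS : S.Le S') {t : Tm L 0} {n : ℕ} (h : t.HasVal S n) :
    t.HasVal S' n := by
  unfold Tm.HasVal at h ⊢
  rw [Tm.reduce_mono hS t (by simp [h]), h]

theorem Tm.HasVal.unique {S : Subst L} {t : Tm L 0} {m n : ℕ} (hm : t.HasVal S m)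
    (hn : t.HasVal S n) : m = n := Option.some.inj (hm.symm.trans hn)

theorem Tm.HasVal.unique_vec {S : Subst L} {n : ℕ} {ts : Fin n → Tm L 0} {a b : Fin n → ℕ}
    (ha : ∀ i, (ts i).HasVal S (a i)) (hb : ∀ i, (ts i).HasVal S (b i)) : a = b :=
  funext fun i => (ha i).unique (hb i)

theorem Tm.HasVal.reduce_eq {S : Subst L} {t : Tm L 0} {n : ℕ} (h : t.HasVal S n) :
    t.reduce S = .num n := Tm.eq_num_of_numVal h

theorem Tm.reduce_subst_congr {S S' : Subst L} {N : ℕ} {withI : Prop}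
    (hS : S.AgreeUpTo N withI S') {k m : ℕ} {σ σ' : Fin k → Tm L m}
    (hσ : ∀ i, (σ i).reduce S = (σ' i).reduce S') :
    ∀ t : Tm L k, t.simpleRank ≤ N → (t.HasI → withI) →
      (t.subst σ).reduce S = (t.subst σ').reduce S'
  | .var i, _, _ => hσ i
  | .zero, _, _ => rfl
  | .succ t, h, hI => by simp only [Tm.subst, Tm.reduce, Tm.reduce_subst_congr hS hσ t h hI]
  | .func f ts, h, hI => by
      have hts := fun i => Tm.reduce_subst_congr hS hσ (ts i)
        (Finset.sup_le_iff.1 h i (Finset.mem_univ i)) fun h => hI ⟨i, h⟩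
      simp only [Tm.subst, Tm.reduce, hts]
  | .skolem φ ts, h, hI => by
      have hts := fun i => Tm.reduce_subst_congr hS hσ (ts i)
        (Finset.sup_le_iff.1 (max_le_iff.1 h).2 i (Finset.mem_univ i)) fun h => hI (.inr ⟨i, h⟩)
      have hφ := fun a => hS.term φ a (max_le_iff.1 h).1 fun h => hI (.inl h)
      simp only [Tm.subst, Tm.reduce, hts, hφ]

theorem Fm.reduce_subst_congr {S S' : Subst L} {N : ℕ} {withI : Prop}
    (hS : S.AgreeUpTo N withI S') {k m : ℕ} {σ σ' : Fin k → Tm L m}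
    (hσ : ∀ i, (σ i).reduce S = (σ' i).reduce S') :
    ∀ φ : Fm L k, φ.simpleRank ≤ N → (φ.HasI → withI) →
      (φ.subst σ).reduce S = (φ.subst σ').reduce S'
  | .tru, _, _ => rfl
  | .fls, _, _ => rfl
  | .eq s t, h, hI => by
      simp only [Fm.subst, Fm.reduce,
        Tm.reduce_subst_congr hS hσ s (max_le_iff.1 h).1 fun h => hI (.inl h),
        Tm.reduce_subst_congr hS hσ t (max_le_iff.1 h).2 fun h => hI (.inr h)]
  | .rel R ts, h, hI => by
      have hts := fun i => Tm.reduce_subst_congr hS hσ (ts i)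
        (Finset.sup_le_iff.1 h i (Finset.mem_univ i)) fun h => hI ⟨i, h⟩
      simp only [Fm.subst, Fm.reduce, hts]
  | .mem t, h, hI => by
      have withI : withI := hI trivial
      simp only [Fm.subst, Fm.reduce, Tm.reduce_subst_congr hS hσ t h fun _ => withI, hS.mem withI]
  | .neg φ, h, hI => by simp only [Fm.subst, Fm.reduce, Fm.reduce_subst_congr hS hσ φ h hI]
  | .and φ ψ, h, hI => by
      simp only [Fm.subst, Fm.reduce,
        Fm.reduce_subst_congr hS hσ φ (max_le_iff.1 h).1 fun h => hI (.inl h),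
        Fm.reduce_subst_congr hS hσ ψ (max_le_iff.1 h).2 fun h => hI (.inr h)]
  | .or φ ψ, h, hI => by
      simp only [Fm.subst, Fm.reduce,
        Fm.reduce_subst_congr hS hσ φ (max_le_iff.1 h).1 fun h => hI (.inl h),
        Fm.reduce_subst_congr hS hσ ψ (max_le_iff.1 h).2 fun h => hI (.inr h)]

theorem Models.inst_congr {S : Subst L} {n : ℕ} {φ : Fm L (n + 1)} {s s' : Tm L 0}
    {ts : Fin n → Tm L 0} (h : Models S (φ.inst s ts)) (hs : s.reduce S = s'.reduce S) :
    Models S (φ.inst s' ts) :=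
  h.congr (Fm.reduce_subst_congr (.refl _ True S) (Fin.cases hs fun _ => rfl) φ le_rfl
    fun _ => trivial)

theorem Tm.reduce_skolem {S : Subst L} {n : ℕ} {φ : Fm L (n + 1)} {ts : Fin n → Tm L 0}
    {a : Fin n → ℕ} (hts : ∀ i, (ts i).HasVal S (a i)) (hS : S (.term φ a) = some .unk) :
    (Tm.skolem φ ts).reduce S = .zero := by
  have h : ∀ i, ((ts i).reduce S).numVal = some (a i) := hts
  simp [Tm.reduce, h, hS]

theorem Tm.exists_hasVal_subst {S S' : Subst L} {k : ℕ} {σ σ' : Fin k → Tm L 0}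
    (hσ : ∀ i, ∃ n, (σ i).HasVal S n ∧ (σ' i).HasVal S' n) :
    ∀ t : Tm L k, t.SkolemFree → ∃ n, (t.subst σ).HasVal S n ∧ (t.subst σ').HasVal S' n
  | .var i, _ => hσ i
  | .zero, _ => ⟨0, rfl, rfl⟩
  | .succ t, h => by
      obtain ⟨n, hn, hn'⟩ := Tm.exists_hasVal_subst hσ t h
      exact ⟨n + 1, congrArg (Option.map (· + 1)) hn, congrArg (Option.map (· + 1)) hn'⟩
  | .func f ts, h => by
      choose n hn hn' using fun i => Tm.exists_hasVal_subst hσ (ts i) (h i)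
      unfold Tm.HasVal at hn hn' ⊢
      simp [Tm.subst, Tm.reduce, hn, hn', Tm.numVal_num]
  | .skolem _ _, h => h.elim

theorem Fm.isArith_reduce_subst {S : Subst L} (hS : S.TotalOnI) {k : ℕ} {σ : Fin k → Tm L 0}
    (hσ : ∀ i, ∃ n, (σ i).HasVal S n) : ∀ φ : Fm L k, φ.SkolemFree →
      ((φ.subst σ).reduce S).IsArith := by
  have hterm : ∀ t : Tm L k, t.SkolemFree → ∃ n, (t.subst σ).HasVal S n := fun t ht =>
    (Tm.exists_hasVal_subst (fun i => (hσ i).imp fun _ h => ⟨h, h⟩) t ht).imp fun _ h => h.1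
  have hfree : ∀ t : Tm L k, t.SkolemFree → ((t.subst σ).reduce S).SkolemFree := fun t ht => by
    obtain ⟨n, hn⟩ := hterm t ht
    exact hn.reduce_eq ▸ Tm.skolemFree_num n
  intro φ hφ
  induction φ using Fm.rec (motive_1 := fun _ _ => True) with
  | tru => trivial
  | fls => trivial
  | eq s t => exact ⟨hfree s hφ.1, hfree t hφ.2⟩
  | rel R ts => exact fun i => hfree (ts i) (hφ i)
  | mem t =>
    obtain ⟨n, hn⟩ := hterm t hφ
    unfold Tm.HasVal at hn
    rcases hS n with h | h <;> simp [Fm.subst, Fm.reduce, hn, h, Fm.IsArith]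
  | neg φ ih => exact ih hσ hterm hfree hφ
  | and φ ψ ihφ ihψ => exact ⟨ihφ hσ hterm hfree hφ.1, ihψ hσ hterm hfree hφ.2⟩
  | or φ ψ ihφ ihψ => exact ⟨ihφ hσ hterm hfree hφ.1, ihψ hσ hterm hfree hφ.2⟩
  | _ => trivial

theorem Fm.holds_reduce_subst_of_onlySign {S S' : Subst L} (hS : S.TotalOnI) (hS' : S'.TotalOnI)
    (hSS' : ∀ n, S (.mem n) = some .top → S' (.mem n) = some .top) {k : ℕ}
    {σ σ' : Fin k → Tm L 0} (hσ : ∀ i, ∃ n, (σ i).HasVal S n ∧ (σ' i).HasVal S' n) :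
    ∀ φ : Fm L k, φ.SkolemFree →
      (φ.OnlySign true → ((φ.subst σ).reduce S).Holds Fin.elim0 →
        ((φ.subst σ').reduce S').Holds Fin.elim0) ∧
      (φ.OnlySign false → ((φ.subst σ').reduce S').Holds Fin.elim0 →
        ((φ.subst σ).reduce S).Holds Fin.elim0) := by
  have hterm := Tm.exists_hasVal_subst hσ
  have hred : ∀ t : Tm L k, t.SkolemFree → (t.subst σ).reduce S = (t.subst σ').reduce S' :=
    fun t ht => by
      obtain ⟨n, hn, hn'⟩ := hterm t ht
      rw [hn.reduce_eq, hn'.reduce_eq]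
  intro φ hφ
  induction φ using Fm.rec (motive_1 := fun _ _ => True) with
  | tru => exact ⟨fun _ => id, fun _ => id⟩
  | fls => exact ⟨fun _ => id, fun _ => id⟩
  | eq s t => simp [Fm.subst, Fm.reduce, hred s hφ.1, hred t hφ.2]
  | rel R ts => simp [Fm.subst, Fm.reduce, fun i => hred (ts i) (hφ i)]
  | mem t =>
    obtain ⟨n, hn, hn'⟩ := hterm t hφ
    unfold Tm.HasVal at hn hn'
    rcases hS n with h | h
    · simp [Fm.subst, Fm.reduce, hn, hn', h, hSS' n h, Fm.Holds]
    · rcases hS' n with h' | h' <;>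
      simp [Fm.subst, Fm.reduce, hn, hn', h, h', Fm.Holds, Fm.OnlySign]
  | neg φ ih =>
    have hφ' := ih hσ hterm hred hφ
    exact ⟨fun h => mt (hφ'.2 h), fun h => mt (hφ'.1 h)⟩
  | and φ ψ ihφ ihψ =>
    have hφ' := ihφ hσ hterm hred hφ.1
    have hψ' := ihψ hσ hterm hred hφ.2
    exact ⟨fun h => And.imp (hφ'.1 h.1) (hψ'.1 h.2), fun h => And.imp (hφ'.2 h.1) (hψ'.2 h.2)⟩
  | or φ ψ ihφ ihψ =>
    have hφ' := ihφ hσ hterm hred hφ.1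
    have hψ' := ihψ hσ hterm hred hφ.2
    exact ⟨fun h => Or.imp (hφ'.1 h.1) (hψ'.1 h.2), fun h => Or.imp (hφ'.2 h.1) (hψ'.2 h.2)⟩
  | _ => trivial

end Evaluation

/-! ### Ranks -/

theorem rk_mem (B : Fm L 2) (n : ℕ) : rk B (.mem n) = Om := rfl

theorem rk_cTerm (B : Fm L 2) (n : ℕ) : rk B (cTerm B n) = Om := if_pos rfl

theorem cTerm_injective (B : Fm L 2) : Function.Injective (cTerm B) := by
  intro m n h
  simp only [cTerm, CExpr.term.injEq, heq_eq_eq, true_and] at h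
  exact congrFun h 0

theorem mem_ne_cTerm (B : Fm L 2) (m n : ℕ) : (.mem m : CExpr L) ≠ cTerm B n := by
  unfold cTerm
  exact nofun

theorem rk_term_cases {B : Fm L 2} {n : ℕ} {φ : Fm L (n + 1)}
    (h : (⟨n, φ⟩ : Σ m, Fm L (m + 1)) ≠ ⟨1, B.neg⟩) (a : Fin n → ℕ) :
    (φ.HasI ∧ rk B (.term φ a) = Om + ((φ.simpleRank + 1 : ℕ) : Ordinal) + 1) ∨
      (¬ φ.HasI ∧ rk B (.term φ a) = ((φ.simpleRank + 1 : ℕ) : Ordinal)) := by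
  unfold rk
  simp only [if_neg h]
  by_cases hI : φ.HasI
  · exact .inl ⟨hI, if_pos hI⟩
  · exact .inr ⟨hI, if_neg hI⟩

theorem natCast_lt_Om (n : ℕ) : (n : Ordinal.{0}) < Om :=
  (Ordinal.natCast_lt_omega0 n).trans (by
    rw [← Ordinal.omega_zero]; exact Ordinal.omega_lt_omega.2 zero_lt_one)

theorem Om_lt_Om_add (n : ℕ) : Om < Om + ((n + 1 : ℕ) : Ordinal) + 1 :=
  (le_add_of_nonneg_right (by simp)).trans_lt (lt_add_of_pos_right _ (by simp))

theorem exists_eq_cTerm {B : Fm L 2} {e : CExpr L} (he : e.IsTerm) (hr : rk B e = Om) :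
    ∃ n, e = cTerm B n := by
  cases e with
  | mem n => exact he.elim
  | @term n φ a =>
    by_cases h : (⟨n, φ⟩ : Σ m, Fm L (m + 1)) = ⟨1, B.neg⟩
    · cases h
      exact ⟨a 0, congrArg (CExpr.term (n := 1) B.neg) (funext fun i => by
        rw [Subsingleton.elim i 0])⟩
    · rcases rk_term_cases h a with ⟨-, hr'⟩ | ⟨-, hr'⟩
      · exact absurd (hr'.symm.trans hr) (Om_lt_Om_add _).ne'
      · exact absurd (hr'.symm.trans hr) (natCast_lt_Om _).ne

theorem isTerm_of_rk_ne {B : Fm L 2} {e : CExpr L} (he : rk B e ≠ Om) : e.IsTerm := by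
  cases e with
  | mem n => exact absurd rfl he
  | term φ a => trivial

theorem rk_lt_of_simpleRank_lt {B : Fm L 2} (hB : B.SkolemFree) (hBI : B.HasI) {m n : ℕ}
    {ψ : Fm L (m + 1)} {φ : Fm L (n + 1)} (h : ψ.simpleRank < φ.simpleRank)
    (hI : ψ.HasI → φ.HasI) (b : Fin m → ℕ) (a : Fin n → ℕ) :
    rk B (.term ψ b) < rk B (.term φ a) := by
  have hφ : (⟨n, φ⟩ : Σ m, Fm L (m + 1)) ≠ ⟨1, B.neg⟩ := by
    rintro hφ
    cases hφ
    exact absurd (Fm.simpleRank_of_skolemFree B hB) (Nat.zero_lt_of_lt h).ne'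
  by_cases hψ : (⟨m, ψ⟩ : Σ m, Fm L (m + 1)) = ⟨1, B.neg⟩
  · cases hψ
    rcases rk_term_cases hφ a with ⟨-, hr⟩ | ⟨hφI, -⟩
    · exact (if_pos rfl).trans_lt (hr ▸ Om_lt_Om_add _)
    · exact absurd (hI hBI) hφI
  rcases rk_term_cases hψ b with ⟨hψI, hr⟩ | ⟨-, hr⟩ <;>
    rcases rk_term_cases hφ a with ⟨-, hr'⟩ | ⟨hφI, hr'⟩ <;> rw [hr, hr']
  · rw [add_assoc, add_assoc]
    exact (add_lt_add_iff_left Om).2 (by exact_mod_cast Nat.add_lt_add_right h 2)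
  · exact absurd (hI hψI) hφI
  · exact (natCast_lt_Om _).trans (Om_lt_Om_add _)
  · exact_mod_cast Nat.succ_lt_succ h

theorem Om_le_rk_of_hasI (B : Fm L 2) {n : ℕ} {φ : Fm L (n + 1)} (hI : φ.HasI) (a : Fin n → ℕ) :
    Om ≤ rk B (.term φ a) := by
  by_cases h : (⟨n, φ⟩ : Σ m, Fm L (m + 1)) = ⟨1, B.neg⟩
  · exact (if_pos h).ge
  · rcases rk_term_cases h a with ⟨-, hr⟩ | ⟨hI', -⟩
    · exact hr ▸ (Om_lt_Om_add _).le
    · exact absurd hI hI'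

theorem Val.Fits.eq_unk_or_eq_num {u : Val} {e : CExpr L} (h : u.Fits e) (he : e.IsTerm) :
    u = .unk ∨ ∃ k, 0 < k ∧ u = .num k := by
  cases e with
  | mem n => exact he.elim
  | term φ a =>
    cases u with
    | unk => exact .inl rfl
    | num k => exact .inr ⟨k, h, rfl⟩
    | top => exact h.elim

theorem Val.Fits.eq_unk_or_eq_top {u : Val} {n : ℕ} (h : u.Fits (.mem n : CExpr L)) :
    u = .unk ∨ u = .top := by
  cases u with
  | unk => exact .inl rfl
  | num k => exact h.elim
  | top => exact .inr rfl

/-! ### Justification of values -/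

section Justification

variable [L.Structure ℕ] {B : Fm L 2}

theorem reduce_justif_congr (hB : B.SkolemFree) (hBI : B.HasI) {r : Ordinal.{0}} (hr : r ≠ Om)
    {S S' : Subst L} (hS : ∀ x, rk B x < r → S x = S' x) {e : CExpr L} (he : e.IsTerm)
    (her : rk B e ≤ r) (u : Val) : (justif B e u).reduce S = (justif B e u).reduce S' := by
  cases e with
  | mem n => exact he.elim
  | @term n φ a =>
    have hagree : S.AgreeUpTo φ.simpleRank φ.HasI S' :=
      ⟨fun ψ b h hI => hS _ ((rk_lt_of_simpleRank_lt hB hBI h hI b a).trans_le her),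
        fun hI m => hS (.mem m) (lt_of_le_of_ne ((Om_le_rk_of_hasI B hI a).trans her) hr.symm)⟩
    have hinst : ∀ k, (instNum φ k a).reduce S = (instNum φ k a).reduce S' := fun k =>
      Fm.reduce_subst_congr hagree
        (Fin.cases (by simp only [Fin.cons_zero, Tm.reduce_num])
          fun i => by simp only [Fin.cons_succ, Tm.reduce_num]) φ le_rfl id
    cases u with
    | unk => rfl
    | top => rfl
    | num k =>
      have hfold : ∀ l : List ℕ,
          (l.foldr (fun v χ => Fm.and (.neg (instNum φ v a)) χ) .tru).reduce S =
          (l.foldr (fun v χ => Fm.and (.neg (instNum φ v a)) χ) .tru).reduce S' := fun l => by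
        induction l with
        | nil => rfl
        | cons v l ih => simp only [List.foldr, Fm.reduce, hinst, ih]
      simp only [justif, Fm.reduce, hinst, hfold]

theorem models_formA_congr (hB : B.SkolemFree) {S S' : Subst L}
    (hS : ∀ x, rk B x = Om → S x = S' x) {n : ℕ} (h : Models S (formA B (.num n))) :
    Models S' (formA B (.num n)) := by
  have hsk : (Tm.skolem B.neg fun _ => .num n : Tm L 0).reduce S =
      (Tm.skolem B.neg fun _ => .num n).reduce S' := by
    have hc := hS (cTerm B n) (rk_cTerm B n)
    unfold cTerm at hc
    simp only [Tm.reduce, Tm.reduce_num, Tm.numVal_num, Option.getD_some, hc]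
  exact h.congr (Fm.reduce_subst_congr (N := 0) (withI := True)
    ⟨fun _ _ h => absurd h (Nat.not_lt_zero _), fun _ m => hS _ (rk_mem B m)⟩
    (Fin.cases hsk fun _ => by simp only [Fin.cons_succ, Tm.reduce_num]) B
    (Fm.simpleRank_of_skolemFree B hB).le fun _ => trivial)

theorem CompInconsistent.mono {S S' : Subst L} (hS : S.Le S') (h : CompInconsistent B S) :
    CompInconsistent B S' :=
  h.imp (fun ⟨e, u, he, hF⟩ => ⟨e, u, hS _ _ he, hF.mono hS⟩)
    fun ⟨n, u, hc, hn⟩ => ⟨n, u, hS _ _ hc, hS _ _ hn⟩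

theorem ext_cTerm_eq_unk {S : Subst L} (hS : IsSubst S) (hF : ¬ CompInconsistent B S) {n : ℕ}
    (hn : S (.mem n) = some .top) : S.ext (cTerm B n) = some .unk := by
  unfold Subst.ext
  cases hu : S (cTerm B n) with
  | none => rfl
  | some u =>
    rcases (hS _ _ hu).2.eq_unk_or_eq_num trivial with rfl | ⟨k, -, rfl⟩
    · rfl
    · exact absurd (.inr ⟨n, k, hu, hn⟩) hF

-- As `B` is positive in `X`, the instance of `B` that admissibility verifies for the formulas
-- before `n ∈ I` stays true in `S`; it is `A(n, I)` because `cₙ` has the value `?`.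
theorem Admissible.models_formA (hB : B.SkolemFree) (hBpos : B.OnlySign true) {S : Subst L}
    {P : List ℕ} (hP : Admissible B P) (hS : IsSubst S)
    (hSP : ∀ n, n ∈ P ↔ S (.mem n) = some .top) (hF : ¬ CompInconsistent B S) {n : ℕ}
    (hn : S (.mem n) = some .top) : Models S.ext (formA B (.num n)) := by
  obtain ⟨P₁, P₂, hP₁₂⟩ := List.append_of_mem ((hSP n).2 hn)
  have hc : (Tm.skolem B.neg fun _ => .num n : Tm L 0).HasVal S.ext 0 := by
    unfold Tm.HasVal
    rw [Tm.reduce_skolem (a := fun _ => n) (fun _ => Tm.hasVal_num _ n)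
      (ext_cTerm_eq_unk hS hF hn), Tm.numVal]
  have hσ : ∀ i : Fin 2, ∃ m,
      ((![.zero, .num n] : Fin 2 → Tm L 0) i).HasVal (substOfList P₁).ext m ∧
      ((Fin.cons (.skolem B.neg fun _ => .num n) fun _ => .num n : Fin 2 → Tm L 0) i).HasVal
        S.ext m :=
    Fin.cases ⟨0, rfl, hc⟩ fun i =>
      ⟨n, by rw [Subsingleton.elim i 0]; exact Tm.hasVal_num _ n, Tm.hasVal_num _ n⟩
  have hmem : ∀ m, (substOfList P₁ : Subst L).ext (.mem m) = some .top →
      S.ext (.mem m) = some .top :=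
    fun m hm => S.le_ext _ _ ((hSP m).1
      (hP₁₂ ▸ List.mem_append_left _ (substOfList_ext_mem_eq_top.1 hm)))
  exact ⟨Fm.isArith_reduce_subst hS.totalOnI_ext (fun i => (hσ i).imp fun _ h => h.2) B hB,
    (Fm.holds_reduce_subst_of_onlySign (isSubst_substOfList P₁).totalOnI_ext hS.totalOnI_ext hmem
      hσ B hB).1 hBpos (hP P₁ n P₂ hP₁₂).2⟩

/-! ### Critical formulas -/

theorem CritPair.mono {S S' : Subst L} {P P' : List ℕ} (hS : S.Le S') (hP : P <+: P')
    {c : Crit L} {e : CExpr L} {v : Val} (h : CritPair B S P c e v) : CritPair B S' P' c e v := by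
  obtain ⟨Q, rfl⟩ := hP
  cases h with
  | pred hs => exact .pred (hs.mono hS)
  | epsilon ht hts => exact .epsilon (ht.mono hS) fun i => (hts i).mono hS
  | induction ht hts hm hφ hmin =>
    exact .induction (ht.mono hS) (fun i => (hts i).mono hS) hm (hφ.mono hS)
      fun j hj => (hmin j hj).mono hS
  | inductiveDef ht => exact .inductiveDef (ht.mono hS)
  | closureNeg hts hP hn hP₁ hA hv =>
    exact .closureNeg (fun i => (hts i).mono hS) (by rw [hP, List.append_assoc, List.cons_append])
      (hn.mono hS) (fun m hm => (hP₁ m hm).mono hS) (hA.mono hS) (hS _ _ hv)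
  | closurePos hts hP hn hP₁ hA =>
    exact .closurePos (fun i => (hts i).mono hS) (by rw [hP, List.append_assoc, List.cons_append])
      (hn.mono hS) (fun m hm => (hP₁ m hm).mono hS) (hA.mono hS)

theorem eq_of_append_cons_eq {α : Type*} {p : α → Prop} {l₁ l₂ l₁' l₂' : List α} {x x' : α}
    (h : l₁ ++ x :: l₂ = l₁' ++ x' :: l₂') (hx : ¬ p x) (hx' : ¬ p x') (h₁ : ∀ y ∈ l₁, p y)
    (h₁' : ∀ y ∈ l₁', p y) : x = x' := by
  classical
  have hfind : (l₁ ++ x :: l₂).find? (fun y => ¬ p y) = some x :=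
    List.find?_eq_some_iff_append.2 ⟨by simpa using hx, l₁, l₂, rfl, by simpa using h₁⟩
  have hfind' : (l₁ ++ x :: l₂).find? (fun y => ¬ p y) = some x' :=
    List.find?_eq_some_iff_append.2 ⟨by simpa using hx', l₁', l₂', h, by simpa using h₁'⟩
  exact Option.some.inj (hfind.symm.trans hfind')

theorem first_counterexample_unique {S : Subst L} {P P₁ P₂ P₁' P₂' : List ℕ} {k n n' : ℕ}
    {φ : Fm L (k + 1)} {ts : Fin k → Tm L 0} (hP : P = P₁ ++ n :: P₂) (hP' : P = P₁' ++ n' :: P₂')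
    (hn : Models S (φ.inst (.num n) ts).neg) (hn' : Models S (φ.inst (.num n') ts).neg)
    (h₁ : ∀ m ∈ P₁, Models S (φ.inst (.num m) ts))
    (h₁' : ∀ m ∈ P₁', Models S (φ.inst (.num m) ts)) : n = n' :=
  eq_of_append_cons_eq (hP.symm.trans hP') (fun h => h.not_models_neg hn)
    (fun h => h.not_models_neg hn') h₁ h₁'

theorem CritPair.unique {S : Subst L} {P : List ℕ} {c : Crit L} {e e' : CExpr L} {v v' : Val}
    (h : CritPair B S P c e v) (h' : CritPair B S P c e' v') : e = e' ∧ v = v' := by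
  cases h with
  | pred hs =>
    obtain ⟨hs'⟩ := h'
    cases hs.unique hs'
    exact ⟨rfl, rfl⟩
  | epsilon ht hts =>
    obtain _ | ⟨ht', hts'⟩ := h'
    cases ht.unique ht'
    cases Tm.HasVal.unique_vec hts hts'
    exact ⟨rfl, rfl⟩
  | induction _ hts _ hφ hmin =>
    obtain _ | _ | ⟨-, hts', -, hφ', hmin'⟩ := h'
    cases Tm.HasVal.unique_vec hts hts'
    have hle := not_lt.1 fun h => (hφ.not_models_neg (hmin' _ h))
    cases hle.antisymm (not_lt.1 fun h => hφ'.not_models_neg (hmin _ h))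
    exact ⟨rfl, rfl⟩
  | inductiveDef ht =>
    obtain _ | _ | _ | ⟨ht'⟩ := h'
    cases ht.unique ht'
    exact ⟨rfl, rfl⟩
  | closureNeg hts hP hn hP₁ hA hv =>
    obtain _ | _ | _ | _ | ⟨hts', hP', hn', hP₁', -, hv'⟩ | ⟨-, hP', hn', hP₁', hA'⟩ := h'
    all_goals cases first_counterexample_unique hP hP' hn hn' hP₁ hP₁'
    · cases Tm.HasVal.unique_vec hts hts'
      cases hv.symm.trans hv'
      exact ⟨rfl, rfl⟩
    · exact absurd hA hA'.not_models_neg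
  | closurePos hts hP hn hP₁ hA =>
    obtain _ | _ | _ | _ | ⟨-, hP', hn', hP₁', hA', -⟩ | ⟨hts', hP', hn', hP₁', -⟩ := h'
    all_goals cases first_counterexample_unique hP hP' hn hn' hP₁ hP₁'
    · exact absurd hA' hA.not_models_neg
    · cases Tm.HasVal.unique_vec hts hts'
      exact ⟨rfl, rfl⟩

theorem one_lt_of_models_neg_pred {S : Subst L} {s : Tm L 0} {k : ℕ} (hs : s.HasVal S k)
    (hc : Models S ((Crit.pred s).fm B).neg) (he : S (.term predFm fun _ => k) = some .unk) :
    1 < k := by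
  obtain ⟨hne, hpred⟩ := models_neg_imp hc
  have hred : ((predFm : Fm L (1 + 1)).ex fun _ => s).reduce S = .eq (.num k) (.succ .zero) := by
    rw [← hs.reduce_eq, ← Tm.reduce_skolem (ts := fun _ => s) (fun _ => hs) he]; rfl
  have hne0 : ¬ (s.reduce S).value Fin.elim0 = 0 := hne.2
  have hne1 : ¬ ((predFm.ex fun _ => s).reduce S).Holds Fin.elim0 := hpred.2
  rw [hs.reduce_eq, Tm.value_num] at hne0
  rw [hred, Fm.Holds, Tm.value_num, Tm.value, Tm.value] at hne1
  omega

theorem CritPair.fits {S : Subst L} {P : List ℕ} {c : Crit L} {e : CExpr L} {v : Val}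
    (hS : IsSubst S) (hc : Models S (c.fm B).neg) (he : S e = some .unk)
    (h : CritPair B S P c e v) : v.Fits e ∧ v ≠ .unk := by
  cases h with
  | pred hs => exact ⟨Nat.sub_pos_of_lt (one_lt_of_models_neg_pred hs hc he), nofun⟩
  | epsilon ht hts =>
    refine ⟨Nat.pos_of_ne_zero ?_, nofun⟩
    rintro rfl
    obtain ⟨hinst, hex⟩ := models_neg_imp hc
    exact (hinst.inst_congr
      (ht.reduce_eq.trans (Tm.reduce_skolem hts he).symm)).not_models_neg hex
  | induction _ hts _ hφ _ =>
    refine ⟨Nat.pos_of_ne_zero ?_, nofun⟩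
    rintro rfl
    exact (hφ.inst_congr (Tm.reduce_skolem hts he).symm).not_models_neg (models_neg_imp hc).2
  | inductiveDef _ => exact ⟨trivial, nofun⟩
  | closureNeg _ _ _ _ _ hv => exact ⟨(hS _ _ hv).2, nofun⟩
  | closurePos hts _ hn _ hA =>
    refine ⟨Nat.pos_of_ne_zero ?_, nofun⟩
    rintro rfl
    have hprog := (models_neg_imp hc).1.inst_congr (s' := .num 0) (Tm.reduce_skolem hts he)
    rw [progFm_inst] at hprog
    exact hprog.2.elim (fun h => h hA.2) hn.2

theorem HApplies.fits {Cr : List (Crit L)} {Θ : Sequent L} {e : CExpr L} {v : Val}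
    (h : HApplies B Cr Θ e v) (hΘ : IsSubst Θ.S) : v.Fits e ∧ v ≠ .unk := by
  obtain ⟨i, hi, hpair, -⟩ := h.selected
  exact hpair.fits hΘ hi h.unk

end Justification

/-! ### The `H`-step -/

section HStep

variable {B : Fm L 2} {Θ Ψ : Sequent L} {e x : CExpr L} {v u : Val} {r : Ordinal.{0}} {n : ℕ}

/-- The pairs that make up `S⁻_{=Ω}`: `(c_m, u)` with `u ≠ ?`, and `(m ∈ I, ?)`. -/
def IsNegPair (B : Fm L 2) : CExpr L → Val → Prop
  | .term φ a, .num _ => rk B (.term φ a) = Om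
  | .mem _, .unk => True
  | _, _ => False

theorem IsNegPair.rk_eq (h : IsNegPair B x u) : rk B x = Om := by
  cases x with
  | mem n => rfl
  | term φ a => cases u with | num k => exact h | _ => exact h.elim

theorem negPart_eq_some {S : Subst L} :
    negPart B S x = some u ↔ S x = some u ∧ IsNegPair B x u := by
  unfold negPart
  cases x with
  | mem n => rcases S (.mem n) with - | (- | - | -) <;> cases u <;> simp [IsNegPair]
  | term φ a =>
    by_cases h : rk B (.term φ a) = Om <;>
      rcases S (.term φ a) with - | (- | - | -) <;> cases u <;> simp [IsNegPair, h]

theorem negPart_congr {S S' : Subst L} (h : ∀ x, rk B x = Om → S x = S' x) :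
    negPart B S = negPart B S' :=
  funext fun x => Option.ext fun u => by
    rw [negPart_eq_some, negPart_eq_some]
    exact and_congr_left fun hx => by rw [h x hx.rk_eq]

theorem negPart_negPart (S : Subst L) : negPart B (negPart B S) = negPart B S :=
  funext fun x => Option.ext fun u => by
    rw [negPart_eq_some, negPart_eq_some, and_assoc, and_self]

theorem IsHistVal.isNegPair {W : Subst L} (hW : IsHistVal B W) (h : W x = some u) :
    IsNegPair B x u := (negPart_eq_some.1 (hW.2.2.symm ▸ h)).2

theorem isHistVal_negPart {S : Subst L} (hS : IsSubst S)
    (hfin : {x | negPart B S x ≠ none}.Finite) : IsHistVal B (negPart B S) :=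
  ⟨fun x u h => hS x u (negPart_eq_some.1 h).1, hfin, negPart_negPart S⟩

theorem posPart_mem_eq_top {S : Subst L} :
    posPart B S (.mem n) = some .top ↔ S (.mem n) = some .top := by
  unfold posPart
  rcases S (.mem n) with - | (- | - | -) <;> simp

theorem posPart_le (S : Subst L) : (posPart B S).Le S := by
  intro x u h
  unfold posPart at h
  split at h
  · split_ifs at h
    simp_all only
  · simp_all only
  · cases h

theorem hSubst_self (B : Fm L 2) (Θ : Sequent L) (e : CExpr L) (v : Val) :
    hSubst B Θ e v e = some v := if_pos rfl

open Classical in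
theorem hSubst_of_rk_ne_Om (he : rk B e ≠ Om) (hx : x ≠ e) :
    hSubst B Θ e v x = if rk B x ≤ rk B e then Θ.S x else none := by
  rw [hSubst.eq_def, if_neg hx, if_pos he]

theorem hSubst_of_rk_lt (h : rk B x < rk B e) : hSubst B Θ e v x = Θ.S x := by
  have hx : x ≠ e := by rintro rfl; exact lt_irrefl _ h
  by_cases he : rk B e = Om
  · rw [hSubst.eq_def, if_neg hx, if_neg (not_not.2 he), if_pos (he ▸ h)]
  · rw [hSubst_of_rk_ne_Om he hx, if_pos h.le]

theorem hSubst_mem (hx : x ≠ .mem n) (hr : Om ≤ rk B x) :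
    hSubst B Θ (.mem n) v x = posPart B Θ.S x := by
  rw [hSubst.eq_def, if_neg hx, if_neg (not_not.2 (rk_mem B n)), if_neg hr.not_gt]

open Classical in
theorem hSubst_cTerm (hx : x ≠ cTerm B n) (hr : Om ≤ rk B x) :
    hSubst B Θ (cTerm B n) v x =
      if ∃ m ∈ Θ.P.takeWhile (· ≠ n), x = .mem m then some .top
      else if ∃ m ∈ Θ.P.takeWhile (· ≠ n), x = cTerm B m ∧ Θ.S x = some .unk then some .unk
      else if n ∈ Θ.P then (Θ.V n).bind (fun W => W x)
      else negPart B Θ.S x := by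
  rw [hSubst.eq_def, if_neg hx, if_neg (not_not.2 (rk_cTerm B n)), if_neg hr.not_gt]
  exact dif_pos rfl

theorem hSubst_of_rk_le (hr : r ≠ Om) (he : r ≤ rk B e) (hx : rk B x ≤ r) (hxe : x ≠ e) :
    hSubst B Θ e v x = Θ.S x := by
  rcases (hx.trans he).lt_or_eq with h | h
  · exact hSubst_of_rk_lt h
  · rw [hSubst_of_rk_ne_Om ((le_antisymm (h ▸ hx) he) ▸ hr) hxe, if_pos h.le]

theorem hSubst_congr (hr : r ≠ Om) (he : r ≤ rk B e) (hS : ∀ x, r < rk B x → Θ.S x = Ψ.S x)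
    (hP : r < Om → Θ.P = Ψ.P) (hV : r < Om → Θ.V = Ψ.V) (hx : r < rk B x) :
    hSubst B Θ e v x = hSubst B Ψ e v x := by
  by_cases h : rk B e = Om
  · have hlt : r < Om := lt_of_le_of_ne (h ▸ he) hr
    unfold hSubst posPart negPart
    rw [hS x hx, hP hlt, hV hlt]
  · simp only [hSubst, if_pos h, hS x hx]

theorem hSubst_cases (h : hSubst B Θ e v x = some u) :
    (x = e ∧ u = v) ∨ Θ.S x = some u ∨ (∃ m ∈ Θ.P, x = .mem m ∧ u = .top) ∨
      ∃ m W, Θ.V m = some W ∧ W x = some u := by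
  by_cases hx : x = e
  · subst hx
    exact .inl ⟨rfl, Option.some.inj (h.symm.trans (hSubst_self ..))⟩
  by_cases he : rk B e = Om
  swap
  · rw [hSubst_of_rk_ne_Om he hx] at h
    split_ifs at h
    exact .inr (.inl h)
  rcases lt_or_ge (rk B x) Om with hr | hr
  · exact .inr (.inl (hSubst_of_rk_lt (he ▸ hr) ▸ h))
  cases e with
  | mem n =>
    rw [hSubst_mem hx hr] at h
    exact .inr (.inl (posPart_le _ _ _ h))
  | term φ a =>
    obtain ⟨n, hn⟩ := exists_eq_cTerm (B := B) (e := .term φ a) trivial he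
    rw [hn] at h hx
    rw [hSubst_cTerm hx hr] at h
    split_ifs at h with h₁ h₂ h₃
    · obtain ⟨m, hm, rfl⟩ := h₁
      exact .inr (.inr (.inl ⟨m, (List.takeWhile_sublist _).mem hm, rfl,
        (Option.some.inj h).symm⟩))
    · obtain ⟨m, -, -, hu⟩ := h₂
      exact .inr (.inl (hu.trans h))
    · obtain ⟨W, hW, hWx⟩ := Option.bind_eq_some_iff.1 h
      exact .inr (.inr (.inr ⟨n, W, hW, hWx⟩))
    · exact .inr (.inl (negPart_eq_some.1 h).1)

theorem hSeq_of_lt (h : rk B e < Om) : hSeq B Θ e = [] := by rw [hSeq.eq_def, if_pos h]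

theorem hSeq_of_gt (h : Om < rk B e) : hSeq B Θ e = Θ.P := by
  rw [hSeq.eq_def, if_neg h.le.not_gt, if_pos h]

theorem hSeq_mem (n : ℕ) : hSeq B Θ (.mem n) = Θ.P ++ [n] := by
  rw [hSeq.eq_def, rk_mem, if_neg (lt_irrefl _), if_neg (lt_irrefl _)]

theorem hSeq_cTerm (n : ℕ) : hSeq B Θ (cTerm B n) = Θ.P.takeWhile (· ≠ n) := by
  rw [hSeq.eq_def, rk_cTerm, if_neg (lt_irrefl _), if_neg (lt_irrefl _)]
  simp only [cTerm, dif_pos]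

theorem hSeq_congr (h : Θ.P = Ψ.P) : hSeq B Θ e = hSeq B Ψ e := by
  unfold hSeq
  rw [h]

theorem hSeq_nodup (hP : Θ.P.Nodup) (he : ∀ n ∈ Θ.P, e ≠ .mem n) : (hSeq B Θ e).Nodup := by
  rcases lt_trichotomy (rk B e) Om with h | h | h
  · exact hSeq_of_lt h ▸ List.nodup_nil
  · cases e with
    | mem m =>
      rw [hSeq_mem]
      exact hP.append (List.nodup_singleton _)
        (List.disjoint_singleton.2 fun hm => he m hm rfl)
    | term φ a =>
      obtain ⟨m, hm⟩ := exists_eq_cTerm (B := B) (e := .term φ a) trivial h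
      rw [hm, hSeq_cTerm]
      exact hP.sublist (List.takeWhile_sublist _)
  · exact hSeq_of_gt h ▸ hP

theorem mem_of_mem_hSeq (h : n ∈ hSeq B Θ e) : e = .mem n ∨ n ∈ Θ.P := by
  unfold hSeq at h
  split_ifs at h
  · cases h
  · exact .inr h
  · cases e with
    | mem m =>
      exact (List.mem_append.1 h).symm.imp_left fun h => by rw [List.mem_singleton.1 h]
    | term φ a =>
      dsimp only at h
      split_ifs at h
      · exact .inr ((List.takeWhile_sublist _).mem h)
      · cases h

theorem mem_hSeq_mem_iff {m : ℕ} (hP : ∀ n, n ∈ Θ.P ↔ Θ.S (.mem n) = some .top) :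
    n ∈ hSeq B Θ (.mem m) ↔ hSubst B Θ (.mem m) .top (.mem n) = some .top := by
  rw [hSeq_mem, List.mem_append, List.mem_singleton]
  by_cases hnm : n = m
  · exact iff_of_true (.inr hnm) (hnm ▸ hSubst_self ..)
  · rw [hSubst_mem (fun h => hnm (CExpr.mem.inj h)) le_rfl, posPart_mem_eq_top, hP,
      or_iff_left hnm]

theorem mem_hSeq_cTerm_iff {m : ℕ} (hV : ∀ n W, Θ.V n = some W → IsHistVal B W) :
    n ∈ hSeq B Θ (cTerm B m) ↔ hSubst B Θ (cTerm B m) v (.mem n) = some .top := by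
  have hneg : ¬ IsNegPair B (.mem n) .top := id
  rw [hSeq_cTerm, hSubst_cTerm (mem_ne_cTerm B n m) le_rfl]
  split_ifs with h₁ h₂ h₃
  · obtain ⟨n', hn', hnn'⟩ := h₁
    cases hnn'
    exact iff_of_true hn' rfl
  · obtain ⟨n', -, h, -⟩ := h₂
    exact absurd h (mem_ne_cTerm B n n')
  · refine iff_of_false (fun h => h₁ ⟨n, h, rfl⟩) fun h => ?_
    obtain ⟨W, hW, hWn⟩ := Option.bind_eq_some_iff.1 h
    exact hneg ((hV _ _ hW).isNegPair hWn)
  · exact iff_of_false (fun h => h₁ ⟨n, h, rfl⟩) fun h => hneg (negPart_eq_some.1 h).2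

theorem mem_hSeq_iff (hΘ : Θ.IsSequent B) (hv : v.Fits e) (hvu : v ≠ .unk) (n : ℕ) :
    n ∈ hSeq B Θ e ↔ hSubst B Θ e v (.mem n) = some .top := by
  rcases lt_trichotomy (rk B e) Om with h | h | h
  · rw [hSeq_of_lt h, hSubst_of_rk_ne_Om h.ne (by rintro rfl; exact lt_irrefl _ h),
      if_neg (show ¬ rk B (.mem n) ≤ rk B e from h.not_ge)]
    exact iff_of_false List.not_mem_nil nofun
  · cases e with
    | mem m =>
      obtain rfl := hv.eq_unk_or_eq_top.resolve_left hvu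
      exact mem_hSeq_mem_iff hΘ.mem_P
    | term φ a =>
      obtain ⟨m, hm⟩ := exists_eq_cTerm (B := B) (e := .term φ a) trivial h
      exact hm ▸ mem_hSeq_cTerm_iff hΘ.val_V
  · rw [hSeq_of_gt h, hSubst_of_rk_lt h, hΘ.mem_P]

theorem hHist_of_gt (hΘ : Θ.IsSequent B) (h : Om < rk B e) : hHist B Θ e = Θ.V := by
  funext m
  rw [hHist, if_neg (by rintro rfl; exact lt_irrefl _ h), hSeq_of_gt h]
  split_ifs with hm
  · rfl
  · exact (Option.not_isSome_iff_eq_none.1 (mt (hΘ.dom_V m).1 hm)).symm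

theorem hHist_congr (hS : ∀ x, rk B x = Om → Θ.S x = Ψ.S x) (hP : Θ.P = Ψ.P) (hV : Θ.V = Ψ.V) :
    hHist B Θ e = hHist B Ψ e := by
  funext m
  simp only [hHist, negPart_congr hS, hSeq_congr hP, hV]

theorem isSome_hHist_iff (hV : ∀ n ∈ Θ.P, (Θ.V n).isSome) :
    (hHist B Θ e n).isSome ↔ n ∈ hSeq B Θ e := by
  unfold hHist
  split_ifs with he hn
  · exact iff_of_true rfl (by rw [he, hSeq_mem]; exact List.mem_append_right _ (.head _))
  · exact iff_of_true (hV n ((mem_of_mem_hSeq hn).resolve_left he)) hn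
  · exact iff_of_false nofun hn

theorem isHistVal_of_hHist (hΘ : Θ.IsSequent B)
    (hfin : ∀ n, e = .mem n → {x | negPart B Θ.S x ≠ none}.Finite) {W : Subst L}
    (h : hHist B Θ e n = some W) : IsHistVal B W := by
  unfold hHist at h
  split_ifs at h with he
  · exact Option.some.inj h ▸ isHistVal_negPart hΘ.isSubst (hfin n he)
  · exact hΘ.val_V _ _ h

theorem isSubst_hSubst (hΘ : Θ.IsSequent B) (hv : v.Fits e) (hunk : Θ.S e = some .unk) :
    IsSubst (hSubst B Θ e v) := by
  intro x u h
  rcases hSubst_cases h with ⟨rfl, rfl⟩ | h | ⟨m, -, rfl, rfl⟩ | ⟨m, W, hW, h⟩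
  · exact ⟨(hΘ.isSubst _ _ hunk).1, hv⟩
  · exact hΘ.isSubst _ _ h
  · exact ⟨trivial, trivial⟩
  · exact (hΘ.val_V _ _ hW).1 _ _ h

theorem isSome_hStep_F_iff (hΘ : Θ.IsSequent B) (hvu : v ≠ .unk) :
    ((hStep B Θ e v).F x).isSome ↔
      hSubst B Θ e v x = some .unk ∨ ((hSubst B Θ e v x).isSome ∧ rk B x = Om) := by
  unfold hStep
  dsimp only
  split_ifs with hx hold
  · refine iff_of_true ((hΘ.dom_F x).2 ?_) hx
    by_cases hr : rk B x = Om
    · exact .inr ⟨hold, hr⟩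
    rcases hSubst_cases (hx.resolve_right fun h => hr h.2) with
      ⟨-, h⟩ | h | ⟨m, -, -, h⟩ | ⟨m, W, hW, h⟩
    · exact absurd h.symm hvu
    · exact .inl h
    · cases h
    · exact absurd ((hΘ.val_V _ _ hW).isNegPair h).rk_eq hr
  · exact iff_of_true rfl hx
  · exact iff_of_false nofun hx

theorem Sequent.IsSequent.hStep (hΘ : Θ.IsSequent B) (hv : v.Fits e) (hunk : Θ.S e = some .unk)
    (hvu : v ≠ .unk) (hfin : ∀ n, e = .mem n → {x | negPart B Θ.S x ≠ none}.Finite) :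
    (hStep B Θ e v).IsSequent B where
  isSubst := isSubst_hSubst hΘ hv hunk
  nodup := hSeq_nodup hΘ.nodup fun n hn he => by
    cases ((hΘ.mem_P n).1 hn).symm.trans (he ▸ hunk)
  mem_P := mem_hSeq_iff hΘ hv hvu
  dom_V _ := isSome_hHist_iff fun n hn => (hΘ.dom_V n).2 hn
  val_V _ _ := isHistVal_of_hHist hΘ hfin
  dom_F _ := isSome_hStep_F_iff hΘ hvu

theorem hStep_F_of_eq (hΘ : Θ.IsSequent B) (h : hSubst B Θ e v x = Θ.S x) :
    (hStep B Θ e v).F x = Θ.F x := by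
  unfold hStep
  dsimp only
  rw [h]
  split_ifs with hx hsome
  · rfl
  · exact absurd (hx.elim (fun h => h ▸ rfl) fun h => h.1) hsome
  · exact (Option.not_isSome_iff_eq_none.1 (mt (hΘ.dom_F x).1 hx)).symm

theorem hStep_F_self (he : rk B e ≠ Om) (hvu : v ≠ .unk) : (hStep B Θ e v).F e = none := by
  unfold hStep
  dsimp only
  rw [if_neg]
  rintro (h | ⟨-, h⟩)
  · exact hvu (Option.some.inj ((hSubst_self B Θ e v).symm.trans h))
  · exact he h

end HStep

/-! ### Extensions of sequents -/

section Extension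

variable {B : Fm L 2} {Θ : Sequent L} {e x : CExpr L} {u : Val}
  {f : Option Bool} {Pe : List ℕ} {Ve : ℕ → Option (Subst L)}

theorem Sequent.IsSequent.F_eq_none (hΘ : Θ.IsSequent B) (he : Θ.S e = none) : Θ.F e = none := by
  have h := mt (hΘ.dom_F e).1 (by simp [he])
  simpa using h

theorem Sequent.IsSequent.F_eq_false (hΘ : Θ.IsSequent B) (hx : Θ.S x = some .unk)
    (h : Θ.F x ≠ some true) : Θ.F x = some false := by
  obtain ⟨b, hb⟩ := Option.isSome_iff_exists.1 ((hΘ.dom_F x).2 (.inl hx))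
  cases b with
  | false => exact hb
  | true => exact absurd hb h

theorem Sequent.isSequent_empty : (Sequent.empty : Sequent L).IsSequent B where
  isSubst e u h := by simp [Sequent.empty] at h
  nodup := List.nodup_nil
  mem_P := by simp [Sequent.empty]
  dom_V := by simp [Sequent.empty]
  val_V := by simp [Sequent.empty]
  dom_F := by simp [Sequent.empty]

open Classical in
/-- The sequent `Θ` with the value of `e` set to `u` and its mark to `f`. For an `e` without a value
this is `(e, u), Θ` if `f` is `none`, and `(e, u, i), Θ` if `f` is `some i`. -/
def Sequent.update (Θ : Sequent L) (e : CExpr L) (u : Val) (f : Option Bool) : Sequent L :=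
  { Θ with S := Function.update Θ.S e (some u), F := Function.update Θ.F e f }

theorem Sequent.update_S_self : (Θ.update e u f).S e = some u := by
  simp [Sequent.update]

theorem Sequent.update_S_of_ne (hx : x ≠ e) : (Θ.update e u f).S x = Θ.S x := by
  simp [Sequent.update, hx]

theorem Sequent.update_F_self : (Θ.update e u f).F e = f := by
  simp [Sequent.update]

theorem Sequent.update_F_of_ne (hx : x ≠ e) : (Θ.update e u f).F x = Θ.F x := by
  simp [Sequent.update, hx]

open Classical in
theorem Sequent.IsSequent.addNum_eq_update (hΘ : Θ.IsSequent B) (he : Θ.S e = none) (k : ℕ) :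
    Θ.addNum e k = Θ.update e (.num k) none := by
  simp only [Sequent.addNum, Sequent.update]
  rw [← hΘ.F_eq_none he, Function.update_eq_self]

theorem Sequent.le_update (he : Θ.S e = none) : Θ.S.Le (Θ.update e u f).S := by
  intro x w hx
  have hxe : x ≠ e := by rintro rfl; simp [he] at hx
  rw [Sequent.update_S_of_ne hxe, hx]

theorem Sequent.IsSequent.update (hΘ : Θ.IsSequent B) (he : Θ.S e = none) (hL : e.InLang)
    (hu : u.Fits e) (hut : u ≠ .top) (hf : f.isSome ↔ u = .unk ∨ rk B e = Om) :
    (Θ.update e u f).IsSequent B where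
  isSubst x w h := by
    by_cases hx : x = e
    · subst hx
      rw [Sequent.update_S_self] at h
      cases h
      exact ⟨hL, hu⟩
    · rw [Sequent.update_S_of_ne hx] at h
      exact hΘ.isSubst x w h
  nodup := hΘ.nodup
  mem_P n := by
    by_cases hx : .mem n = e
    · subst hx
      simp [Sequent.update, hΘ.mem_P, he, hut]
    · rw [Sequent.update_S_of_ne hx]
      exact hΘ.mem_P n
  dom_V := hΘ.dom_V
  val_V := hΘ.val_V
  dom_F x := by
    by_cases hx : x = e
    · subst hx
      simp [Sequent.update_S_self, Sequent.update_F_self, hf]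
    · rw [Sequent.update_S_of_ne hx, Sequent.update_F_of_ne hx, hΘ.dom_F]

theorem Sequent.addForms_S_mem {m : ℕ} (hm : m ∈ Pe) (i : Bool) :
    (Θ.addForms Pe Ve i).S (.mem m) = some .top := if_pos hm

theorem Sequent.addForms_S_of_isTerm (i : Bool) (hx : x.IsTerm) :
    (Θ.addForms Pe Ve i).S x = Θ.S x := by
  cases x with
  | term φ a => rfl
  | mem m => exact hx.elim

theorem Sequent.addForms_F_of_isTerm (i : Bool) (hx : x.IsTerm) :
    (Θ.addForms Pe Ve i).F x = Θ.F x := by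
  cases x with
  | term φ a => rfl
  | mem m => exact hx.elim

theorem Sequent.le_addForms (h : ∀ m ∈ Pe, Θ.S (.mem m) = none) (i : Bool) :
    Θ.S.Le (Θ.addForms Pe Ve i).S := by
  intro x u hx
  cases x with
  | term φ a => exact hx
  | mem m =>
    have hm : m ∉ Pe := fun hm => by simp [h m hm] at hx
    exact (if_neg hm).trans hx

theorem Sequent.IsSequent.addForms (hΘ : Θ.IsSequent B) (hnd : Pe.Nodup)
    (hdisj : ∀ m ∈ Pe, m ∉ Θ.P) (hV : IsHist B Pe Ve) (i : Bool) :
    (Θ.addForms Pe Ve i).IsSequent B where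
  isSubst x w h := by
    cases x with
    | term φ a => exact hΘ.isSubst _ _ h
    | mem m =>
      by_cases hm : m ∈ Pe
      · rw [Sequent.addForms_S_mem hm] at h
        cases h
        exact ⟨trivial, trivial⟩
      · exact hΘ.isSubst _ _ ((if_neg hm).symm.trans h)
  nodup := hΘ.nodup.append hnd fun m hm hm' => hdisj m hm' hm
  mem_P m := by
    by_cases hm : m ∈ Pe <;> simp [Sequent.addForms, hm, hΘ.mem_P]
  dom_V m := by
    by_cases hm : m ∈ Pe <;> simp [Sequent.addForms, hm, hΘ.dom_V, hV.1]
  val_V m W h := by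
    by_cases hm : m ∈ Pe
    · exact hV.2 m W ((if_pos hm).symm.trans h)
    · exact hΘ.val_V m W ((if_neg hm).symm.trans h)
  dom_F x := by
    cases x with
    | term φ a => exact hΘ.dom_F _
    | mem m =>
      by_cases hm : m ∈ Pe <;> simp [Sequent.addForms, hm, hΘ.dom_F, rk_mem]

open Classical in
theorem Sequent.IsSequent.isHist_of_subset (hΘ : Θ.IsSequent B) (h : Pe ⊆ Θ.P) :
    IsHist B Pe fun m => if m ∈ Pe then Θ.V m else none := by
  refine ⟨fun m => ?_, fun m W hW => ?_⟩
  · by_cases hm : m ∈ Pe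
    · simp [hm, (hΘ.dom_V m).2 (h hm)]
    · simp [hm]
  · by_cases hm : m ∈ Pe
    · exact hΘ.val_V m W ((if_pos hm).symm.trans hW)
    · exact nomatch (if_neg hm).symm.trans hW

end Extension

/-! ### Comparison of sequents below and above a rank -/

section Compare

variable {B : Fm L 2} {r : Ordinal.{0}} {Θ Ψ Φ : Sequent L} {e x : CExpr L} {u v : Val}
  {f : Option Bool} {Pe : List ℕ} {Ve : ℕ → Option (Subst L)}

/-- `Θ` and `Ψ` have the same part of rank `> r`; the components `P` and `V` count as having
rank `Ω`. -/
structure EqAbove (B : Fm L 2) (r : Ordinal.{0}) (Θ Ψ : Sequent L) : Prop where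
  S_eq : ∀ x, r < rk B x → Ψ.S x = Θ.S x
  F_eq : ∀ x, r < rk B x → Ψ.F x = Θ.F x
  P_eq : r < Om → Ψ.P = Θ.P
  V_eq : r < Om → Ψ.V = Θ.V

/-- `Θ` and `Ψ` have the same part of rank `≤ r`; the components `P` and `V` count as having
rank `Ω`. -/
structure EqUpTo (B : Fm L 2) (r : Ordinal.{0}) (Θ Ψ : Sequent L) : Prop where
  S_eq : ∀ x, rk B x ≤ r → Ψ.S x = Θ.S x
  F_eq : ∀ x, rk B x ≤ r → Ψ.F x = Θ.F x
  P_eq : Om < r → Ψ.P = Θ.P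
  V_eq : Om < r → Ψ.V = Θ.V

/-- The part of rank `≤ r` of `Θ` is contained in `Ψ`. Of the marks only those of rank `r` with
value `f` are compared. -/
structure SubUpTo (B : Fm L 2) (r : Ordinal.{0}) (Θ Ψ : Sequent L) : Prop where
  S_le : ∀ x u, rk B x ≤ r → Θ.S x = some u → Ψ.S x = some u
  F_false : ∀ x, rk B x = r → Θ.F x = some false → Ψ.F x = some false
  isPrefix_P : Om < r → Θ.P <+: Ψ.P
  V_le : Om < r → ∀ m W, Θ.V m = some W → Ψ.V m = some W

theorem EqAbove.symm (h : EqAbove B r Θ Ψ) : EqAbove B r Ψ Θ :=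
  ⟨fun x hx => (h.S_eq x hx).symm, fun x hx => (h.F_eq x hx).symm, fun hr => (h.P_eq hr).symm,
    fun hr => (h.V_eq hr).symm⟩

theorem EqAbove.trans (h : EqAbove B r Θ Ψ) (h' : EqAbove B r Ψ Φ) : EqAbove B r Θ Φ :=
  ⟨fun x hx => (h'.S_eq x hx).trans (h.S_eq x hx), fun x hx => (h'.F_eq x hx).trans (h.F_eq x hx),
    fun hr => (h'.P_eq hr).trans (h.P_eq hr), fun hr => (h'.V_eq hr).trans (h.V_eq hr)⟩

theorem EqUpTo.symm (h : EqUpTo B r Θ Ψ) : EqUpTo B r Ψ Θ :=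
  ⟨fun x hx => (h.S_eq x hx).symm, fun x hx => (h.F_eq x hx).symm, fun hr => (h.P_eq hr).symm,
    fun hr => (h.V_eq hr).symm⟩

theorem EqUpTo.trans (h : EqUpTo B r Θ Ψ) (h' : EqUpTo B r Ψ Φ) : EqUpTo B r Θ Φ :=
  ⟨fun x hx => (h'.S_eq x hx).trans (h.S_eq x hx), fun x hx => (h'.F_eq x hx).trans (h.F_eq x hx),
    fun hr => (h'.P_eq hr).trans (h.P_eq hr), fun hr => (h'.V_eq hr).trans (h.V_eq hr)⟩

theorem EqUpTo.eq_of_eqAbove (hr : r ≠ Om) (h : EqUpTo B r Θ Ψ) (h' : EqAbove B r Θ Ψ) :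
    Ψ = Θ := by
  have hS : Ψ.S = Θ.S := funext fun x => (le_or_gt (rk B x) r).elim (h.S_eq x) (h'.S_eq x)
  have hF : Ψ.F = Θ.F := funext fun x => (le_or_gt (rk B x) r).elim (h.F_eq x) (h'.F_eq x)
  have hP : Ψ.P = Θ.P := hr.lt_or_gt.elim h'.P_eq h.P_eq
  have hV : Ψ.V = Θ.V := hr.lt_or_gt.elim h'.V_eq h.V_eq
  cases Θ
  cases Ψ
  simp_all only

theorem SubUpTo.refl (Θ : Sequent L) : SubUpTo B r Θ Θ :=
  ⟨fun _ _ _ h => h, fun _ _ h => h, fun _ => List.prefix_rfl, fun _ _ _ h => h⟩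

theorem SubUpTo.trans (h : SubUpTo B r Θ Ψ) (h' : SubUpTo B r Ψ Φ) : SubUpTo B r Θ Φ :=
  ⟨fun x u hx hu => h'.S_le x u hx (h.S_le x u hx hu),
    fun x hx hf => h'.F_false x hx (h.F_false x hx hf),
    fun hr => (h.isPrefix_P hr).trans (h'.isPrefix_P hr),
    fun hr m W hW => h'.V_le hr m W (h.V_le hr m W hW)⟩

theorem EqUpTo.subUpTo (h : EqUpTo B r Θ Ψ) : SubUpTo B r Θ Ψ :=
  ⟨fun x _ hx hu => (h.S_eq x hx).trans hu, fun x hx hf => (h.F_eq x hx.le).trans hf,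
    fun hr => h.P_eq hr ▸ List.prefix_rfl, fun hr m _ hW => (congrFun (h.V_eq hr) m).trans hW⟩

theorem EqAbove.update (h : EqAbove B r Θ Ψ) (e : CExpr L) (u : Val) (f : Option Bool) :
    EqAbove B r (Θ.update e u f) (Ψ.update e u f) where
  S_eq x hx := by
    by_cases hxe : x = e
    · subst hxe
      rw [Sequent.update_S_self, Sequent.update_S_self]
    · rw [Sequent.update_S_of_ne hxe, Sequent.update_S_of_ne hxe, h.S_eq x hx]
  F_eq x hx := by
    by_cases hxe : x = e
    · subst hxe
      rw [Sequent.update_F_self, Sequent.update_F_self]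
    · rw [Sequent.update_F_of_ne hxe, Sequent.update_F_of_ne hxe, h.F_eq x hx]
  P_eq := h.P_eq
  V_eq := h.V_eq

theorem eqAbove_update (he : rk B e ≤ r) : EqAbove B r Θ (Θ.update e u f) where
  S_eq _ hx := Sequent.update_S_of_ne fun h => hx.not_ge (h ▸ he)
  F_eq _ hx := Sequent.update_F_of_ne fun h => hx.not_ge (h ▸ he)
  P_eq _ := rfl
  V_eq _ := rfl

theorem eqUpTo_update (he : r < rk B e) : EqUpTo B r Θ (Θ.update e u f) where
  S_eq _ hx := Sequent.update_S_of_ne fun h => he.not_ge (h ▸ hx)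
  F_eq _ hx := Sequent.update_F_of_ne fun h => he.not_ge (h ▸ hx)
  P_eq _ := rfl
  V_eq _ := rfl

theorem SubUpTo.update (h : SubUpTo B r Θ Ψ) (e : CExpr L) (u : Val) (f : Option Bool) :
    SubUpTo B r (Θ.update e u f) (Ψ.update e u f) where
  S_le x w hx hw := by
    by_cases hxe : x = e
    · subst hxe
      rwa [Sequent.update_S_self] at hw ⊢
    · rw [Sequent.update_S_of_ne hxe] at hw ⊢
      exact h.S_le x w hx hw
  F_false x hx hf := by
    by_cases hxe : x = e
    · subst hxe
      rwa [Sequent.update_F_self] at hf ⊢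
    · rw [Sequent.update_F_of_ne hxe] at hf ⊢
      exact h.F_false x hx hf
  isPrefix_P := h.isPrefix_P
  V_le := h.V_le

theorem SubUpTo.update_left (h : SubUpTo B r Θ Ψ) (he : Ψ.S e = some u)
    (hf : rk B e = r → f = some false → Ψ.F e = some false) :
    SubUpTo B r (Θ.update e u f) Ψ where
  S_le x w hx hw := by
    by_cases hxe : x = e
    · subst hxe
      rwa [Sequent.update_S_self, ← he] at hw
    · rw [Sequent.update_S_of_ne hxe] at hw
      exact h.S_le x w hx hw
  F_false x hx hxf := by
    by_cases hxe : x = e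
    · subst hxe
      exact hf hx (Sequent.update_F_self.symm.trans hxf)
    · rw [Sequent.update_F_of_ne hxe] at hxf
      exact h.F_false x hx hxf
  isPrefix_P := h.isPrefix_P
  V_le := h.V_le

theorem Sequent.IsSequent.subUpTo_update (hΘ : Θ.IsSequent B) (he : Θ.S e = none) :
    SubUpTo B r Θ (Θ.update e u f) where
  S_le x w _ hw := Sequent.le_update he x w hw
  F_false x _ hxf := by
    rw [Sequent.update_F_of_ne, hxf]
    rintro rfl
    simp [hΘ.F_eq_none he] at hxf
  isPrefix_P _ := List.prefix_rfl
  V_le _ _ _ h := h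

theorem eqAbove_addForms (hr : Om < r) (i : Bool) : EqAbove B r Θ (Θ.addForms Pe Ve i) where
  S_eq _ hx := Sequent.addForms_S_of_isTerm i (isTerm_of_rk_ne (hr.trans hx).ne')
  F_eq _ hx := Sequent.addForms_F_of_isTerm i (isTerm_of_rk_ne (hr.trans hx).ne')
  P_eq h := absurd hr h.not_gt
  V_eq h := absurd hr h.not_gt

theorem Sequent.IsSequent.subUpTo_addForms (hΘ : Θ.IsSequent B) (hr : r ≠ Om)
    (hfresh : ∀ m ∈ Pe, Θ.S (.mem m) = none) (i : Bool) :
    SubUpTo B r Θ (Θ.addForms Pe Ve i) where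
  S_le x u _ hu := Sequent.le_addForms hfresh i x u hu
  F_false _ hx hf :=
    (Sequent.addForms_F_of_isTerm i (isTerm_of_rk_ne (hx.symm ▸ hr))).trans hf
  isPrefix_P _ := List.prefix_append ..
  V_le _ m W hW := by
    have hm : m ∉ Pe := fun hm => by
      have htop := (hΘ.mem_P m).1 ((hΘ.dom_V m).1 (by simp [hW]))
      simp [hfresh m hm] at htop
    exact (if_neg hm).trans hW

open Classical in
theorem SubUpTo.addForms_left (h : SubUpTo B r Θ Ψ) (hr : r ≠ Om) (hΨ : Ψ.IsSequent B)
    (hP : Θ.P ++ Pe <+: Ψ.P) :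
    SubUpTo B r (Θ.addForms Pe (fun m => if m ∈ Pe then Ψ.V m else none) false) Ψ where
  S_le x u hx hu := by
    cases x with
    | term φ a => exact h.S_le _ u hx hu
    | mem m =>
      by_cases hm : m ∈ Pe
      · rw [Sequent.addForms_S_mem hm] at hu
        rw [← hu]
        exact (hΨ.mem_P m).1 (hP.subset (List.mem_append_right _ hm))
      · exact h.S_le _ u hx ((if_neg hm).symm.trans hu)
  F_false x hx hf := by
    rw [Sequent.addForms_F_of_isTerm false (isTerm_of_rk_ne (hx.symm ▸ hr))] at hf
    exact h.F_false x hx hf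
  isPrefix_P _ := hP
  V_le hlt m W hW := by
    by_cases hm : m ∈ Pe
    · exact (if_pos hm).symm.trans ((if_pos hm).symm.trans hW)
    · exact h.V_le hlt m W ((if_neg hm).symm.trans hW)

theorem EqAbove.hStep (h : EqAbove B r Θ Ψ) (hr : r ≠ Om) (he : r ≤ rk B e) :
    EqAbove B r (hStep B Θ e v) (hStep B Ψ e v) where
  S_eq _ hx := hSubst_congr hr he h.S_eq h.P_eq h.V_eq hx
  F_eq x hx := by
    simp only [EpsID1.hStep]
    rw [hSubst_congr hr he h.S_eq h.P_eq h.V_eq hx, h.S_eq x hx, h.F_eq x hx]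
  P_eq hlt := hSeq_congr (h.P_eq hlt)
  V_eq hlt := hHist_congr (fun x hx => h.S_eq x (hx ▸ hlt)) (h.P_eq hlt) (h.V_eq hlt)

theorem Sequent.IsSequent.eqUpTo_hStep (hΘ : Θ.IsSequent B) (he : r < rk B e) :
    EqUpTo B r Θ (EpsID1.hStep B Θ e v) where
  S_eq _ hx := hSubst_of_rk_lt (hx.trans_lt he)
  F_eq _ hx := hStep_F_of_eq hΘ (hSubst_of_rk_lt (hx.trans_lt he))
  P_eq hr := hSeq_of_gt (hr.trans he)
  V_eq hr := hHist_of_gt hΘ (hr.trans he)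

theorem SubUpTo.hStep (h : SubUpTo B r Θ Ψ) (hr : r ≠ Om) (hΘ : Θ.IsSequent B)
    (hΨ : Ψ.IsSequent B) (he : r ≤ rk B e) (hv : v ≠ .unk) :
    SubUpTo B r (hStep B Θ e v) (hStep B Ψ e v) where
  S_le x u hx hu := by
    change hSubst B _ e v x = _ at hu ⊢
    by_cases hxe : x = e
    · subst hxe
      rwa [hSubst_self] at hu ⊢
    · rw [hSubst_of_rk_le hr he hx hxe] at hu ⊢
      exact h.S_le x u hx hu
  F_false x hx hf := by
    by_cases hxe : x = e
    · subst hxe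
      simp [hStep_F_self (hx ▸ hr) hv] at hf
    · rw [hStep_F_of_eq hΘ (hSubst_of_rk_le hr he hx.le hxe)] at hf
      rw [hStep_F_of_eq hΨ (hSubst_of_rk_le hr he hx.le hxe)]
      exact h.F_false x hx hf
  isPrefix_P hlt := by
    change hSeq B Θ e <+: hSeq B Ψ e
    rw [hSeq_of_gt (hlt.trans_le he), hSeq_of_gt (hlt.trans_le he)]
    exact h.isPrefix_P hlt
  V_le hlt := by
    change ∀ m W, hHist B Θ e m = some W → hHist B Ψ e m = some W
    rw [hHist_of_gt hΘ (hlt.trans_le he), hHist_of_gt hΨ (hlt.trans_le he)]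
    exact h.V_le hlt

theorem SubUpTo.hStep_right (h : SubUpTo B r Θ Ψ) (hr : r ≠ Om) (hΘ : Θ.IsSequent B)
    (hΨ : Ψ.IsSequent B) (he : rk B e = r) (hS : Θ.S e = none) :
    SubUpTo B r Θ (EpsID1.hStep B Ψ e v) where
  S_le x w hx hw := by
    have hxe : x ≠ e := by rintro rfl; simp [hS] at hw
    exact (hSubst_of_rk_le hr he.ge hx hxe).trans (h.S_le x w hx hw)
  F_false x hx hf := by
    have hxe : x ≠ e := by rintro rfl; simp [hΘ.F_eq_none hS] at hf
    rw [hStep_F_of_eq hΨ (hSubst_of_rk_le hr he.ge hx.le hxe), h.F_false x hx hf]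
  isPrefix_P hlt := by
    change Θ.P <+: hSeq B Ψ e
    rw [hSeq_of_gt (he ▸ hlt)]
    exact h.isPrefix_P hlt
  V_le hlt := by
    change ∀ m W, Θ.V m = some W → hHist B Ψ e m = some W
    rw [hHist_of_gt hΨ (he ▸ hlt)]
    exact h.V_le hlt

theorem Active.eq_of_rk_ne (he : rk B e ≠ Om) (h : Active B Θ e v x) : x = e := by
  by_contra hx
  exact h.2.2 ((hSubst_of_rk_ne_Om he hx).trans (if_pos h.2.1.le))

theorem active_self (he : Θ.S e = some .unk) (hv : v ≠ .unk) : Active B Θ e v e := by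
  refine ⟨by simp [he], rfl, ?_⟩
  rw [hSubst_self, he]
  exact fun h => hv (Option.some.inj h)

theorem EqAbove.active_iff (h : EqAbove B r Θ Ψ) (hr : r ≠ Om) (he : r ≤ rk B e)
    (hx : r < rk B x) : Active B Ψ e v x ↔ Active B Θ e v x := by
  unfold Active
  rw [h.S_eq x hx, hSubst_congr hr he h.S_eq h.P_eq h.V_eq hx]

end Compare

/-! ### Inferences -/

section Inference

variable {B : Fm L 2} {r : Ordinal.{0}} {R : Rule L} {u : Val} {f : Option Bool}

/-- `R.Assigns u f`: one premise of `R` assigns the value `u` with mark `f` to the main expression.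
The value `⊤` is not covered, and rules `H` assign nothing. -/
def Rule.Assigns : Rule L → Val → Option Bool → Prop
  | .cut _, u, f => u = .unk ∧ f = some false ∨ ∃ k, 0 < k ∧ u = .num k ∧ f = none
  | .cutFr _, u, f => u = .unk ∧ f = some true ∨ ∃ k, 0 < k ∧ u = .num k ∧ f = none
  | .cutTerm _, u, f => u = .unk ∧ f = some false ∨ ∃ k, 0 < k ∧ u = .num k ∧ f = some false
  | .cutFrTerm _, u, f => u = .unk ∧ f = some true ∨ ∃ k, 0 < k ∧ u = .num k ∧ f = some false
  | .cutForm _, u, f => u = .unk ∧ f = some false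
  | .fr _, u, f => u = .unk ∧ f = some true
  | .h _ _, _, _ => False

theorem Rule.Assigns.name_ne_H (h : R.Assigns u f) : R.name ≠ .H := by
  cases R with
  | h e v => exact h.elim
  | _ => exact nofun

theorem Rule.Assigns.name_ne_cut (h : R.Assigns u (some true)) : R.name ≠ .Cut := by
  cases R <;> simp_all [Rule.Assigns, Rule.name]

/-- The restriction on the rules of an `r`-deduction. -/
def Rule.IsR (B : Fm L 2) (r : Ordinal.{0}) (R : Rule L) : Prop :=
  match R.name with
  | .Cut => rk B R.main < r
  | .CutFr => rk B R.main < 0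
  | .Fr => r ≤ rk B R.main
  | .H => r ≤ rk B R.main

/-- The restriction on the rules of an `r⁺`-deduction. -/
def Rule.IsRPlus (B : Fm L 2) (r : Ordinal.{0}) (R : Rule L) : Prop :=
  match R.name with
  | .Cut => rk B R.main < r
  | .CutFr => rk B R.main = r
  | .Fr => r < rk B R.main
  | .H => r ≤ rk B R.main

theorem Rule.IsR.name_eq_cut_or_le (h : R.IsR B r) : R.name = .Cut ∨ r ≤ rk B R.main := by
  cases R <;> simp_all [Rule.IsR, Rule.name]

theorem Rule.IsRPlus.name_eq_cut_or_le (h : R.IsRPlus B r) :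
    R.name = .Cut ∨ r ≤ rk B R.main := by
  cases R <;> simp_all [Rule.IsRPlus, Rule.name, le_of_lt]

theorem Rule.IsRPlus.name_eq_cut_or_eq_cutFr (h : R.IsRPlus B r) (hR : R.name ≠ .H)
    (hle : rk B R.main ≤ r) : R.name = .Cut ∨ R.name = .CutFr := by
  cases R <;> simp_all [Rule.IsRPlus, Rule.name, hle.not_gt]

theorem Rule.IsR.cut_or_fr_or_h (h : R.IsR B (r + 1)) :
    (R.name = .Cut ∧ rk B R.main ≤ r) ∨ (∃ e, R = .fr e ∧ r < rk B e) ∨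
      ∃ e v, R = .h e v ∧ r < rk B e := by
  cases R with
  | cutFr e => exact absurd h not_lt_zero
  | cutFrTerm e => exact absurd h not_lt_zero
  | fr e => exact .inr (.inl ⟨e, rfl, Order.add_one_le_iff.1 h⟩)
  | h e v => exact .inr (.inr ⟨e, v, rfl, Order.add_one_le_iff.1 h⟩)
  | _ => exact .inl ⟨rfl, Order.lt_add_one_iff.1 h⟩

theorem Rule.IsRPlus.prune (h : R.IsRPlus B r) : R.prune.IsR B r := by
  cases R with
  | cutFr e => exact h.ge
  | cutFrTerm e => exact h.ge
  | fr e => exact h.le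
  | _ => exact h

variable [L.Structure ℕ] {Cr : List (Crit L)} {Θ Θ' Ψ : Sequent L}

/-- The premises of `R` with conclusion `Θ`, sorted by their form. -/
inductive Rule.Premise (B : Fm L 2) (Cr : List (Crit L)) (Θ : Sequent L) : Rule L → Sequent L → Prop
  | update {R : Rule L} {u : Val} {f : Option Bool} (h : R.Assigns u f) :
      Premise B Cr Θ R (Θ.update R.main u f)
  | addForms {n : ℕ} {Pe : List ℕ} {Ve : ℕ → Option (Subst L)} (hP : Proper B n Θ Pe)
      (hV : IsHist B Pe Ve) : Premise B Cr Θ (.cutForm n) (Θ.addForms Pe Ve false)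
  | hStep {e : CExpr L} {v : Val} (h : HApplies B Cr Θ e v) :
      Premise B Cr Θ (.h e v) (hStep B Θ e v)

theorem Rule.Applies.eq_none (ha : R.Applies B Cr Θ) (hR : R.name ≠ .H) : Θ.S R.main = none := by
  cases R with
  | cutForm n => exact ha
  | fr e => exact ha.2
  | h e v => exact absurd rfl hR
  | _ => exact ha.2.2.2

theorem Rule.Applies.of_eq_none (ha : R.Applies B Cr Θ) (hΘ : Θ.S R.main = none)
    (hΨ : Ψ.S R.main = none) : R.Applies B Cr Ψ := by
  cases R with
  | cutForm n => exact hΨ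
  | fr e => exact ⟨ha.1, hΨ⟩
  | h e v => simp [Rule.main, ha.1.unk] at hΘ
  | _ => exact ⟨ha.1, ha.2.1, ha.2.2.1, hΨ⟩

theorem Rule.premise_of_mem (hΘ : Θ.IsSequent B) (ha : R.Applies B Cr Θ)
    (hp : Θ' ∈ R.premises B Θ) : R.Premise B Cr Θ Θ' := by
  cases R with
  | cut e | cutFr e =>
    rcases hp with rfl | ⟨k, hk, rfl⟩
    · exact .update (.inl ⟨rfl, rfl⟩)
    · rw [hΘ.addNum_eq_update ha.2.2.2]
      exact .update (.inr ⟨k, hk, rfl, rfl⟩)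
  | cutTerm e | cutFrTerm e =>
    rcases hp with rfl | ⟨k, hk, rfl⟩
    · exact .update (.inl ⟨rfl, rfl⟩)
    · exact .update (.inr ⟨k, hk, rfl, rfl⟩)
  | cutForm n =>
    rcases hp with rfl | ⟨Pe, Ve, hP, hV, rfl⟩
    · exact .update ⟨rfl, rfl⟩
    · exact .addForms hP hV
  | fr e =>
    cases hp
    exact .update ⟨rfl, rfl⟩
  | h e v =>
    cases hp
    exact .hStep ha.1

theorem Rule.Assigns.update_mem_premises (h : R.Assigns u f) (hΘ : Θ.IsSequent B)
    (he : Θ.S R.main = none) : Θ.update R.main u f ∈ R.premises B Θ := by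
  cases R with
  | cut e | cutFr e =>
    rcases h with ⟨rfl, rfl⟩ | ⟨k, hk, rfl, rfl⟩
    · exact .inl rfl
    · exact .inr ⟨k, hk, (hΘ.addNum_eq_update he k).symm⟩
  | cutTerm e | cutFrTerm e =>
    rcases h with ⟨rfl, rfl⟩ | ⟨k, hk, rfl, rfl⟩
    · exact .inl rfl
    · exact .inr ⟨k, hk, rfl⟩
  | cutForm n =>
    rcases h with ⟨rfl, rfl⟩
    exact .inl rfl
  | fr e =>
    rcases h with ⟨rfl, rfl⟩
    rfl
  | h e v => exact h.elim

theorem Rule.Applies.isSequent_update (ha : R.Applies B Cr Θ) (hΘ : Θ.IsSequent B)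
    (h : R.Assigns u f) : (Θ.update R.main u f).IsSequent B := by
  have he := ha.eq_none h.name_ne_H
  cases R with
  | cut e | cutFr e =>
    obtain ⟨ht, hL, hr, -⟩ := ha
    cases e with
    | mem n => exact ht.elim
    | term φ a =>
      rcases h with ⟨rfl, rfl⟩ | ⟨k, hk, rfl, rfl⟩
      · exact hΘ.update he hL trivial nofun (by simp)
      · exact hΘ.update he hL hk nofun (by simpa [Rule.main] using hr)
  | cutTerm e | cutFrTerm e =>
    obtain ⟨ht, hL, hr, -⟩ := ha
    cases e with
    | mem n => exact ht.elim
    | term φ a =>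
      rcases h with ⟨rfl, rfl⟩ | ⟨k, hk, rfl, rfl⟩
      · exact hΘ.update he hL trivial nofun (by simp)
      · exact hΘ.update he hL hk nofun (by simpa [Rule.main] using hr)
  | cutForm n =>
    rcases h with ⟨rfl, rfl⟩
    exact hΘ.update he trivial trivial nofun (by simp)
  | fr e =>
    rcases h with ⟨rfl, rfl⟩
    exact hΘ.update he ha.1 trivial nofun (by simp)
  | h e v => exact h.elim

theorem Rule.Applies.exists_assigns (ha : R.Applies B Cr Θ) (hR : R.name = .Cut ∨ R.name = .CutFr)
    (hform : ∀ n, R ≠ .cutForm n) (hu : u.Fits R.main) : ∃ f, R.Assigns u f := by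
  cases R with
  | cutForm n => exact absurd rfl (hform n)
  | fr e => simp [Rule.name] at hR
  | h e v => simp [Rule.name] at hR
  | _ =>
    rcases hu.eq_unk_or_eq_num ha.1 with rfl | ⟨k, hk, rfl⟩
    · exact ⟨_, .inl ⟨rfl, rfl⟩⟩
    · exact ⟨_, .inr ⟨k, hk, rfl, rfl⟩⟩

theorem Rule.Assigns.name_eq_cut (h : R.Assigns u (some false)) (ha : R.Applies B Cr Θ)
    (hr : rk B R.main ≠ Om) : R.name = .Cut := by
  cases R with
  | cutFrTerm e => exact absurd ha.2.2.1 hr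
  | _ => simp_all [Rule.Assigns, Rule.name]

end Inference

/-! ### Derivability and reachability -/

section Derivability

variable [L.Structure ℕ] {B : Fm L 2} {Cr : List (Crit L)} {𝒮 : Set (Sequent L)}
  {r : Ordinal.{0}} {Θ Θ₀ : Sequent L} {R : Rule L} {ok : Rule L → Prop}

/-- `Θ` has a derivation all of whose rules satisfy `ok`. -/
inductive Derivable (B : Fm L 2) (Cr : List (Crit L)) (ok : Rule L → Prop) : Sequent L → Prop
  | ax {Θ : Sequent L} (hΘ : Θ.IsSequent B) (h : IsAxiom B Cr Θ) : Derivable B Cr ok Θ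
  | infer {Θ : Sequent L} (hΘ : Θ.IsSequent B) (R : Rule L) (hR : ok R) (h : R.Applies B Cr Θ)
      (ds : ∀ Θ', Θ' ∈ R.premises B Θ → Derivable B Cr ok Θ') : Derivable B Cr ok Θ

theorem Derivable.isSequent (h : Derivable B Cr ok Θ) : Θ.IsSequent B := by
  cases h <;> assumption

theorem Derivable.of_compInconsistent (hΘ : Θ.IsSequent B) (h : CompInconsistent B Θ.S) :
    Derivable B Cr ok Θ :=
  .ax hΘ (.inl h)

theorem Deduction.isSequent (d : Deduction B Cr 𝒮 Θ) : Θ.IsSequent B := by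
  cases d <;> assumption

theorem Deduction.mem_rules_of_premise {hΘ : Θ.IsSequent B} {h : R.Applies B Cr Θ}
    {ds : ∀ Θ', Θ' ∈ R.premises B Θ → Deduction B Cr 𝒮 Θ'} {Θ' : Sequent L}
    (hp : Θ' ∈ R.premises B Θ) {R' : Rule L} (hR' : R' ∈ (ds Θ' hp).rules) :
    R' ∈ (Deduction.infer Θ hΘ R h ds).rules :=
  .inr (Set.mem_iUnion₂.2 ⟨Θ', hp, hR'⟩)

theorem Deduction.derivable (d : Derivation B Cr Θ) (h : ∀ R ∈ d.rules, ok R) :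
    Derivable B Cr ok Θ := by
  induction d with
  | leaf Θ hΘ h' => exact h'.elim
  | ax Θ hΘ h' => exact .ax hΘ h'
  | infer Θ hΘ R hR ds ih =>
    exact .infer hΘ R (h R (.inl rfl)) hR fun Θ' hp =>
      ih Θ' hp fun R' hR' => h R' (Deduction.mem_rules_of_premise hp hR')

theorem Derivable.exists_derivation (h : Derivable B Cr ok Θ) :
    ∃ d : Derivation B Cr Θ, ∀ R ∈ d.rules, ok R := by
  induction h with
  | ax hΘ h => exact ⟨.ax _ hΘ h, fun R hR => hR.elim⟩
  | infer hΘ R hR h ds ih =>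
    choose d hd using ih
    refine ⟨.infer _ hΘ R h d, ?_⟩
    rintro R' (rfl | hR')
    · exact hR
    · obtain ⟨Θ', hp, hR'⟩ := Set.mem_iUnion₂.1 hR'
      exact hd Θ' hp R' hR'

theorem Deduction.exists_of_mem_rules_prune (d : Deduction B Cr 𝒮 Θ) :
    ∀ R ∈ d.prune.rules, ∃ R' ∈ d.rules, R = R'.prune := by
  induction d with
  | leaf => exact fun R hR => hR.elim
  | ax => exact fun R hR => hR.elim
  | infer Θ hΘ R hR ds ih =>
    rintro R' (hR' | hR')
    · exact ⟨R, .inl rfl, hR'⟩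
    · obtain ⟨Θ', hp, hR'⟩ := Set.mem_iUnion₂.1 hR'
      obtain ⟨R'', hR'', rfl⟩ := ih _ _ R' hR'
      exact ⟨R'', Deduction.mem_rules_of_premise (Rule.premises_prune hp) hR'', rfl⟩

theorem Deduction.IsRPlus.prune {d : Deduction B Cr 𝒮 Θ} (h : d.IsRPlus r) : d.prune.IsR r := by
  intro R hR
  obtain ⟨R', hR', rfl⟩ := d.exists_of_mem_rules_prune R hR
  exact Rule.IsRPlus.prune (h R' hR')

/-- `Θ` has an `r`-path, presented step by step. -/
inductive Reachable (B : Fm L 2) (Cr : List (Crit L)) (r : Ordinal.{0}) : Sequent L → Prop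
  | empty : Reachable B Cr r Sequent.empty
  | step {Θ Θ' : Sequent L} (h : Reachable B Cr r Θ) (R : Rule L) (hR : R.IsR B r)
      (ha : R.Applies B Cr Θ) (hp : Θ' ∈ R.premises B Θ) (hΘ' : Θ'.IsSequent B) :
      Reachable B Cr r Θ'

theorem Reachable.isSequent (h : Reachable B Cr r Θ) : Θ.IsSequent B := by
  cases h with
  | empty => exact Sequent.isSequent_empty
  | step _ _ _ _ _ hΘ' => exact hΘ'

theorem Deduction.IsPath.ne_nil {d : Deduction B Cr 𝒮 Θ} {l : List (Sequent L)}
    (h : d.IsPath l) : l ≠ [] := by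
  rintro rfl
  cases d <;> simp [Deduction.IsPath] at h

theorem Reachable.of_isPath (d : Deduction B Cr 𝒮 Θ₀) (hd : d.IsR r) (h₀ : Reachable B Cr r Θ₀)
    {l : List (Sequent L)} (hl : d.IsPath l) (hΘ : l.getLast? = some Θ) :
    Reachable B Cr r Θ := by
  induction d generalizing l with
  | leaf Θ₀ _ _ =>
    cases hl
    cases hΘ
    exact h₀
  | ax Θ₀ _ _ =>
    cases hl
    cases hΘ
    exact h₀
  | infer Θ₀ _ R hR ds ih =>
    rcases hl with rfl | ⟨Θ', hp, l', rfl, hl'⟩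
    · cases hΘ
      exact h₀
    · have h₁ := h₀.step R (hd R (.inl rfl)) hR hp (ds Θ' hp).isSequent
      rw [List.getLast?_cons_of_ne_nil hl'.ne_nil] at hΘ
      exact ih Θ' hp (fun R' hR' => hd R' (Deduction.mem_rules_of_premise hp hR')) h₁ hl' hΘ

theorem HasRPath.reachable (h : HasRPath B Cr r Θ) : Reachable B Cr r Θ := by
  obtain ⟨l, ⟨𝒮, d, hd, hl⟩, hΘ⟩ := h
  exact Reachable.of_isPath d hd .empty hl hΘ

end Derivability

section Tame

variable {B : Fm L 2} {r s : Ordinal.{0}} {Θ Θ' Ψ : Sequent L} {e : CExpr L} {u v : Val}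
  {f : Option Bool}

/-- The formulas `n ∈ I` (given by the numbers `n`) without a value such that `c_n` has the value
`?`. They have to be cut before an `H`-step can change the value of a term of rank `Ω`. -/
def Sequent.pending (B : Fm L 2) (Θ : Sequent L) : Set ℕ :=
  {n | Θ.S (cTerm B n) = some .unk ∧ Θ.S (.mem n) = none}

theorem Sequent.pending_subset (hle : Θ.S.Le Ψ.S) (hS : ∀ x, x.IsTerm → Ψ.S x = Θ.S x) :
    Ψ.pending B ⊆ Θ.pending B := by
  rintro n ⟨hc, hn⟩
  refine ⟨(hS (cTerm B n) trivial).symm.trans hc, ?_⟩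
  by_contra hn'
  obtain ⟨u, hu⟩ := Option.ne_none_iff_exists'.1 hn'
  simp [hle _ _ hu] at hn

variable [L.Structure ℕ] {Cr : List (Crit L)} {R : Rule L}

/-- The properties of all sequents on `s`-paths that the `r⁺`-calculus preserves for `r ≤ s`: no
value of rank `< s` has the mark `t`, and, if `Ω < s`, the sequence `P` is admissible and only
finitely many formulas `n ∈ I` are pending. -/
structure Tame (B : Fm L 2) (s : Ordinal.{0}) (Θ : Sequent L) : Prop where
  F_ne : ∀ x, rk B x < s → Θ.F x ≠ some true
  admissible : Om < s → Admissible B Θ.P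
  finite_pending : Om < s → (Θ.pending B).Finite

theorem tame_empty : Tame B s (Sequent.empty : Sequent L) where
  F_ne := by simp [Sequent.empty]
  admissible := by simp [Sequent.empty, Admissible]
  finite_pending := by simp [Sequent.empty, Sequent.pending]

theorem Tame.mono (h : Tame B s Θ) (hr : r ≤ s) : Tame B r Θ where
  F_ne x hx := h.F_ne x (hx.trans_le hr)
  admissible hx := h.admissible (hx.trans_le hr)
  finite_pending hx := h.finite_pending (hx.trans_le hr)

theorem Tame.update (h : Tame B s Θ) (he : Θ.S e = none) (hf : rk B e < s → f ≠ some true) :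
    Tame B s (Θ.update e u f) where
  F_ne x hx := by
    by_cases hxe : x = e
    · subst hxe
      rw [Sequent.update_F_self]
      exact hf hx
    · rw [Sequent.update_F_of_ne hxe]
      exact h.F_ne x hx
  admissible := h.admissible
  finite_pending hs := by
    refine ((h.finite_pending hs).union
      ((Set.finite_singleton e).preimage (cTerm_injective B).injOn)).subset ?_
    rintro n ⟨hc, hn⟩
    by_cases hce : cTerm B n = e
    · exact .inr hce
    · refine .inl ⟨(Sequent.update_S_of_ne hce).symm.trans hc, ?_⟩
      by_cases hne : .mem n = e
      · exact hne ▸ he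
      · exact (Sequent.update_S_of_ne hne).symm.trans hn

theorem Tame.addForms (h : Tame B s Θ) {n : ℕ} {Pe : List ℕ} {Ve : ℕ → Option (Subst L)}
    (hP : Proper B n Θ Pe) : Tame B s (Θ.addForms Pe Ve false) where
  F_ne x hx := by
    cases x with
    | term φ a => exact h.F_ne _ hx
    | mem m =>
      by_cases hm : m ∈ Pe
      · simp [Sequent.addForms, hm]
      · simpa [Sequent.addForms, hm] using h.F_ne _ hx
  admissible _ := hP.admissible
  finite_pending hs := (h.finite_pending hs).subset <|
    Sequent.pending_subset (Sequent.le_addForms hP.fresh _)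
      fun _ hx => Sequent.addForms_S_of_isTerm _ hx

theorem Tame.hStep (h : Tame B s Θ) (hΘ : Θ.IsSequent B) (he : s ≤ rk B e) :
    Tame B s (hStep B Θ e v) where
  F_ne x hx := by
    rw [hStep_F_of_eq hΘ (hSubst_of_rk_lt (hx.trans_le he))]
    exact h.F_ne x hx
  admissible hs := by
    change Admissible B (hSeq B Θ e)
    rw [hSeq_of_gt (hs.trans_le he)]
    exact h.admissible hs
  finite_pending hs := by
    refine (h.finite_pending hs).subset fun m hm => ?_
    have hlt := hs.trans_le he
    exact ⟨(hSubst_of_rk_lt (rk_cTerm B m ▸ hlt)).symm.trans hm.1,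
      (hSubst_of_rk_lt (rk_mem B m ▸ hlt)).symm.trans hm.2⟩

theorem Tame.premise (h : Tame B s Θ) (hΘ : Θ.IsSequent B) (ha : R.Applies B Cr Θ)
    (hR : R.name = .Cut ∨ s ≤ rk B R.main) (hp : R.Premise B Cr Θ Θ') : Tame B s Θ' := by
  cases hp with
  | @update _ u f hA =>
    refine h.update (ha.eq_none hA.name_ne_H) ?_
    rintro hlt rfl
    exact hA.name_ne_cut (hR.resolve_right hlt.not_ge)
  | addForms hP hV => exact h.addForms hP
  | hStep => exact h.hStep hΘ (hR.resolve_left nofun)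

theorem Reachable.tame (h : Reachable B Cr r Θ) : Tame B r Θ := by
  induction h with
  | empty => exact tame_empty
  | step h R hR ha hp _ ih =>
    exact ih.premise h.isSequent ha hR.name_eq_cut_or_le
      (Rule.premise_of_mem h.isSequent ha hp)

end Tame

/-! ### Weakening -/

section Weakening

variable [L.Structure ℕ] {B : Fm L 2} {Cr : List (Crit L)} {r : Ordinal.{0}}
  {Ξ Ξ' Ψ Φ : Sequent L} {e x : CExpr L} {u v : Val} {f : Option Bool} {Pe Q : List ℕ}
  {Ve : ℕ → Option (Subst L)} {n : ℕ}

/-- `Ψ` arises from `Ξ` by adding justified values of rank `≤ r`. -/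
structure IsWeakening (B : Fm L 2) (r : Ordinal.{0}) (Ξ Ψ : Sequent L) : Prop
    extends SubUpTo B r Ξ Ψ, EqAbove B r Ξ Ψ where
  isSequent : Ψ.IsSequent B
  tame : Tame B r Ψ
  models_new : ∀ x u, x.IsTerm → Ξ.S x = none → Ψ.S x = some u → Models Ψ.S (justif B x u)

theorem IsWeakening.le (w : IsWeakening B r Ξ Ψ) : Ξ.S.Le Ψ.S := fun x u hx =>
  (le_or_gt (rk B x) r).elim (fun h => w.S_le x u h hx) fun h => (w.S_eq x h).trans hx

theorem IsWeakening.isPrefix (hr : r ≠ Om) (w : IsWeakening B r Ξ Ψ) : Ξ.P <+: Ψ.P :=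
  hr.lt_or_gt.elim (fun h => w.P_eq h ▸ List.prefix_rfl) w.isPrefix_P

theorem IsWeakening.trans (w : IsWeakening B r Ξ Ψ) (w' : IsWeakening B r Ψ Φ) :
    IsWeakening B r Ξ Φ where
  toSubUpTo := w.toSubUpTo.trans w'.toSubUpTo
  toEqAbove := w.toEqAbove.trans w'.toEqAbove
  isSequent := w'.isSequent
  tame := w'.tame
  models_new x u hx hΞ hu := by
    cases hΨ : Ψ.S x with
    | none => exact w'.models_new x u hx hΨ hu
    | some u' =>
      obtain rfl : u' = u := Option.some.inj ((w'.le x u' hΨ).symm.trans hu)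
      exact (w.models_new x u' hx hΞ hΨ).mono w'.le

theorem IsWeakening.of_left (w : IsWeakening B r Ξ Ψ) (hle : Ξ.S.Le Ξ'.S)
    (h : EqAbove B r Ξ Ξ') (h' : SubUpTo B r Ξ' Ψ) : IsWeakening B r Ξ' Ψ where
  toSubUpTo := h'
  toEqAbove := h.symm.trans w.toEqAbove
  isSequent := w.isSequent
  tame := w.tame
  models_new x u hx hΞ' := by
    refine w.models_new x u hx ?_
    by_contra hΞ
    obtain ⟨u', hu'⟩ := Option.ne_none_iff_exists'.1 hΞ
    simp [hle x u' hu'] at hΞ'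

theorem IsWeakening.update (w : IsWeakening B r Ξ Ψ) (he : Ψ.S e = none)
    (hΨ : (Ψ.update e u f).IsSequent B) (hf : rk B e < r → f ≠ some true) :
    IsWeakening B r (Ξ.update e u f) (Ψ.update e u f) where
  toSubUpTo := w.toSubUpTo.update e u f
  toEqAbove := w.toEqAbove.update e u f
  isSequent := hΨ
  tame := w.tame.update he hf
  models_new x w' hx hΞ hw := by
    have hxe : x ≠ e := by
      rintro rfl
      simp [Sequent.update_S_self] at hΞ
    rw [Sequent.update_S_of_ne hxe] at hΞ hw
    exact (w.models_new x w' hx hΞ hw).mono (Sequent.le_update he)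

theorem IsWeakening.update_left (w : IsWeakening B r Ξ Ψ) (hΞ : Ξ.S e = none)
    (he : Ψ.S e = some u) (her : rk B e ≤ r)
    (hf : rk B e = r → f = some false → Ψ.F e = some false) :
    IsWeakening B r (Ξ.update e u f) Ψ :=
  w.of_left (Sequent.le_update hΞ) (eqAbove_update her) (w.toSubUpTo.update_left he hf)

theorem isWeakening_update_mem (hr : Om < r) (hΨ : Ψ.IsSequent B) (ht : Tame B r Ψ)
    (hn : Ψ.S (.mem n) = none) :
    IsWeakening B r Ψ (Ψ.update (.mem n) .unk (some false)) where
  toSubUpTo := hΨ.subUpTo_update hn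
  toEqAbove := eqAbove_update hr.le
  isSequent := hΨ.update hn trivial trivial nofun (by simp)
  tame := ht.update hn (by simp)
  models_new x u hx hΨx hu := by
    rw [Sequent.update_S_of_ne (by rintro rfl; exact hx), hΨx] at hu
    cases hu

theorem isWeakening_addForms (hr : Om < r) (hΨ : Ψ.IsSequent B) (ht : Tame B r Ψ)
    (hP : Proper B n Ψ Pe) (hV : IsHist B Pe Ve) :
    IsWeakening B r Ψ (Ψ.addForms Pe Ve false) where
  toSubUpTo := hΨ.subUpTo_addForms hr.ne' hP.fresh false
  toEqAbove := eqAbove_addForms hr false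
  isSequent := hΨ.addForms hP.nodup hP.disjoint hV false
  tame := ht.addForms hP
  models_new x u hx hΨx hu := by
    rw [Sequent.addForms_S_of_isTerm false hx, hΨx] at hu
    cases hu

theorem IsWeakening.proper (w : IsWeakening B r Ξ Ψ) (hr : Om < r) (hΞ : Ξ.IsSequent B)
    (hF : ¬ CompInconsistent B Ψ.S) (hQ : Ξ.P ++ Q <+: Ψ.P) (hn : Q.getLast? = some n) :
    Proper B n Ξ Q := by
  have hnd : (Ξ.P ++ Q).Nodup := w.isSequent.nodup.sublist hQ.sublist
  have htop : ∀ m ∈ Q, Ψ.S (.mem m) = some .top := fun m hm =>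
    (w.isSequent.mem_P m).1 (hQ.subset (List.mem_append_right _ hm))
  have hdisj : ∀ m ∈ Q, m ∉ Ξ.P := fun m hm hm' =>
    (List.nodup_append.1 hnd).2.2 m hm' m hm rfl
  refine ⟨(List.nodup_append.1 hnd).2.1, fun m hm u hu => ?_, ?_, hn, hdisj, fun m hm => ?_⟩
  · have hu' := w.le _ _ hu
    rcases (w.isSequent.isSubst _ _ hu').2.eq_unk_or_eq_num trivial with rfl | ⟨k, -, rfl⟩
    · rfl
    · exact absurd (.inr ⟨m, k, hu', htop m hm⟩) hF
  · obtain ⟨T, hT⟩ := hQ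
    intro P₁ k P₂ h
    exact w.tame.admissible hr P₁ k (P₂ ++ T) (by rw [← hT, h]; simp)
  · by_contra hne
    obtain ⟨u, hu⟩ := Option.ne_none_iff_exists'.1 hne
    obtain rfl : u = .top := Option.some.inj ((w.le _ _ hu).symm.trans (htop m hm))
    exact hdisj m hm ((hΞ.mem_P m).2 hu)

theorem IsWeakening.models_new_hStep (hB : B.SkolemFree) (hBI : B.HasI) (hr : r ≠ Om)
    (w : IsWeakening B r Ξ Ψ) (her : r ≤ rk B e) (hx : x.IsTerm)
    (hΞ : hSubst B Ξ e v x = none) (hΨ : hSubst B Ψ e v x = some u) :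
    Models (hSubst B Ψ e v) (justif B x u) := by
  have hxe : x ≠ e := by
    rintro rfl
    simp [hSubst_self] at hΞ
  have hxr : rk B x ≤ r := by
    by_contra hlt
    have hS := (w.toEqAbove.hStep hr her (v := v)).S_eq x (not_le.1 hlt)
    exact nomatch hΨ.symm.trans (hS.trans hΞ)
  rw [hSubst_of_rk_le hr her hxr hxe] at hΞ hΨ
  exact (w.models_new x u hx hΞ hΨ).congr <| reduce_justif_congr hB hBI hr
    (fun y hy => (hSubst_of_rk_lt (hy.trans_le her)).symm) hx hxr u

theorem IsWeakening.hStep (hB : B.SkolemFree) (hBI : B.HasI) (hr : r ≠ Om)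
    (w : IsWeakening B r Ξ Ψ) (hΞ : Ξ.IsSequent B) (hΞ' : (hStep B Ξ e v).IsSequent B)
    (h : HApplies B Cr Ψ e v) (her : r ≤ rk B e) :
    IsWeakening B r (hStep B Ξ e v) (hStep B Ψ e v) := by
  obtain ⟨hv, hvu⟩ := h.fits w.isSequent.isSubst
  refine ⟨w.toSubUpTo.hStep hr hΞ w.isSequent her hvu, w.toEqAbove.hStep hr her,
    w.isSequent.hStep hv h.unk hvu ?_, w.tame.hStep w.isSequent her,
    fun x u => w.models_new_hStep hB hBI hr her⟩
  rintro n rfl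
  have hlt : r < Om := lt_of_le_of_ne her hr
  rw [negPart_congr fun x hx => w.S_eq x (hx ▸ hlt)]
  exact (hΞ'.val_V n (negPart B Ξ.S) (if_pos rfl)).2.1

theorem IsWeakening.correct (hB : B.SkolemFree) (hBpos : B.OnlySign true) (hr : r ≠ Om)
    (w : IsWeakening B r Ξ Ψ) (h : HApplies B Cr Ξ e v) (hF : ¬ CompInconsistent B Ψ.S) :
    Correct B Ψ.S := by
  intro x u hx
  cases x with
  | mem n =>
    rcases (w.isSequent.isSubst _ _ hx).2.eq_unk_or_eq_top with rfl | rfl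
    · exact ⟨trivial, trivial⟩
    rcases hr.lt_or_gt with hr | hr
    · refine models_formA_congr hB (fun y hy => ?_)
        (h.correct (.mem n) .top ((w.S_eq (.mem n) hr).symm.trans hx))
      simp only [Subst.ext, w.S_eq y (hy ▸ hr)]
    · exact (w.tame.admissible hr).models_formA hB hBpos w.isSequent.isSubst w.isSequent.mem_P hF hx
  | term φ a =>
    refine Models.mono (Subst.le_ext Ψ.S) ?_
    cases hΞ : Ξ.S (.term φ a) with
    | none => exact w.models_new _ u trivial hΞ hx
    | some u' =>
      obtain rfl : u' = u := Option.some.inj ((w.le _ u' hΞ).symm.trans hx)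
      exact ((h.decides_justif (.term φ a) u' trivial hΞ).models_of_le (Subst.le_ext Ξ.S)
        (h.correct _ u' hΞ)).mono w.le

theorem HApplies.models_neg_of_le (h : HApplies B Cr Ξ e v) (hle : Ξ.S.Le Ψ.S) {c : Crit L}
    (hc : c ∈ Cr) (hneg : Models Ψ.S (c.fm B).neg) : Models Ξ.S (c.fm B).neg :=
  (h.decides_crit c hc).resolve_left fun h => (h.mono hle).not_models_neg hneg

theorem HApplies.of_isWeakening (hB : B.SkolemFree) (hBpos : B.OnlySign true) (hr : r ≠ Om)
    (h : HApplies B Cr Ξ e v) (w : IsWeakening B r Ξ Ψ) (hF : ¬ CompInconsistent B Ψ.S)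
    (hpending : rk B e = Om → Om < r → Ψ.pending B = ∅) : HApplies B Cr Ψ e v where
  correct := w.correct hB hBpos hr h hF
  decides_crit c hc := (h.decides_crit c hc).mono w.le
  computes c hc hneg := by
    obtain ⟨e', v', h'⟩ := h.computes c hc (h.models_neg_of_le w.le hc hneg)
    exact ⟨e', v', h'.mono w.le (w.isPrefix hr)⟩
  selected := by
    obtain ⟨i, hneg, hpair, hmin⟩ := h.selected
    refine ⟨i, hneg.mono w.le, hpair.mono w.le (w.isPrefix hr), fun j e' v' hneg hp => ?_⟩
    have hneg' := h.models_neg_of_le w.le (List.get_mem Cr j) hneg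
    obtain ⟨e'', v'', h'⟩ := h.computes _ (List.get_mem Cr j) hneg'
    obtain ⟨rfl, rfl⟩ := (h'.mono w.le (w.isPrefix hr)).unique hp
    exact hmin j _ _ hneg' h'
  decides_justif x u hx hxu := by
    cases hΞ : Ξ.S x with
    | none => exact .inl (w.models_new x u hx hΞ hxu)
    | some u' =>
      obtain rfl : u' = u := Option.some.inj ((w.le x u' hΞ).symm.trans hxu)
      exact (h.decides_justif x u' hx hΞ).mono w.le
  decides_new := h.decides_new.mono w.le
  unk := w.le _ _ h.unk
  mem_dom n hn := w.le.isSome (h.mem_dom n hn)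
  cTerm_dom n hn := w.le.isSome (h.cTerm_dom n hn)
  mem_dom_of_unk ht he n hn := by
    rcases hr.lt_or_gt with hlt | hlt
    · exact w.le.isSome (h.mem_dom_of_unk ht he n ((w.S_eq _ (rk_cTerm B n ▸ hlt)).symm.trans hn))
    · by_contra hmem
      exact (hpending he hlt).subset ⟨hn, Option.not_isSome_iff_eq_none.1 hmem⟩

theorem IsWeakening.axH (hr : r ≠ Om) (w : IsWeakening B r Ξ Ψ) (h : AxH B Cr e v Ξ)
    (hΨ : HApplies B Cr Ψ e v) : AxH B Cr e v Ψ := by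
  obtain ⟨-, x, hx, hxf⟩ := h
  have axH_self (hF : Ψ.F e = some false) : AxH B Cr e v Ψ :=
    ⟨hΨ, e, active_self hΨ.unk (hΨ.fits w.isSequent.isSubst).2, hF⟩
  rcases lt_trichotomy (rk B e) r with hlt | heq | hgt
  · exact axH_self (w.isSequent.F_eq_false hΨ.unk (w.tame.F_ne e hlt))
  · cases hx.eq_of_rk_ne (heq ▸ hr)
    exact axH_self (w.F_false e heq hxf)
  · have hxr : r < rk B x := hx.2.1 ▸ hgt
    exact ⟨hΨ, x, (w.active_iff hr hgt.le hxr).2 hx, (w.F_eq x hxr).trans hxf⟩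

theorem IsWeakening.derivable_of_isSome (hr : Om < r) (w : IsWeakening B r Ξ Ψ) (n : ℕ)
    (h : ∀ Ψ', IsWeakening B r Ξ Ψ' → Ψ.S.Le Ψ'.S → (∀ x, x.IsTerm → Ψ'.S x = Ψ.S x) →
      (Ψ'.S (.mem n)).isSome → Derivable B Cr (Rule.IsRPlus B r) Ψ') :
    Derivable B Cr (Rule.IsRPlus B r) Ψ := by
  by_cases hn : Ψ.S (.mem n) = none
  · refine .infer w.isSequent (.cutForm n) hr hn fun Ψ' hp => ?_
    rcases hp with rfl | ⟨Pe, Ve, hP, hV, rfl⟩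
    · refine h _ (w.trans (isWeakening_update_mem hr w.isSequent w.tame hn))
        (Sequent.le_update hn) (fun x hx => Sequent.update_S_of_ne ?_) ?_
      · rintro rfl
        exact hx
      · exact Option.isSome_iff_exists.2 ⟨_, Sequent.update_S_self⟩
    · exact h _ (w.trans (isWeakening_addForms hr w.isSequent w.tame hP hV))
        (Sequent.le_addForms hP.fresh _) (fun x hx => Sequent.addForms_S_of_isTerm _ hx)
        (Option.isSome_iff_exists.2
          ⟨_, Sequent.addForms_S_mem (List.mem_of_getLast? hP.last) false⟩)
  · exact h Ψ w (fun _ _ h => h) (fun _ _ => rfl) (Option.isSome_iff_ne_none.2 hn)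

theorem IsWeakening.derivable_of_pending (hr : Om < r) (w : IsWeakening B r Ξ Ψ)
    (h : ∀ Ψ', IsWeakening B r Ξ Ψ' → Ψ'.pending B = ∅ → Derivable B Cr (Rule.IsRPlus B r) Ψ') :
    Derivable B Cr (Rule.IsRPlus B r) Ψ := by
  induction hk : (Ψ.pending B).ncard using Nat.strong_induction_on generalizing Ψ with
  | _ k ih =>
    rcases (Ψ.pending B).eq_empty_or_nonempty with hempty | ⟨n, hn⟩
    · exact h Ψ w hempty
    · refine w.derivable_of_isSome hr n fun Ψ' w' hle hS hn' => ih _ ?_ w' rfl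
      rw [← hk]
      refine Set.ncard_lt_ncard ⟨Sequent.pending_subset hle hS, fun hsub => ?_⟩
        (w.tame.finite_pending hr)
      simp [(hsub hn).2] at hn'

/-- All weakenings of `Ξ` have `r⁺`-derivations. -/
def StablyDerivable (B : Fm L 2) (Cr : List (Crit L)) (r : Ordinal.{0}) (Ξ : Sequent L) : Prop :=
  ∀ Ψ, IsWeakening B r Ξ Ψ → Derivable B Cr (Rule.IsRPlus B r) Ψ

theorem IsAxiom.stablyDerivable (hB : B.SkolemFree) (hBpos : B.OnlySign true) (hr : r ≠ Om)
    (h : IsAxiom B Cr Ξ) : StablyDerivable B Cr r Ξ := by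
  intro Ψ w
  rcases h with h | h | ⟨e, v, h⟩
  · exact .of_compInconsistent w.isSequent (h.mono w.le)
  · exact .ax w.isSequent (.inr (.inl fun c hc => (h c hc).mono w.le))
  have derivable (Ψ : Sequent L) (w : IsWeakening B r Ξ Ψ)
      (hpending : rk B e = Om → Om < r → Ψ.pending B = ∅) :
      Derivable B Cr (Rule.IsRPlus B r) Ψ := by
    by_cases hF : CompInconsistent B Ψ.S
    · exact .of_compInconsistent w.isSequent hF
    · exact .ax w.isSequent (.inr (.inr ⟨e, v, w.axH hr h
        (h.1.of_isWeakening hB hBpos hr w hF hpending)⟩))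
  by_cases hrank : rk B e = Om ∧ Om < r
  · exact w.derivable_of_pending hrank.2 fun Ψ' w' hpending => derivable Ψ' w' fun _ _ => hpending
  · exact derivable Ψ w fun he hr => absurd ⟨he, hr⟩ hrank

theorem stablyDerivable_of_assigning {R : Rule L} (hr : r ≠ Om) (hΞ : Ξ.IsSequent B)
    (hR : R.IsRPlus B r) (ha : R.Applies B Cr Ξ) (hH : R.name ≠ .H) (hform : ∀ n, R ≠ .cutForm n)
    (ih : ∀ Ξ' ∈ R.premises B Ξ, StablyDerivable B Cr r Ξ') : StablyDerivable B Cr r Ξ := by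
  intro Ψ w
  have hnone := ha.eq_none hH
  cases he : Ψ.S R.main with
  | none =>
    have haΨ := ha.of_eq_none hnone he
    refine .infer w.isSequent R hR haΨ fun Ψ' hp => ?_
    cases Rule.premise_of_mem w.isSequent haΨ hp with
    | update hA =>
      refine ih _ (hA.update_mem_premises hΞ hnone) _
        (w.update he (haΨ.isSequent_update w.isSequent hA) ?_)
      rintro hlt rfl
      exact hA.name_ne_cut (hR.name_eq_cut_or_le.resolve_right hlt.not_ge)
    | addForms => exact absurd rfl (hform _)
    | hStep => exact absurd rfl hH
  | some u =>
    have hle : rk B R.main ≤ r := by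
      by_contra hgt
      exact nomatch he.symm.trans ((w.S_eq _ (not_le.1 hgt)).trans hnone)
    obtain ⟨f, hA⟩ := ha.exists_assigns (hR.name_eq_cut_or_eq_cutFr hH hle) hform
      (w.isSequent.isSubst _ _ he).2
    refine ih _ (hA.update_mem_premises hΞ hnone) _ (w.update_left hnone he hle ?_)
    rintro heq rfl
    have hlt := hR
    simp only [Rule.IsRPlus, hA.name_eq_cut ha (heq ▸ hr)] at hlt
    exact absurd heq hlt.ne

theorem stablyDerivable_of_cutForm (hr : Om < r) (hΞ : Ξ.IsSequent B)
    (hn : Ξ.S (.mem n) = none)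
    (ih : ∀ Ξ' ∈ (Rule.cutForm n).premises B Ξ, StablyDerivable B Cr r Ξ') :
    StablyDerivable B Cr r Ξ := by
  intro Ψ w
  refine w.derivable_of_isSome hr n fun Ψ w _ _ hu => ?_
  by_cases hF : CompInconsistent B Ψ.S
  · exact .of_compInconsistent w.isSequent hF
  obtain ⟨u, hu⟩ := Option.isSome_iff_exists.1 hu
  rcases (w.isSequent.isSubst _ _ hu).2.eq_unk_or_eq_top with rfl | rfl
  · exact ih _ (.inl rfl) Ψ (w.update_left hn hu hr.le fun h => absurd h hr.ne)
  · obtain ⟨Q, hQ⟩ := w.isPrefix_P hr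
    have hnQ : n ∈ Q := by
      have hnP : n ∈ Ξ.P ++ Q := hQ ▸ (w.isSequent.mem_P n).2 hu
      refine (List.mem_append.1 hnP).resolve_left fun h => ?_
      simp [(hΞ.mem_P n).1 h] at hn
    obtain ⟨Q₁, Q₂, rfl⟩ := List.append_of_mem hnQ
    have hpre : Ξ.P ++ (Q₁ ++ [n]) <+: Ψ.P := ⟨Q₂, by simpa using hQ⟩
    have hproper : Proper B n Ξ _ := w.proper hr hΞ hF hpre (by simp)
    have hV := w.isSequent.isHist_of_subset (Pe := Q₁ ++ [n]) fun _ hm =>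
      hpre.subset (List.mem_append_right _ hm)
    exact ih _ (.inr ⟨_, _, hproper, hV, rfl⟩) Ψ
      (w.of_left (Sequent.le_addForms hproper.fresh _) (eqAbove_addForms hr _)
        (w.addForms_left hr.ne' w.isSequent hpre))

theorem stablyDerivable_of_h (hB : B.SkolemFree) (hBI : B.HasI) (hBpos : B.OnlySign true)
    (hr : r ≠ Om) (hΞ : Ξ.IsSequent B) (her : r ≤ rk B e) (ha : (Rule.h e v).Applies B Cr Ξ)
    (hΞ' : (hStep B Ξ e v).IsSequent B) (ih : StablyDerivable B Cr r (hStep B Ξ e v)) :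
    StablyDerivable B Cr r Ξ := by
  intro Ψ w
  by_cases hF : CompInconsistent B Ψ.S
  · exact .of_compInconsistent w.isSequent hF
  have hΨ : HApplies B Cr Ψ e v := ha.1.of_isWeakening hB hBpos hr w hF fun he hlt =>
    absurd (he ▸ her) hlt.not_ge
  by_cases hFe : Ψ.F e = some true
  · refine .infer w.isSequent (.h e v) her ⟨hΨ, hFe, fun x hx => ?_⟩ ?_
    · by_cases he : rk B e = Om
      · have hxr : r < rk B x := hx.2.1 ▸ lt_of_le_of_ne her (he ▸ hr)
        rw [w.F_eq x hxr]
        exact ha.2.2 x ((w.active_iff hr her hxr).1 hx)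
      · rw [hx.eq_of_rk_ne he, hFe]
    · rintro Ψ' rfl
      exact ih _ (w.hStep hB hBI hr hΞ hΞ' hΨ her)
  · exact .ax w.isSequent (.inr (.inr ⟨e, v, hΨ, e,
      active_self hΨ.unk (hΨ.fits w.isSequent.isSubst).2, w.isSequent.F_eq_false hΨ.unk hFe⟩))

theorem Derivable.stablyDerivable (hB : B.SkolemFree) (hBI : B.HasI) (hBpos : B.OnlySign true)
    (hr : r ≠ Om) (h : Derivable B Cr (Rule.IsRPlus B r) Ξ) : StablyDerivable B Cr r Ξ := by
  induction h with
  | ax _ h => exact h.stablyDerivable hB hBpos hr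
  | infer hΞ R hR ha ds ih =>
    cases R with
    | cutForm n => exact stablyDerivable_of_cutForm hR hΞ ha ih
    | h e v =>
      exact stablyDerivable_of_h hB hBI hBpos hr hΞ hR ha (ds _ rfl).isSequent (ih _ rfl)
    | _ => exact stablyDerivable_of_assigning hr hΞ hR ha nofun nofun ih

end Weakening

/-! ### Descending along a path -/

section Descent

variable {B : Fm L 2} {r : Ordinal.{0}} {K Θ Θ' Φ : Sequent L} {e x : CExpr L} {u v : Val}
  {f : Option Bool}

/-- `Θ` with its part of rank `≤ r` replaced by that of `K`; the components `P` and `V` count as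
having rank `Ω`. -/
def replaceUpTo (B : Fm L 2) (r : Ordinal.{0}) (K Θ : Sequent L) : Sequent L := open Classical in
  { S := fun x => if rk B x ≤ r then K.S x else Θ.S x
    P := if Om < r then K.P else Θ.P
    V := if Om < r then K.V else Θ.V
    F := fun x => if rk B x ≤ r then K.F x else Θ.F x }

theorem eqUpTo_replaceUpTo : EqUpTo B r K (replaceUpTo B r K Θ) :=
  ⟨fun _ h => if_pos h, fun _ h => if_pos h, fun h => if_pos h, fun h => if_pos h⟩

theorem eqAbove_replaceUpTo : EqAbove B r Θ (replaceUpTo B r K Θ) :=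
  ⟨fun _ h => if_neg h.not_ge, fun _ h => if_neg h.not_ge, fun h => if_neg h.not_gt,
    fun h => if_neg h.not_gt⟩

theorem eq_replaceUpTo (hr : r ≠ Om) (h : EqUpTo B r K Φ) (h' : EqAbove B r Θ Φ) :
    Φ = replaceUpTo B r K Θ :=
  (eqUpTo_replaceUpTo.symm.trans h).eq_of_eqAbove hr (eqAbove_replaceUpTo.symm.trans h')

theorem EqAbove.replaceUpTo_eq (h : EqAbove B r Θ Θ') (hr : r ≠ Om) :
    replaceUpTo B r K Θ = replaceUpTo B r K Θ' :=
  eq_replaceUpTo hr eqUpTo_replaceUpTo (h.symm.trans eqAbove_replaceUpTo)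

theorem update_replaceUpTo (hr : r ≠ Om) (he : r < rk B e) :
    (replaceUpTo B r K Θ).update e u f = replaceUpTo B r K (Θ.update e u f) :=
  eq_replaceUpTo hr (eqUpTo_replaceUpTo.trans (eqUpTo_update he))
    (eqAbove_replaceUpTo.update e u f)

theorem isSequent_replaceUpTo (hr : r ≠ Om) (hK : K.IsSequent B) (hΘ : Θ.IsSequent B) :
    (replaceUpTo B r K Θ).IsSequent B := by
  have hle : EqUpTo B r K (replaceUpTo B r K Θ) := eqUpTo_replaceUpTo
  have hgt : EqAbove B r Θ (replaceUpTo B r K Θ) := eqAbove_replaceUpTo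
  have hS : IsSubst (replaceUpTo B r K Θ).S := fun x u hx => by
    rcases le_or_gt (rk B x) r with h | h
    · exact hK.isSubst x u ((hle.S_eq x h).symm.trans hx)
    · exact hΘ.isSubst x u ((hgt.S_eq x h).symm.trans hx)
  have hF : ∀ x, ((replaceUpTo B r K Θ).F x).isSome ↔ (replaceUpTo B r K Θ).S x = some .unk ∨
      (((replaceUpTo B r K Θ).S x).isSome ∧ rk B x = Om) := fun x => by
    rcases le_or_gt (rk B x) r with h | h
    · rw [hle.S_eq x h, hle.F_eq x h, hK.dom_F]
    · rw [hgt.S_eq x h, hgt.F_eq x h, hΘ.dom_F]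
  rcases hr.lt_or_gt with h | h
  · have hP := hgt.P_eq h
    have hV := hgt.V_eq h
    exact ⟨hS, hP ▸ hΘ.nodup, fun n => by rw [hP, hgt.S_eq (.mem n) h, hΘ.mem_P],
      fun n => by rw [hP, hV, hΘ.dom_V], hV ▸ hΘ.val_V, hF⟩
  · have hP := hle.P_eq h
    have hV := hle.V_eq h
    exact ⟨hS, hP ▸ hK.nodup, fun n => by rw [hP, hle.S_eq (.mem n) h.le, hK.mem_P],
      fun n => by rw [hP, hV, hK.dom_V], hV ▸ hK.val_V, hF⟩

theorem hStep_replaceUpTo (hr : r ≠ Om) (hK : K.IsSequent B) (hΘ : Θ.IsSequent B)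
    (he : r < rk B e) :
    hStep B (replaceUpTo B r K Θ) e v = replaceUpTo B r K (hStep B Θ e v) :=
  eq_replaceUpTo hr
    (eqUpTo_replaceUpTo.trans ((isSequent_replaceUpTo hr hK hΘ).eqUpTo_hStep he))
    (eqAbove_replaceUpTo.hStep hr he.le)

variable [L.Structure ℕ] {Cr : List (Crit L)} {R : Rule L}

theorem EqUpTo.tame (h : EqUpTo B r K Φ) (hK : Tame B r K) : Tame B r Φ where
  F_ne x hx := by
    rw [h.F_eq x hx.le]
    exact hK.F_ne x hx
  admissible hr := by
    rw [h.P_eq hr]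
    exact hK.admissible hr
  finite_pending hr := by
    refine (hK.finite_pending hr).subset fun n hn => ?_
    exact ⟨(h.S_eq (cTerm B n) (rk_cTerm B n ▸ hr.le)).symm.trans hn.1,
      (h.S_eq (.mem n) hr.le).symm.trans hn.2⟩

/-- All values of `K` have rank `≤ r`, and the values of terms are justified. -/
structure JustifiedUpTo (B : Fm L 2) (r : Ordinal.{0}) (K : Sequent L) : Prop where
  isSequent : K.IsSequent B
  tame : Tame B r K
  S_eq_none : ∀ x, r < rk B x → K.S x = none
  models : ∀ x u, x.IsTerm → K.S x = some u → Models K.S (justif B x u)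

theorem JustifiedUpTo.rk_le (hK : JustifiedUpTo B r K) (hx : K.S x = some u) : rk B x ≤ r := by
  by_contra h
  exact nomatch hx.symm.trans (hK.S_eq_none x (not_le.1 h))

theorem JustifiedUpTo.eqAbove_empty (hK : JustifiedUpTo B r K) : EqAbove B r Sequent.empty K := by
  have hP (h : r < Om) (n : ℕ) : n ∉ K.P := fun hn =>
    nomatch ((hK.isSequent.mem_P n).1 hn).symm.trans (hK.S_eq_none (.mem n) h)
  refine ⟨hK.S_eq_none, fun x hx => hK.isSequent.F_eq_none (hK.S_eq_none x hx),
    fun h => List.eq_nil_iff_forall_not_mem.2 (hP h), fun h => funext fun n => ?_⟩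
  exact Option.not_isSome_iff_eq_none.1 (mt (hK.isSequent.dom_V n).1 (hP h n))

theorem JustifiedUpTo.replaceUpTo_empty (hK : JustifiedUpTo B r K) (hr : r ≠ Om) :
    replaceUpTo B r K Sequent.empty = K :=
  (eq_replaceUpTo hr ⟨fun _ _ => rfl, fun _ _ => rfl, fun _ => rfl, fun _ => rfl⟩
    hK.eqAbove_empty).symm

theorem JustifiedUpTo.isWeakening_replaceUpTo (hK : JustifiedUpTo B r K) (hr : r ≠ Om)
    (hΘ : Θ.IsSequent B) (h : SubUpTo B r Θ K) : IsWeakening B r Θ (replaceUpTo B r K Θ) where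
  toSubUpTo := h.trans eqUpTo_replaceUpTo.subUpTo
  toEqAbove := eqAbove_replaceUpTo
  isSequent := isSequent_replaceUpTo hr hK.isSequent hΘ
  tame := eqUpTo_replaceUpTo.tame hK.tame
  models_new x u hx hΘx hu := by
    have hle : EqUpTo B r K (replaceUpTo B r K Θ) := eqUpTo_replaceUpTo
    have hxr : rk B x ≤ r := by
      by_contra hlt
      exact nomatch hu.symm.trans ((eqAbove_replaceUpTo.S_eq x (not_le.1 hlt)).trans hΘx)
    rw [hle.S_eq x hxr] at hu
    exact (hK.models x u hx hu).mono fun y w hy => (hle.S_eq y (hK.rk_le hy)).trans hy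

theorem Rule.Premise.eqAbove (hp : R.Premise B Cr Θ Θ') (hr : r ≠ Om) (hR : R.name = .Cut)
    (hle : rk B R.main ≤ r) : EqAbove B r Θ Θ' := by
  cases hp with
  | update => exact eqAbove_update hle
  | addForms => exact eqAbove_addForms (lt_of_le_of_ne hle hr.symm) _
  | hStep => cases hR

theorem Rule.Premise.subUpTo (hp : R.Premise B Cr Θ Θ') (hr : r ≠ Om) (hΘ : Θ.IsSequent B)
    (ha : R.Applies B Cr Θ) (hR : R.name ≠ .H) : SubUpTo B r Θ Θ' := by
  cases hp with
  | update => exact hΘ.subUpTo_update (ha.eq_none hR)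
  | addForms hP => exact hΘ.subUpTo_addForms hr hP.fresh _
  | hStep => exact absurd rfl hR

theorem Derivable.replaceUpTo_of_hStep (hB : B.SkolemFree) (hBpos : B.OnlySign true)
    (hr : r ≠ Om) (hK : JustifiedUpTo B r K) (hΘ : Θ.IsSequent B) (hsub : SubUpTo B r Θ K)
    (he : r < rk B e) (ha : (Rule.h e v).Applies B Cr Θ)
    (hd : Derivable B Cr (Rule.IsRPlus B r) (replaceUpTo B r K (hStep B Θ e v))) :
    Derivable B Cr (Rule.IsRPlus B r) (replaceUpTo B r K Θ) := by
  have w := hK.isWeakening_replaceUpTo hr hΘ hsub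
  by_cases hF : CompInconsistent B (replaceUpTo B r K Θ).S
  · exact .of_compInconsistent w.isSequent hF
  have hΦ : HApplies B Cr (replaceUpTo B r K Θ) e v :=
    ha.1.of_isWeakening hB hBpos hr w hF fun h h' => absurd (h ▸ he) h'.not_gt
  refine .infer w.isSequent (.h e v) he.le
    ⟨hΦ, (w.F_eq e he).trans ha.2.1, fun x hx => ?_⟩ ?_
  · have hxr : r < rk B x := hx.2.1 ▸ he
    exact (w.F_eq x hxr).trans (ha.2.2 x ((w.active_iff hr he.le hxr).1 hx))
  · rintro _ rfl
    rwa [hStep_replaceUpTo hr hK.isSequent hΘ he]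

theorem Reachable.derivable_of_replaceUpTo (hB : B.SkolemFree) (hBpos : B.OnlySign true)
    (hr : r ≠ Om) (h : Reachable B Cr (r + 1) Θ) (hK : JustifiedUpTo B r K)
    (hsub : SubUpTo B r Θ K) (hd : Derivable B Cr (Rule.IsRPlus B r) (replaceUpTo B r K Θ)) :
    Derivable B Cr (Rule.IsRPlus B r) K := by
  induction h with
  | empty => rwa [hK.replaceUpTo_empty hr] at hd
  | @step Θ Θ' h R hR ha hp _ ih =>
    have hΘ := h.isSequent
    rcases hR.cut_or_fr_or_h with ⟨hcut, hle⟩ | ⟨e, rfl, he⟩ | ⟨e, v, rfl, he⟩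
    · have hp' := Rule.premise_of_mem hΘ ha hp
      refine ih ((hp'.subUpTo hr hΘ ha (by simp [hcut])).trans hsub) ?_
      rwa [(hp'.eqAbove hr hcut hle).replaceUpTo_eq hr]
    · cases hp
      have hnone : (replaceUpTo B r K Θ).S e = none :=
        (eqAbove_replaceUpTo.S_eq e he).trans ha.2
      refine ih ((hΘ.subUpTo_update ha.2).trans hsub)
        (.infer (isSequent_replaceUpTo hr hK.isSequent hΘ) (.fr e) he ⟨ha.1, hnone⟩ ?_)
      rintro _ rfl
      change Derivable B Cr _ ((replaceUpTo B r K Θ).update e .unk (some true))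
      rwa [update_replaceUpTo hr he]
    · cases hp
      have hsub' := (hΘ.eqUpTo_hStep he).subUpTo.trans hsub
      exact ih hsub' (.replaceUpTo_of_hStep hB hBpos hr hK hΘ hsub' he ha hd)

end Descent

/-! ### Cut reduction -/

section CutReduction

variable {B : Fm L 2} {r : Ordinal.{0}} {Θ Θ₀ Ξ Ξ' : Sequent L} {e e₁ x : CExpr L} {u v : Val}
  {f : Option Bool} {Pe : List ℕ} {Ve : ℕ → Option (Subst L)}

open Classical in
/-- The sequent `Θ` with the mark of `e` set to `t`. -/
def Sequent.markTrue (e : CExpr L) (Θ : Sequent L) : Sequent L :=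
  { Θ with F := Function.update Θ.F e (some true) }

theorem Sequent.markTrue_F_self : (Ξ.markTrue e).F e = some true := by simp [Sequent.markTrue]

theorem Sequent.markTrue_F_of_ne (hx : x ≠ e) : (Ξ.markTrue e).F x = Ξ.F x := by
  simp [Sequent.markTrue, hx]

theorem Sequent.markTrue_eq {Φ : Sequent L} (hS : Φ.S = Ξ.S) (hP : Φ.P = Ξ.P) (hV : Φ.V = Ξ.V)
    (he : Φ.F e = some true) (hF : ∀ x, x ≠ e → Φ.F x = Ξ.F x) : Φ = Ξ.markTrue e := by
  obtain ⟨S, P, V, F⟩ := Φ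
  obtain rfl : F = (Ξ.markTrue e).F := funext fun x => by
    by_cases hx : x = e
    · rw [hx, Sequent.markTrue_F_self, ← he]
    · rw [Sequent.markTrue_F_of_ne hx, ← hF x hx]
  simp only at hS hP hV
  rw [hS, hP, hV, Sequent.markTrue]

theorem Sequent.markTrue_update : (Θ.update e u f).markTrue e = Θ.update e u (some true) := by
  simp [Sequent.markTrue, Sequent.update]

open Classical in
theorem Sequent.update_markTrue (h : e₁ ≠ e) :
    (Ξ.markTrue e).update e₁ u f = (Ξ.update e₁ u f).markTrue e := by
  simp only [Sequent.markTrue, Sequent.update, Function.update_comm h]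

theorem Sequent.addForms_markTrue (he : e.IsTerm) (i : Bool) :
    (Ξ.markTrue e).addForms Pe Ve i = (Ξ.addForms Pe Ve i).markTrue e := by
  refine Sequent.markTrue_eq rfl rfl rfl ?_ fun x hx => ?_
  · rw [Sequent.addForms_F_of_isTerm i he, Sequent.markTrue_F_self]
  · cases x with
    | term φ a => exact Sequent.markTrue_F_of_ne hx
    | mem m => simp only [Sequent.addForms, Sequent.markTrue_F_of_ne hx]

theorem Sequent.IsSequent.markTrue (hΞ : Ξ.IsSequent B) (he : Ξ.S e = some .unk) :
    (Ξ.markTrue e).IsSequent B where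
  isSubst := hΞ.isSubst
  nodup := hΞ.nodup
  mem_P := hΞ.mem_P
  dom_V := hΞ.dom_V
  val_V := hΞ.val_V
  dom_F x := by
    by_cases hx : x = e
    · rw [hx, Sequent.markTrue_F_self]
      exact iff_of_true rfl (.inl he)
    · rw [Sequent.markTrue_F_of_ne hx]
      exact hΞ.dom_F x

theorem hStep_markTrue (hΞ : Ξ.IsSequent B) (he : Ξ.S e = some .unk)
    (h : hSubst B Ξ e₁ v e = some .unk) :
    hStep B (Ξ.markTrue e) e₁ v = (hStep B Ξ e₁ v).markTrue e := by
  refine Sequent.markTrue_eq rfl rfl rfl ?_ fun x hx => ?_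
  · rw [← Sequent.markTrue_F_self (Ξ := Ξ)]
    exact hStep_F_of_eq (hΞ.markTrue he) (h.trans he.symm)
  · simp only [hStep, Sequent.markTrue_F_of_ne hx]
    rfl

theorem hStep_markTrue_self (he : rk B e ≠ Om) (hv : v ≠ .unk) :
    hStep B (Ξ.markTrue e) e v = hStep B Ξ e v := by
  have hF : (hStep B (Ξ.markTrue e) e v).F = (hStep B Ξ e v).F := funext fun x => by
    by_cases hx : x = e
    · rw [hx, hStep_F_self he hv, hStep_F_self he hv]
    · simp only [hStep, Sequent.markTrue_F_of_ne hx]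
      rfl
  exact congrArg (Sequent.mk (hSubst B Ξ e v) (hSeq B Ξ e) (hHist B Ξ e)) hF

variable [L.Structure ℕ] {Cr : List (Crit L)} {R : Rule L}

theorem HApplies.markTrue (h : HApplies B Cr Ξ e₁ v) : HApplies B Cr (Ξ.markTrue e) e₁ v :=
  ⟨h.correct, h.decides_crit, h.computes, h.selected, h.decides_justif, h.decides_new, h.unk,
    h.mem_dom, h.cTerm_dom, h.mem_dom_of_unk⟩

theorem Rule.Applies.markTrue (ha : R.Applies B Cr Ξ) : R.Applies B Cr (Ξ.markTrue e) := by
  cases R with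
  | h e₁ v =>
    obtain ⟨hH, hF, hact⟩ := ha
    have hmark {x : CExpr L} (hx : Ξ.F x = some true) : (Ξ.markTrue e).F x = some true := by
      by_cases hxe : x = e
      · rw [hxe, Sequent.markTrue_F_self]
      · rw [Sequent.markTrue_F_of_ne hxe, hx]
    exact ⟨hH.markTrue, hmark hF, fun x hx => hmark (hact x hx)⟩
  | _ => exact ha

theorem Rule.Applies.exists_of_mem_premises_markTrue (ha : R.Applies B Cr Ξ) (hr : r ≠ Om)
    (hΞ : Ξ.IsSequent B) (her : rk B e = r) (he : Ξ.S e = some .unk) (hf : Ξ.F e = some false)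
    (hR : R.IsRPlus B r) (hp : Ξ' ∈ R.premises B (Ξ.markTrue e)) :
    ∃ Ξ'' ∈ R.premises B Ξ, Ξ' = Ξ''.markTrue e := by
  cases Rule.premise_of_mem (hΞ.markTrue he) ha.markTrue hp with
  | update h =>
    have hnone := ha.eq_none h.name_ne_H
    refine ⟨_, h.update_mem_premises hΞ hnone, Sequent.update_markTrue ?_⟩
    rintro rfl
    exact nomatch hnone.symm.trans he
  | addForms hP hV =>
    exact ⟨_, .inr ⟨_, _, ⟨hP.nodup, hP.unk, hP.admissible, hP.last, hP.disjoint, hP.fresh⟩, hV,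
      rfl⟩, Sequent.addForms_markTrue (isTerm_of_rk_ne (her ▸ hr)) false⟩
  | @hStep e₁ v h =>
    have hne : e ≠ e₁ := by
      rintro rfl
      exact nomatch hf.symm.trans ha.2.1
    exact ⟨_, rfl, hStep_markTrue hΞ he ((hSubst_of_rk_le hr hR her.le hne).trans he)⟩

theorem SubUpTo.premise (h : SubUpTo B r Θ₀ Ξ) (hr : r ≠ Om) (hΘ₀ : Θ₀.IsSequent B)
    (ht : Tame B (r + 1) Θ₀) (hΞ : Ξ.IsSequent B) (hR : R.IsRPlus B r) (ha : R.Applies B Cr Ξ)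
    (hp : R.Premise B Cr Ξ Ξ') : SubUpTo B r Θ₀ Ξ' := by
  by_cases hH : R.name = .H
  swap
  · exact h.trans (hp.subUpTo hr hΞ ha hH)
  cases hp with
  | update hA => exact absurd hH hA.name_ne_H
  | addForms => cases hH
  | @hStep e v hΞe =>
    have her : r ≤ rk B e := hR
    rcases her.lt_or_eq with hlt | heq
    · exact h.trans (hΞ.eqUpTo_hStep hlt).subUpTo
    refine h.hStep_right hr hΘ₀ hΞ heq.symm ?_
    by_contra hne
    obtain ⟨w, hw⟩ := Option.ne_none_iff_exists'.1 hne
    obtain rfl : w = .unk := Option.some.inj ((h.S_le e w heq.ge hw).symm.trans hΞe.unk)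
    have hfalse := h.F_false e heq.symm
      (hΘ₀.F_eq_false hw (ht.F_ne e (Order.lt_add_one_iff.2 heq.ge)))
    exact nomatch hfalse.symm.trans ha.2.1

theorem HApplies.decides_of_hStep (h : HApplies B Cr Ξ e v) (he : rk B e ≠ Om) (hx : x.IsTerm)
    (hu : (hStep B Ξ e v).S x = some u) : Decides Ξ.S (justif B x u) := by
  change hSubst B Ξ e v x = some u at hu
  by_cases hxe : x = e
  · subst hxe
    cases (hSubst_self B Ξ x v).symm.trans hu
    exact h.decides_new
  · rw [hSubst_of_rk_ne_Om he hxe] at hu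
    split_ifs at hu
    exact h.decides_justif x u hx hu

theorem HApplies.justifiedUpTo_hStep (hB : B.SkolemFree) (hBI : B.HasI) (hr : r ≠ Om)
    (her : rk B e = r) (h : HApplies B Cr Ξ e v) (hΞ : Ξ.IsSequent B) (ht : Tame B r Ξ)
    (hF : ¬ CompInconsistent B (hStep B Ξ e v).S) : JustifiedUpTo B r (hStep B Ξ e v) := by
  have he : rk B e ≠ Om := her ▸ hr
  obtain ⟨hv, hvu⟩ := h.fits hΞ.isSubst
  have hnone (x : CExpr L) (hx : r < rk B x) : (hStep B Ξ e v).S x = none := by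
    have hxe : x ≠ e := by rintro rfl; exact hx.ne her.symm
    exact (hSubst_of_rk_ne_Om he hxe).trans (if_neg (her ▸ hx.not_ge))
  refine ⟨hΞ.hStep hv h.unk hvu ?_, ht.hStep hΞ her.ge, hnone, fun x u hx hu => ?_⟩
  · rintro n rfl
    exact absurd rfl he
  have hxr : rk B x ≤ r := by
    by_contra hlt
    exact nomatch hu.symm.trans (hnone x (not_le.1 hlt))
  have hdec := decides_iff.1 (h.decides_of_hStep he hx hu)
  rw [← reduce_justif_congr hB hBI hr (fun y hy => hSubst_of_rk_lt (her ▸ hy)) hx hxr u] at hdec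
  exact (decides_iff.2 hdec).resolve_right fun hneg => hF (.inl ⟨x, u, hu, hneg⟩)

/-- The value `v` found by the `H`-step selects a side premise `(e, v), Θ` of the former cut. -/
theorem Derivable.hStep_of_reachable (hB : B.SkolemFree) (hBI : B.HasI) (hBpos : B.OnlySign true)
    (hr : r ≠ Om) (hΘ : Reachable B Cr (r + 1) Θ) (her : rk B e = r) (he : Θ.S e = none)
    (hnum : ∀ k, 0 < k → Derivable B Cr (Rule.IsRPlus B r) (Θ.addNum e k))
    (hΞ : Ξ.IsSequent B) (hsub : SubUpTo B r Θ Ξ) (ht : Tame B r Ξ) (h : HApplies B Cr Ξ e v) :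
    Derivable B Cr (Rule.IsRPlus B r) (hStep B Ξ e v) := by
  have hΘs := hΘ.isSequent
  have he_ne : rk B e ≠ Om := her ▸ hr
  obtain ⟨hv, hvu⟩ := h.fits hΞ.isSubst
  obtain ⟨k, hk, rfl⟩ := (hv.eq_unk_or_eq_num (isTerm_of_rk_ne he_ne)).resolve_left hvu
  by_cases hF : CompInconsistent B (hStep B Ξ e (.num k)).S
  · refine .of_compInconsistent (hΞ.hStep hv h.unk hvu ?_) hF
    rintro n rfl
    exact absurd rfl he_ne
  have hK := h.justifiedUpTo_hStep hB hBI hr her hΞ ht hF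
  have hsubK := hsub.hStep_right (v := .num k) hr hΘs hΞ her he
  have w := hK.isWeakening_replaceUpTo hr hΘs hsubK
  refine hΘ.derivable_of_replaceUpTo hB hBpos hr hK hsubK
    ((hnum k hk).stablyDerivable hB hBI hBpos hr _ ?_)
  rw [hΘs.addNum_eq_update he]
  exact w.update_left he ((eqUpTo_replaceUpTo.S_eq e her.le).trans (hSubst_self ..)) her.le nofun

theorem IsAxiom.derivable_markTrue (hr : r ≠ Om) (her : rk B e = r) (he : Ξ.S e = some .unk)
    (hΞ : Ξ.IsSequent B)
    (hstep : ∀ v, HApplies B Cr Ξ e v → Derivable B Cr (Rule.IsRPlus B r) (hStep B Ξ e v))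
    (h : IsAxiom B Cr Ξ) : Derivable B Cr (Rule.IsRPlus B r) (Ξ.markTrue e) := by
  have hΞ' := hΞ.markTrue he
  have he_ne : rk B e ≠ Om := her ▸ hr
  rcases h with h | h | ⟨e₁, v, hH, x, hx, hxf⟩
  · exact .ax hΞ' (.inl h)
  · exact .ax hΞ' (.inr (.inl h))
  by_cases hee : e₁ = e
  · subst hee
    refine .infer hΞ' (.h e₁ v) her.ge ⟨hH.markTrue, Sequent.markTrue_F_self, fun x hx => ?_⟩ ?_
    · rw [hx.eq_of_rk_ne he_ne, Sequent.markTrue_F_self]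
    · rintro _ rfl
      rw [hStep_markTrue_self he_ne (hH.fits hΞ.isSubst).2]
      exact hstep v hH
  · have hxe : x ≠ e := by
      rintro rfl
      exact hee (hx.eq_of_rk_ne (hx.2.1 ▸ he_ne)).symm
    exact .ax hΞ' (.inr (.inr ⟨e₁, v, hH.markTrue, x, hx,
      (Sequent.markTrue_F_of_ne hxe).trans hxf⟩))

theorem Derivable.markTrue (hr : r ≠ Om) (her : rk B e = r) (hΘ₀ : Θ₀.IsSequent B)
    (ht₀ : Tame B (r + 1) Θ₀) (he : Θ₀.S e = some .unk)
    (hstep : ∀ Ξ v, Ξ.IsSequent B → SubUpTo B r Θ₀ Ξ → Tame B r Ξ → HApplies B Cr Ξ e v →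
      Derivable B Cr (Rule.IsRPlus B r) (hStep B Ξ e v))
    (h : Derivable B Cr (Rule.IsRPlus B r) Ξ) (hsub : SubUpTo B r Θ₀ Ξ) (ht : Tame B r Ξ) :
    Derivable B Cr (Rule.IsRPlus B r) (Ξ.markTrue e) := by
  have hf : Θ₀.F e = some false :=
    hΘ₀.F_eq_false he (ht₀.F_ne e (Order.lt_add_one_iff.2 her.le))
  induction h with
  | @ax Ξ hΞ h =>
    exact h.derivable_markTrue hr her (hsub.S_le e _ her.le he) hΞ
      fun v => hstep Ξ v hΞ hsub ht
  | @infer Ξ hΞ R hR ha _ ih =>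
    have heΞ := hsub.S_le e _ her.le he
    refine .infer (hΞ.markTrue heΞ) R hR ha.markTrue fun Ξ' hp => ?_
    obtain ⟨Ξ'', hmem, rfl⟩ :=
      ha.exists_of_mem_premises_markTrue hr hΞ her heΞ (hsub.F_false e her hf) hR hp
    have hp' := Rule.premise_of_mem hΞ ha hmem
    exact ih Ξ'' hmem (hsub.premise hr hΘ₀ ht₀ hΞ hR ha hp')
      (ht.premise hΞ ha hR.name_eq_cut_or_le hp')

theorem Derivable.cutFr_of_cut (hB : B.SkolemFree) (hBI : B.HasI) (hBpos : B.OnlySign true)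
    (hr : r ≠ Om) (hΘ : Reachable B Cr (r + 1) Θ) (her : rk B e = r)
    (ha : (Rule.cut e).Applies B Cr Θ)
    (hd : ∀ Θ' ∈ (Rule.cut e).premises B Θ, Derivable B Cr (Rule.IsRPlus B r) Θ') :
    Derivable B Cr (Rule.IsRPlus B r) Θ := by
  have he : Θ.S e = none := ha.2.2.2
  have hnum k (hk : 0 < k) := hd _ (.inr ⟨k, hk, rfl⟩)
  have hunk := hd _ (.inl rfl)
  have ht : Tame B (r + 1) (Θ.addUnk e false) := hΘ.tame.update he nofun
  refine .infer hΘ.isSequent (.cutFr e) her ha ?_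
  rintro _ (rfl | ⟨k, hk, rfl⟩)
  · have hsub : SubUpTo B r Θ (Θ.addUnk e false) := hΘ.isSequent.subUpTo_update he
    have hmark := hunk.markTrue hr her hunk.isSequent ht Sequent.update_S_self
      (fun Ξ v hΞ h htΞ => hStep_of_reachable hB hBI hBpos hr hΘ her he hnum hΞ (hsub.trans h) htΞ)
      (.refl _) (ht.mono (Order.lt_add_one_iff.2 le_rfl).le)
    rwa [show (Θ.addUnk e false).markTrue e = Θ.addUnk e true from
      Sequent.markTrue_update] at hmark
  · exact hnum k hk

theorem Derivable.cut_reduction (hB : B.SkolemFree) (hBI : B.HasI) (hBpos : B.OnlySign true)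
    (hr : r ≠ Om) (h : Derivable B Cr (Rule.IsR B (r + 1)) Θ) (hΘ : Reachable B Cr (r + 1) Θ) :
    Derivable B Cr (Rule.IsRPlus B r) Θ := by
  induction h with
  | ax hΘs h => exact .ax hΘs h
  | @infer Θ hΘs R hR ha ds ih =>
    have ih' Θ' (hp : Θ' ∈ R.premises B Θ) :=
      ih Θ' hp (hΘ.step R hR ha hp (ds Θ' hp).isSequent)
    rcases hR.cut_or_fr_or_h with ⟨hcut, hle⟩ | ⟨e, rfl, he⟩ | ⟨e, v, rfl, he⟩
    · rcases hle.lt_or_eq with hlt | heq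
      · exact .infer hΘs R (by simpa only [Rule.IsRPlus, hcut] using hlt) ha ih'
      · cases R with
        | cut e => exact .cutFr_of_cut hB hBI hBpos hr hΘ heq ha ih'
        | cutTerm e => exact absurd (heq.symm.trans ha.2.2.1) hr
        | cutForm n => exact absurd heq.symm hr
        | _ => cases hcut
    · exact .infer hΘs (.fr e) he ha ih'
    · exact .infer hΘs (.h e v) he.le ha ih'

end CutReduction

end EpsID1

end

theorem mainTheorem4 {L : FirstOrder.Language.{0, 0}} [L.Structure ℕ]
    (B : Fm L 2) (hB : B.SkolemFree) (hBsimple : B.Simple) (hBI : B.HasI)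
    (hBpos : B.OnlySign true)
    (Cr : List (Crit L)) (hCr : ∀ c ∈ Cr, c.InLang)
    (r : Ordinal.{0}) (hr : r ≠ Om) (Θ : Sequent L)
    (d : EpsID1.Derivation B Cr Θ) (hd : d.IsR (r + 1)) (hΘ : HasRPath B Cr (r + 1) Θ) :
    ∃ d' : EpsID1.Derivation B Cr Θ, d'.IsRPlus r ∧ d'.prune.IsR r := by
  obtain ⟨d', hd'⟩ :=
    (Derivable.cut_reduction hB hBI hBpos hr (d.derivable hd) hΘ.reachable).exists_derivation
  exact ⟨d', hd', Deduction.IsRPlus.prune hd'⟩
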